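/- Consider the Cauchy problem on the real line $$m_t+2\,(u-u_{xx})_x\,m+(u-u_{xx})\,m_x=0,\qquad m=(1-\partial_x^2)^2u=u-2u_{xx}+u_{xxxx},\qquad u(\cdot,0)=u_0,$$ where $u$ is real-valued. For $0<T\le\infty$, a solution on $[0,T)$ is a function $u\in C([0,T);H^4(\mathbb R))\cap C^1([0,T);H^3(\mathbb R))$ with $u(0)=u_0$ that satisfies the equation in the sense of distributions on $\mathbb R$ at every time $t\in[0,T)$. Let $u_0\in H^4(\mathbb R)$, put $$E_0=\Big(\int_{\mathbb R}\big(u_0^2+3u_{0x}^2+3u_{0xx}^2+u_{0xxx}^2\big)\,dx\Big)^{1/2},$$ and suppose that there is a point $x_0\in\mathbb R$ such that $$\varphi_0:=(u_{0x}-u_{0xxx})(x_0)<-\frac{E_0}{\sqrt2}$$ (the value at $x_0$ is that of the continuous representative). Then the Cauchy problem has a unique maximal solution $u$ (every other solution is a restriction of it to a shorter time interval), and $u$ blows up in finite time: its lifespan $T$ is finite, $\lim_{t\to T^-}\|u(t)\|_{H^4}=\infty$, and $$T\le\frac{1}{-\frac12\varphi_0+\frac{E_0^2}{4\varphi_0}}.$$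 In particular, if $\varphi_0<-E_0$, then also $$T\le\frac{1}{-\frac12\varphi_0+\frac{E_0^2}{2\varphi_0}}.$$ -/

import Mathlib

open MeasureTheory Set Filter Topology
open scoped ContDiff

noncomputable section

namespace CHType

/-- Real-valued square-integrable functions on the line. -/
abbrev L2 : Type := Lp ℝ 2 (volume : Measure ℝ)

/-- `g` is the weak (distributional) derivative of `f`. -/
def IsWeakDeriv (f g : L2) : Prop :=
  ∀ η : ℝ → ℝ, ContDiff ℝ ∞ η → HasCompactSupport η →
    ∫ x, f x * deriv η x = -∫ x, g x * η x

theorem L2.locallyIntegrable (f : L2) : LocallyIntegrable (f : ℝ → ℝ) volume :=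
  (Lp.memLp f).locallyIntegrable (by norm_num)

theorem exists_support_subset {η : ℝ → ℝ} (hc : HasCompactSupport η) :
    ∃ R : ℝ, 0 < R ∧ tsupport η ⊆ Ioo (-R) R := by
  obtain ⟨R, hR0, hR⟩ := hc.isCompact.isBounded.subset_ball_lt 0 0
  refine ⟨R, hR0, ?_⟩
  rwa [Real.ball_eq_Ioo, zero_sub, zero_add] at hR

theorem primitive_by_parts {g : ℝ → ℝ} (hg : LocallyIntegrable g volume)
    {η : ℝ → ℝ} (hη : ContDiff ℝ ∞ η) (hc : HasCompactSupport η) :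
    ∫ x, (∫ y in (0 : ℝ)..x, g y) * deriv η x = -∫ x, g x * η x := by
  obtain ⟨R, hR0, hR⟩ := exists_support_subset hc
  have hR1 : tsupport η ⊆ Ioc (-R) R := hR.trans Ioo_subset_Ioc_self
  have hz : ∀ x, x ∉ Ioo (-R) R → η x = 0 := fun x hx =>
    image_eq_zero_of_notMem_tsupport (fun h => hx (hR h))
  have hgi : IntervalIntegrable g volume (-R) R := (hg.integrableOn_isCompact isCompact_uIcc).intervalIntegrable
  have hF := hgi.absolutelyContinuousOnInterval_intervalIntegral (c := 0)
    (by rw [uIcc_of_le (by linarith)]; constructor <;> linarith)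
  have hE : AbsolutelyContinuousOnInterval η (-R) R :=
    (hη.of_le (by exact_mod_cast le_top : (1 : WithTop ℕ∞) ≤ ∞)).contDiffOn.absolutelyContinuousOnInterval
  have key := hF.integral_mul_deriv_eq_deriv_mul hE
  rw [hz R (by simp), hz (-R) (by simp)] at key
  rw [← intervalIntegral.integral_eq_integral_of_support_subset (a := -R) (b := R),
    ← intervalIntegral.integral_eq_integral_of_support_subset (a := -R) (b := R), key]
  · simp only [mul_zero, sub_zero, zero_sub]
    congr 1
    apply intervalIntegral.integral_congr_ae
    filter_upwards [LocallyIntegrable.ae_hasDerivAt_integral hg] with x hx _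
    rw [(hx 0).deriv]
  · intro x hx
    by_contra h
    exact hx (by simp [image_eq_zero_of_notMem_tsupport (fun h' => h (hR1 h'))])
  · intro x hx
    by_contra h
    refine hx ?_
    have : deriv η x = 0 :=
      image_eq_zero_of_notMem_tsupport (fun h' => h (hR1 (tsupport_deriv_subset (𝕜 := ℝ) h')))
    simp [this]

theorem exists_compact_primitive {ψ : ℝ → ℝ} (hψ : ContDiff ℝ ∞ ψ) (hc : HasCompactSupport ψ)
    (h0 : ∫ x, ψ x = 0) :
    ∃ η : ℝ → ℝ, ContDiff ℝ ∞ η ∧ HasCompactSupport η ∧ deriv η = ψ := by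
  obtain ⟨R, hR0, hR⟩ := exists_support_subset hc
  have hz : ∀ x, x ∉ Ioo (-R) R → ψ x = 0 := fun x hx =>
    image_eq_zero_of_notMem_tsupport (fun h => hx (hR h))
  have hd : ∀ x, HasDerivAt (fun x => ∫ y in (-R)..x, ψ y) (ψ x) x := fun x =>
    hψ.continuous.integral_hasStrictDerivAt (-R) x |>.hasDerivAt
  have hd' : deriv (fun x => ∫ y in (-R)..x, ψ y) = ψ := funext fun x => (hd x).deriv
  refine ⟨fun x => ∫ y in (-R)..x, ψ y, ?_, ?_, hd'⟩
  · rw [contDiff_infty_iff_deriv, hd']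
    exact ⟨fun x => (hd x).differentiableAt, hψ⟩
  · refine HasCompactSupport.intro (isCompact_Icc (a := -R) (b := R)) fun x hx => ?_
    simp only [mem_Icc, not_and_or, not_le] at hx
    rcases hx with hx | hx
    · rw [intervalIntegral.integral_congr (g := fun _ => (0 : ℝ))]
      · simp
      · intro y hy
        rw [uIcc_of_ge hx.le] at hy
        exact hz y (fun h => by linarith [hy.2, h.1])
    · rw [intervalIntegral.integral_eq_integral_of_support_subset, h0]
      intro y hy
      by_contra h
      exact hy (hz y (fun h' => h ⟨h'.1, by linarith [h'.2]⟩))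

/-- A square-integrable function with a square-integrable weak derivative has a continuous
representative. -/
theorem exists_continuous_rep {f g : L2} (h : IsWeakDeriv f g) :
    ∃ F : ℝ → ℝ, Continuous F ∧ F =ᵐ[volume] f := by
  have hg := L2.locallyIntegrable g
  have hf := L2.locallyIntegrable f
  set P : ℝ → ℝ := fun x => ∫ y in (0 : ℝ)..x, g y with hP
  have hPc : Continuous P := intervalIntegral.continuous_primitive
    (fun a b => (hg.integrableOn_isCompact isCompact_uIcc).intervalIntegrable) 0
  obtain ⟨b⟩ : Nonempty (ContDiffBump (0 : ℝ)) := ⟨⟨1, 2, by norm_num, by norm_num⟩⟩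
  set ψ₀ : ℝ → ℝ := b.normed volume with hψ₀
  have h₀s : ContDiff ℝ ∞ ψ₀ := b.contDiff_normed
  have h₀c : HasCompactSupport ψ₀ := b.hasCompactSupport_normed
  have h₀i : ∫ x, ψ₀ x = 1 := b.integral_normed
  set k : ℝ → ℝ := fun x => f x - P x with hk
  have hkl : LocallyIntegrable k volume := hf.sub hPc.locallyIntegrable
  have int : ∀ {w ψ : ℝ → ℝ}, LocallyIntegrable w volume → Continuous ψ → HasCompactSupport ψ →
      Integrable (fun x => w x * ψ x) volume := fun hw hψ hc => by
    simpa [mul_comm] using hw.integrable_smul_left_of_hasCompactSupport hψ hc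
  have h1 : ∀ η : ℝ → ℝ, ContDiff ℝ ∞ η → HasCompactSupport η → ∫ x, k x * deriv η x = 0 := by
    intro η hη hc
    have hd : Continuous (deriv η) := (contDiff_infty_iff_deriv.1 hη).2.continuous
    simp only [hk, sub_mul]
    rw [integral_sub (int hf hd hc.deriv) (int hPc.locallyIntegrable hd hc.deriv),
      h η hη hc, primitive_by_parts hg hη hc, sub_self]
  set c : ℝ := ∫ x, k x * ψ₀ x with hc0
  have h2 : ∀ᵐ x, k x = c := by
    refine ae_eq_of_integral_contDiff_smul_eq hkl continuous_const.locallyIntegrable ?_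
    intro ψ hψ hc
    have hψi := hψ.continuous.integrable_of_hasCompactSupport hc (μ := volume)
    have h₀int := h₀s.continuous.integrable_of_hasCompactSupport h₀c (μ := volume)
    obtain ⟨η, hη, hηc, hηd⟩ := exists_compact_primitive
      (ψ := fun x => ψ x - (∫ y, ψ y) * ψ₀ x) (hψ.sub (contDiff_const.mul h₀s))
      (hc.sub h₀c.mul_left)
      (by rw [integral_sub hψi (h₀int.const_mul _), integral_const_mul, h₀i]; ring)
    have h3 := h1 η hη hηc
    rw [hηd] at h3
    have h4 : ∀ x, k x * (ψ x - (∫ y, ψ y) * ψ₀ x)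
        = k x * ψ x - (∫ y, ψ y) * (k x * ψ₀ x) := fun x => by ring
    simp only [h4] at h3
    rw [integral_sub (int hkl hψ.continuous hc)
      ((int hkl h₀s.continuous h₀c).const_mul _), integral_const_mul] at h3
    simp only [smul_eq_mul]
    rw [integral_mul_const]
    have : ∫ x, ψ x * k x = ∫ x, k x * ψ x := by simp only [mul_comm]
    rw [this]; linarith
  refine ⟨fun x => c + P x, continuous_const.add hPc, ?_⟩
  filter_upwards [h2] with x hx
  rw [← hx]; simp [hk]

theorem IsWeakDeriv.zero : IsWeakDeriv 0 0 := by
  intro η _ _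
  rw [integral_eq_zero_of_ae, integral_eq_zero_of_ae, neg_zero]
  · exact Eventually.of_forall fun x => by simp
  · exact Eventually.of_forall fun x => by simp

theorem IsWeakDeriv.add {f g f' g' : L2} (hf : IsWeakDeriv f f') (hg : IsWeakDeriv g g') :
    IsWeakDeriv (f + g) (f' + g') := by
  intro η hη hc
  have int : ∀ (w : L2) (ψ : ℝ → ℝ), Continuous ψ → HasCompactSupport ψ →
      Integrable (fun x => w x * ψ x) volume := fun w ψ hψ hc => by
    simpa [mul_comm] using
      (L2.locallyIntegrable w).integrable_smul_left_of_hasCompactSupport hψ hc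
  have hd : Continuous (deriv η) := (contDiff_infty_iff_deriv.1 hη).2.continuous
  have e1 : ∫ x, (f + g : L2) x * deriv η x = ∫ x, (f x * deriv η x + g x * deriv η x) := by
    apply integral_congr_ae
    filter_upwards [Lp.coeFn_add f g] with x hx
    rw [hx, Pi.add_apply, add_mul]
  have e2 : ∫ x, (f' + g' : L2) x * η x = ∫ x, (f' x * η x + g' x * η x) := by
    apply integral_congr_ae
    filter_upwards [Lp.coeFn_add f' g'] with x hx
    rw [hx, Pi.add_apply, add_mul]
  rw [e1, e2, integral_add (int f _ hd hc.deriv) (int g _ hd hc.deriv),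
    integral_add (int f' _ hη.continuous hc) (int g' _ hη.continuous hc), hf η hη hc, hg η hη hc]
  ring

theorem IsWeakDeriv.smul {f f' : L2} (c : ℝ) (hf : IsWeakDeriv f f') :
    IsWeakDeriv (c • f) (c • f') := by
  intro η hη hc
  have e1 : ∫ x, (c • f : L2) x * deriv η x = ∫ x, c * (f x * deriv η x) := by
    apply integral_congr_ae
    filter_upwards [Lp.coeFn_smul c f] with x hx
    rw [hx, Pi.smul_apply, smul_eq_mul, mul_assoc]
  have e2 : ∫ x, (c • f' : L2) x * η x = ∫ x, c * (f' x * η x) := by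
    apply integral_congr_ae
    filter_upwards [Lp.coeFn_smul c f'] with x hx
    rw [hx, Pi.smul_apply, smul_eq_mul, mul_assoc]
  rw [e1, e2, integral_const_mul, integral_const_mul, hf η hη hc, mul_neg]

theorem IsWeakDeriv.sub {f g f' g' : L2} (hf : IsWeakDeriv f f') (hg : IsWeakDeriv g g') :
    IsWeakDeriv (f - g) (f' - g') := by
  have h := hf.add (hg.smul (-1))
  simpa [sub_eq_add_neg] using h

/-- The Sobolev space `H^k(ℝ)` of real-valued functions. An element is the tuple
`(u, ∂ₓu, …, ∂ₓᵏu)` of a function in `L²` together with its weak derivatives (which `u` determines)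
up to order `k`, all in `L²`. The norm inherited from the `ℓ²`-sum of copies of `L²` is the usual
one, `‖u‖² = ∑ j ≤ k, ‖∂ₓʲu‖²`. -/
def sobolevSubmodule (k : ℕ) : Submodule ℝ (PiLp 2 (fun _ : Fin (k + 1) => L2)) where
  carrier := {U | ∀ i : Fin k, IsWeakDeriv (U i.castSucc) (U i.succ)}
  zero_mem' := fun _ => IsWeakDeriv.zero
  add_mem' := fun hU hV i => (hU i).add (hV i)
  smul_mem' := fun c _ hU i => (hU i).smul c

/-- The normed space `H^k(ℝ)`. -/
abbrev Sobolev (k : ℕ) : Type := sobolevSubmodule k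

/-- `U.d j` is the weak derivative `∂ₓʲ u`. -/
def Sobolev.d {k : ℕ} (U : Sobolev k) (j : Fin (k + 1)) : L2 :=
  (U : PiLp 2 (fun _ : Fin (k + 1) => L2)) j

/-- The inclusion `H^(k+1)(ℝ) ⊆ H^k(ℝ)`. -/
def Sobolev.incl {k : ℕ} (U : Sobolev (k + 1)) : Sobolev k :=
  ⟨WithLp.toLp 2 (fun j : Fin (k + 1) => U.d j.castSucc), fun i => U.2 i.castSucc⟩

/-- `v = u - u_xx`. -/
def Sobolev.v (U : Sobolev 4) : L2 := U.d 0 - U.d 2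

/-- `v_x = u_x - u_xxx`. -/
def Sobolev.vx (U : Sobolev 4) : L2 := U.d 1 - U.d 3

/-- `m = (1 - ∂ₓ²)² u = u - 2 u_xx + u_xxxx`. -/
def Sobolev.m (U : Sobolev 4) : L2 := U.d 0 - (2 : ℝ) • U.d 2 + U.d 4

theorem Sobolev.isWeakDeriv_vx (U : Sobolev 4) : IsWeakDeriv U.vx (U.d 2 - U.d 4) :=
  (show IsWeakDeriv (U.d 1) (U.d 2) from U.2 1).sub (show IsWeakDeriv (U.d 3) (U.d 4) from U.2 3)

/-- The continuous representative of `u_x - u_xxx`, through which its values at points are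
understood (it is unique, since continuous functions that agree almost everywhere are equal). -/
def Sobolev.vxRep (U : Sobolev 4) : ℝ → ℝ :=
  Classical.choose (exists_continuous_rep U.isWeakDeriv_vx)

theorem Sobolev.continuous_vxRep (U : Sobolev 4) : Continuous U.vxRep :=
  (Classical.choose_spec (exists_continuous_rep U.isWeakDeriv_vx)).1

theorem Sobolev.vxRep_ae_eq (U : Sobolev 4) : U.vxRep =ᵐ[volume] U.vx :=
  (Classical.choose_spec (exists_continuous_rep U.isWeakDeriv_vx)).2

/-- `E₀ = (∫ u² + 3 u_x² + 3 u_xx² + u_xxx² dx)^(1/2)`. -/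
def Sobolev.E₀ (U : Sobolev 4) : ℝ :=
  √(∫ x, ((U.d 0 x) ^ 2 + 3 * (U.d 1 x) ^ 2 + 3 * (U.d 2 x) ^ 2 + (U.d 3 x) ^ 2))

/-- The equation `m_t + 2 v_x m + v m_x = 0` at a fixed time, in the sense of distributions on the
line, where `ut` stands for `u_t`, so that `m_t = (1 - ∂ₓ²)² ut`. Paired with a test function `η`,
the three terms are `∫ ut (1 - ∂ₓ²)² η`, `∫ 2 v_x m η` and `⟨m_x, v η⟩ = -∫ m (v_x η + v η_x)`. -/
def SatisfiesEquation (U : Sobolev 4) (ut : Sobolev 3) : Prop :=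
  ∀ η : ℝ → ℝ, ContDiff ℝ ∞ η → HasCompactSupport η →
    (∫ x, ut.d 0 x * (η x - 2 * iteratedDeriv 2 η x + iteratedDeriv 4 η x))
      + (∫ x, 2 * U.vx x * U.m x * η x)
      - (∫ x, U.m x * (U.vx x * η x + U.v x * deriv η x)) = 0

/-- The time interval `[0, T)`, where `T = ∞` is allowed. -/
def timeInterval (T : EReal) : Set ℝ := {t | 0 ≤ t ∧ (t : EReal) < T}

/-- `u ∈ C([0,T); H⁴) ∩ C¹([0,T); H³)` solves the Cauchy problem on `[0, T)` with initial value
`u₀`. -/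
def IsSolution (u₀ : Sobolev 4) (T : EReal) (u : ℝ → Sobolev 4) : Prop :=
  u 0 = u₀ ∧ ContinuousOn u (timeInterval T) ∧
    ∃ ut : ℝ → Sobolev 3, ContinuousOn ut (timeInterval T) ∧
      ∀ t ∈ timeInterval T,
        HasDerivWithinAt (fun s => (u s).incl) (ut t) (timeInterval T) t ∧
        SatisfiesEquation (u t) (ut t)

/-- `u` is the solution of the Cauchy problem and `T` is its lifespan: `T` is the largest time
for which there is a solution on `[0, T)`, and every solution is a restriction of `u`. -/
def IsMaximalSolution (u₀ : Sobolev 4) (T : EReal) (u : ℝ → Sobolev 4) : Prop :=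
  0 < T ∧ IsSolution u₀ T u ∧
    ∀ (T' : EReal) (w : ℝ → Sobolev 4), IsSolution u₀ T' w →
      T' ≤ T ∧ ∀ t ∈ timeInterval T', w t = u t

end CHType
end

noncomputable section

namespace CHType

/-! Put v = u - u_xx. Then m = v - v_xx, so the equation is the Camassa–Holm equation for v, with u
in H⁴ corresponding to v in H². Integration by parts shows that E₀ is the H¹ norm of v at time 0
(`Sobolev.E₀_eq`), and φ₀ is v_x at x₀.

Blow-up. Testing the equation with v itself shows that the H¹ norm of v is conserved
(`IsSolution.norm_vH`). The material derivative z = v_t + v v_x equals -P_x, where P - P_xx = v² +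
v_x²/2, so z_x = v² + v_x²/2 - P. Since P ≥ v²/2 (`sq_le_two_mul_pressure`) and v² ≤ E₀²/2
(`H1.rep_sq_le`), one gets z_x ≤ E₀²/4 + v_x²/2. Formally, v_x along a characteristic then satisfies
R' ≤ E₀²/4 - R²/2, and a Riccati comparison (`riccati_lifespan`) bounds the lifespan. For v merely
in H², v_x need not be differentiable along a characteristic. The Riccati inequality is therefore
proved for the difference quotient of v between two characteristics, with an error controlled by the
Hölder continuity of v_x (`IsSolution.le_lifespan_slope`), and the second starting point is sent to
x₀ (`IsSolution.le_lifespan`).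

Local existence. Let q be the flow of v and a = log q_ξ. The equation says that m(q) q_ξ² is
constant in time, and v_x is the convolution of m with the derivative of the Green function of 1 -
∂ₓ². Hence a solves an autonomous ordinary differential equation in the bounded continuous
functions, whose right-hand side is locally Lipschitz although the kernel jumps: flows preserve
order, so two flows always see the same side of the jump (`IsDecayKernel.abs_lagrangeOp_sub_le`).
Picard–Lindelöf gives an existence time depending only on a bound for the L² norm of m. Transporting
m back to Eulerian variables and inverting (1 - ∂ₓ²)² gives u (`exists_local_solution`).

Maximality. An H¹ energy estimate for the difference of two solutions gives uniqueness, so local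
solutions can be glued. The lifespan is the supremum of the existence times, finite by the blow-up
bound, and the uniform existence time forces the H⁴ norm to infinity there. -/

/-! ### Absolutely continuous functions as primitives -/

/-- `F` is a primitive of the locally integrable function `f`. -/
structure IsPrimitive (F f : ℝ → ℝ) : Prop where
  locInt : LocallyIntegrable f volume
  sub_eq : ∀ a b, F b - F a = ∫ x in a..b, f x

namespace IsPrimitive

theorem intervalIntegrable {F f : ℝ → ℝ} (h : IsPrimitive F f) (a b : ℝ) :
    IntervalIntegrable f volume a b :=
  (h.locInt.integrableOn_isCompact isCompact_uIcc).intervalIntegrable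

theorem eq_add {F f : ℝ → ℝ} (h : IsPrimitive F f) (a : ℝ) :
    F = fun b => F a + ∫ x in a..b, f x := by
  ext b; rw [← h.sub_eq a b]; ring

theorem continuous {F f : ℝ → ℝ} (h : IsPrimitive F f) : Continuous F := by
  rw [h.eq_add 0]
  exact continuous_const.add (intervalIntegral.continuous_primitive h.intervalIntegrable 0)

theorem absolutelyContinuousOnInterval {F f : ℝ → ℝ} (h : IsPrimitive F f) (a b : ℝ) :
    AbsolutelyContinuousOnInterval F a b := by
  rw [h.eq_add a]
  have h1 := (h.intervalIntegrable a b).absolutelyContinuousOnInterval_intervalIntegral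
    (c := a) left_mem_uIcc
  have h2 : AbsolutelyContinuousOnInterval (fun _ : ℝ => F a) a b :=
    (contDiff_const (n := 1)).contDiffOn.absolutelyContinuousOnInterval
  exact h2.add h1

theorem ae_hasDerivAt {F f : ℝ → ℝ} (h : IsPrimitive F f) : ∀ᵐ x, HasDerivAt F (f x) x := by
  filter_upwards [LocallyIntegrable.ae_hasDerivAt_integral h.locInt] with x hx
  rw [h.eq_add 0]
  exact (hx 0).const_add _

theorem congr {F f g : ℝ → ℝ} (h : IsPrimitive F f) (hfg : f =ᵐ[volume] g) : IsPrimitive F g where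
  locInt := h.locInt.congr hfg
  sub_eq a b := by
    rw [h.sub_eq]
    exact intervalIntegral.integral_congr_ae (hfg.mono fun x hx _ => hx)

theorem of_hasDerivAt {F f : ℝ → ℝ} (h : ∀ x, HasDerivAt F (f x) x) (hf : Continuous f) :
    IsPrimitive F f where
  locInt := hf.locallyIntegrable
  sub_eq a b :=
    (intervalIntegral.integral_eq_sub_of_hasDerivAt (fun x _ => h x)
      (hf.intervalIntegrable a b)).symm

theorem mul {F f G g : ℝ → ℝ} (hF : IsPrimitive F f) (hG : IsPrimitive G g) :
    IsPrimitive (fun x => F x * G x) (fun x => f x * G x + F x * g x) where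
  locInt := by
    refine LocallyIntegrable.add ?_ ?_
    · simpa [mul_comm] using hF.locInt.smul_continuous hG.continuous
    · simpa [mul_comm] using hG.locInt.smul_continuous hF.continuous
  sub_eq a b := by
    rw [← (hF.absolutelyContinuousOnInterval a b).integral_deriv_mul_eq_sub
      (hG.absolutelyContinuousOnInterval a b)]
    apply intervalIntegral.integral_congr_ae
    filter_upwards [hF.ae_hasDerivAt, hG.ae_hasDerivAt] with x hx hy _
    rw [hx.deriv, hy.deriv]

/-- Integrability of `h` gives `H` a limit at infinity, and integrability of `H` on a half-line of
infinite measure forces that limit to be zero. -/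
theorem integral_Ioi {H h : ℝ → ℝ} (hH : IsPrimitive H h) {x : ℝ} (hi : IntegrableOn H (Ioi x))
    (hi' : IntegrableOn h (Ioi x)) : ∫ y in Ioi x, h y = -H x := by
  have h1 := intervalIntegral_tendsto_integral_Ioi x hi' tendsto_id
  have h2 : Tendsto H atTop (𝓝 (H x + ∫ y in Ioi x, h y)) := by
    rw [hH.eq_add x]
    simpa using h1.const_add (H x)
  have h3 : H x + ∫ y in Ioi x, h y = 0 := by
    have : IntegrableAtFilter H atTop volume := ⟨Ioi x, Ioi_mem_atTop x, hi⟩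
    refine IntegrableAtFilter.eq_zero_of_tendsto this ?_ h2
    intro s hs
    obtain ⟨b, hb⟩ := mem_atTop_sets.1 hs
    rw [← top_le_iff, ← Real.volume_Ici (a := b)]
    exact measure_mono hb
  linarith

theorem integral_Iic {H h : ℝ → ℝ} (hH : IsPrimitive H h) {x : ℝ} (hi : IntegrableOn H (Iic x))
    (hi' : IntegrableOn h (Iic x)) : ∫ y in Iic x, h y = H x := by
  have h1 := intervalIntegral_tendsto_integral_Iic x hi' tendsto_id
  have h2 : Tendsto H atBot (𝓝 (H x - ∫ y in Iic x, h y)) := by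
    refine (h1.const_sub (H x)).congr fun y => ?_
    rw [id, ← hH.sub_eq]; ring
  have h3 : H x - ∫ y in Iic x, h y = 0 := by
    have : IntegrableAtFilter H atBot volume := ⟨Iic x, Iic_mem_atBot x, hi⟩
    refine IntegrableAtFilter.eq_zero_of_tendsto this ?_ h2
    intro s hs
    obtain ⟨b, hb⟩ := mem_atBot_sets.1 hs
    rw [← top_le_iff, ← Real.volume_Iic (a := b)]
    exact measure_mono hb
  linarith

theorem integral_eq_zero {H h : ℝ → ℝ} (hH : IsPrimitive H h) (hi : Integrable H)
    (hi' : Integrable h) : ∫ y, h y = 0 := by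
  rw [← intervalIntegral.integral_Iic_add_Ioi (b := 0) hi'.integrableOn hi'.integrableOn,
    hH.integral_Ioi hi.integrableOn hi'.integrableOn, hH.integral_Iic hi.integrableOn
    hi'.integrableOn]
  ring

theorem isWeakDeriv {F f : ℝ → ℝ} (h : IsPrimitive F f) {u u' : L2} (hu : F =ᵐ[volume] u)
    (hu' : f =ᵐ[volume] u') : IsWeakDeriv u u' := by
  intro η hη hc
  have hd : Continuous (deriv η) := (contDiff_infty_iff_deriv.1 hη).2.continuous
  have hE : IsPrimitive η (deriv η) :=
    of_hasDerivAt (fun x => ((contDiff_infty_iff_deriv.1 hη).1 x).hasDerivAt) hd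
  have int : ∀ {w ψ : ℝ → ℝ}, LocallyIntegrable w volume → Continuous ψ → HasCompactSupport ψ →
      Integrable (fun x => w x * ψ x) volume := fun hw hψ hc => by
    simpa [mul_comm] using hw.integrable_smul_left_of_hasCompactSupport hψ hc
  have i1 := int h.continuous.locallyIntegrable hη.continuous hc
  have i2 := int h.locInt hη.continuous hc
  have i3 := int h.continuous.locallyIntegrable hd hc.deriv
  have := (h.mul hE).integral_eq_zero i1 (i2.add i3)
  rw [integral_add i2 i3] at this
  have e1 : ∫ x, u x * deriv η x = ∫ x, F x * deriv η x :=
    integral_congr_ae (hu.mono fun x hx => by simp only [hx])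
  have e2 : ∫ x, u' x * η x = ∫ x, f x * η x :=
    integral_congr_ae (hu'.mono fun x hx => by simp only [hx])
  rw [e1, e2]; linarith

end IsPrimitive

/-! ### Sobolev spaces on the line: representatives, embedding, products -/

/-- The continuous representative is a primitive of the weak derivative. -/
theorem IsWeakDeriv.exists_isPrimitive {f g : L2} (h : IsWeakDeriv f g) :
    ∃ F : ℝ → ℝ, IsPrimitive F g ∧ F =ᵐ[volume] f := by
  have hg := L2.locallyIntegrable g
  have hf := L2.locallyIntegrable f
  set P : ℝ → ℝ := fun x => ∫ y in (0 : ℝ)..x, g y with hP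
  have hPp : IsPrimitive P g := ⟨hg, fun a b => by
    have hi : ∀ a b, IntervalIntegrable g volume a b := fun a b =>
      (hg.integrableOn_isCompact isCompact_uIcc).intervalIntegrable
    exact intervalIntegral.integral_interval_sub_left (hi _ _) (hi _ _)⟩
  have hPc := hPp.continuous
  obtain ⟨b⟩ : Nonempty (ContDiffBump (0 : ℝ)) := ⟨⟨1, 2, by norm_num, by norm_num⟩⟩
  set ψ₀ : ℝ → ℝ := b.normed volume with hψ₀
  have h₀s : ContDiff ℝ ∞ ψ₀ := b.contDiff_normed
  have h₀c : HasCompactSupport ψ₀ := b.hasCompactSupport_normed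
  have h₀i : ∫ x, ψ₀ x = 1 := b.integral_normed
  set k : ℝ → ℝ := fun x => f x - P x with hk
  have hkl : LocallyIntegrable k volume := hf.sub hPc.locallyIntegrable
  have int : ∀ {w ψ : ℝ → ℝ}, LocallyIntegrable w volume → Continuous ψ → HasCompactSupport ψ →
      Integrable (fun x => w x * ψ x) volume := fun hw hψ hc => by
    simpa [mul_comm] using hw.integrable_smul_left_of_hasCompactSupport hψ hc
  have h1 : ∀ η : ℝ → ℝ, ContDiff ℝ ∞ η → HasCompactSupport η → ∫ x, k x * deriv η x = 0 := by
    intro η hη hc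
    have hd : Continuous (deriv η) := (contDiff_infty_iff_deriv.1 hη).2.continuous
    simp only [hk, sub_mul]
    rw [integral_sub (int hf hd hc.deriv) (int hPc.locallyIntegrable hd hc.deriv),
      h η hη hc, primitive_by_parts hg hη hc, sub_self]
  set c : ℝ := ∫ x, k x * ψ₀ x with hc0
  -- The du Bois-Reymond argument: a test function minus its integral times `ψ₀` has mean zero,
  -- hence is the derivative of a test function and is annihilated by `k`.
  have h2 : ∀ᵐ x, k x = c := by
    refine ae_eq_of_integral_contDiff_smul_eq hkl continuous_const.locallyIntegrable ?_
    intro ψ hψ hc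
    have hψi := hψ.continuous.integrable_of_hasCompactSupport hc (μ := volume)
    have h₀int := h₀s.continuous.integrable_of_hasCompactSupport h₀c (μ := volume)
    obtain ⟨η, hη, hηc, hηd⟩ := exists_compact_primitive
      (ψ := fun x => ψ x - (∫ y, ψ y) * ψ₀ x) (hψ.sub (contDiff_const.mul h₀s))
      (hc.sub h₀c.mul_left)
      (by rw [integral_sub hψi (h₀int.const_mul _), integral_const_mul, h₀i]; ring)
    have h3 := h1 η hη hηc
    rw [hηd] at h3
    have h4 : ∀ x, k x * (ψ x - (∫ y, ψ y) * ψ₀ x)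
        = k x * ψ x - (∫ y, ψ y) * (k x * ψ₀ x) := fun x => by ring
    simp only [h4] at h3
    rw [integral_sub (int hkl hψ.continuous hc)
      ((int hkl h₀s.continuous h₀c).const_mul _), integral_const_mul] at h3
    simp only [smul_eq_mul]
    rw [integral_mul_const]
    have : ∫ x, ψ x * k x = ∫ x, k x * ψ x := by simp only [mul_comm]
    rw [this]; linarith
  refine ⟨fun x => c + P x, ⟨hg, fun x y => by rw [← hPp.sub_eq]; ring⟩, ?_⟩
  filter_upwards [h2] with x hx
  rw [← hx]; simp [hk]

/-- The Hilbert space `H¹(ℝ)`. -/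
abbrev H1 : Type := Sobolev 1

theorem continuous_testPairing (ψ : ℝ → ℝ) (hψ : Continuous ψ) (hc : HasCompactSupport ψ) :
    Continuous fun f : L2 => ∫ x, f x * ψ x := by
  have hm : MemLp ψ 2 (volume : Measure ℝ) := hψ.memLp_of_hasCompactSupport hc
  have : (fun f : L2 => ∫ x, f x * ψ x) = fun f : L2 => inner ℝ hm.toLp f := by
    ext f
    rw [L2.inner_def]
    refine integral_congr_ae ?_
    filter_upwards [hm.coeFn_toLp] with x hx
    simp [hx]
  rw [this]
  fun_prop

/-- Each condition defining a weak derivative is an equality of continuous functionals. Closedness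
yields completeness, which the adjoints defining the resolvents and the calculus of H¹-valued
integrals require. -/
theorem isClosed_sobolevSubmodule (k : ℕ) :
    IsClosed (sobolevSubmodule k : Set (PiLp 2 (fun _ : Fin (k + 1) => L2))) := by
  have : (sobolevSubmodule k : Set (PiLp 2 (fun _ : Fin (k + 1) => L2))) =
      ⋂ i : Fin k, ⋂ η : ℝ → ℝ, ⋂ _ : ContDiff ℝ ∞ η, ⋂ _ : HasCompactSupport η,
        {U | ∫ x, U i.castSucc x * deriv η x = -∫ x, U i.succ x * η x} := by
    ext U
    simp only [mem_iInter]
    rfl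
  rw [this]
  refine isClosed_iInter fun i => isClosed_iInter fun η => isClosed_iInter fun hη =>
    isClosed_iInter fun hc => ?_
  have hd : Continuous (deriv η) := (contDiff_infty_iff_deriv.1 hη).2.continuous
  refine isClosed_eq ?_ ?_
  · exact (continuous_testPairing _ hd hc.deriv).comp (PiLp.continuous_apply 2 _ _)
  · exact ((continuous_testPairing _ hη.continuous hc).comp (PiLp.continuous_apply 2 _ _)).neg

instance instCompleteSpaceSobolev (k : ℕ) : CompleteSpace (Sobolev k) :=
  (isClosed_sobolevSubmodule k).completeSpace_coe

/-- The derivative of order `j` as a continuous linear map. -/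
def Sobolev.dL (k : ℕ) (j : Fin (k + 1)) : Sobolev k →L[ℝ] L2 :=
  (PiLp.proj 2 (fun _ : Fin (k + 1) => L2) j).comp (sobolevSubmodule k).subtypeL

theorem Sobolev.dL_apply {k : ℕ} (j : Fin (k + 1)) (U : Sobolev k) : dL k j U = U.d j := rfl

theorem Sobolev.norm_sq {k : ℕ} (U : Sobolev k) : ‖U‖ ^ 2 = ∑ j, ‖U.d j‖ ^ 2 := by
  have : ‖U‖ = ‖(U : PiLp 2 (fun _ : Fin (k + 1) => L2))‖ := rfl
  rw [this, PiLp.norm_sq_eq_of_L2]; rfl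

theorem Sobolev.norm_d_le {k : ℕ} (U : Sobolev k) (j : Fin (k + 1)) : ‖U.d j‖ ≤ ‖U‖ :=
  PiLp.norm_apply_le (U : PiLp 2 (fun _ : Fin (k + 1) => L2)) j

/-- An `H¹` function from a weak derivative. -/
def H1.mk (f g : L2) (h : IsWeakDeriv f g) : H1 :=
  ⟨WithLp.toLp 2 ![f, g], fun i => by fin_cases i; exact h⟩

@[simp] theorem H1.mk_d_zero (f g : L2) (h : IsWeakDeriv f g) : (H1.mk f g h).d 0 = f := rfl
@[simp] theorem H1.mk_d_one (f g : L2) (h : IsWeakDeriv f g) : (H1.mk f g h).d 1 = g := rfl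

theorem H1.isWeakDeriv (f : H1) : IsWeakDeriv (f.d 0) (f.d 1) := f.2 0

theorem H1.ext' {f g : H1} (h0 : f.d 0 = g.d 0) (h1 : f.d 1 = g.d 1) : f = g := by
  apply Subtype.ext
  apply PiLp.ext
  intro i
  fin_cases i
  · exact h0
  · exact h1

theorem L2.integral_mul (f g : L2) : inner ℝ f g = ∫ x, f x * g x := by
  rw [L2.inner_def]
  simp [mul_comm]

theorem H1.inner_eq (f g : H1) :
    inner ℝ f g = (∫ x, f.d 0 x * g.d 0 x) + ∫ x, f.d 1 x * g.d 1 x := by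
  have : inner ℝ f g = inner ℝ (f : PiLp 2 (fun _ : Fin 2 => L2)) g := rfl
  rw [this, PiLp.inner_apply, Fin.sum_univ_two, L2.integral_mul, L2.integral_mul]
  rfl

theorem H1.norm_sq (f : H1) : ‖f‖ ^ 2 = ‖f.d 0‖ ^ 2 + ‖f.d 1‖ ^ 2 := by
  rw [Sobolev.norm_sq, Fin.sum_univ_two]

/-- The continuous representative of an `H¹` function. -/
def H1.rep (f : H1) : ℝ → ℝ := Classical.choose f.isWeakDeriv.exists_isPrimitive

theorem H1.isPrimitive (f : H1) : IsPrimitive f.rep (f.d 1) :=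
  (Classical.choose_spec f.isWeakDeriv.exists_isPrimitive).1

theorem H1.rep_ae (f : H1) : f.rep =ᵐ[volume] f.d 0 :=
  (Classical.choose_spec f.isWeakDeriv.exists_isPrimitive).2

theorem H1.continuous_rep (f : H1) : Continuous f.rep := f.isPrimitive.continuous

theorem H1.rep_eq_of_ae {f : H1} {F : ℝ → ℝ} (hF : Continuous F) (h : F =ᵐ[volume] f.d 0) :
    f.rep = F :=
  (f.continuous_rep.ae_eq_iff_eq volume hF).1 (f.rep_ae.trans h.symm)

theorem H1.memLp_rep (f : H1) : MemLp f.rep 2 volume :=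
  (memLp_congr_ae f.rep_ae).2 (Lp.memLp (f.d 0))

theorem L2.integrable_mul {f g : ℝ → ℝ} (hf : MemLp f 2 volume) (hg : MemLp g 2 volume) :
    Integrable (fun x => f x * g x) volume := hf.integrable_mul hg

/-- Integration by parts. -/
theorem H1.integral_by_parts (f g : H1) :
    (∫ x, f.d 1 x * g.rep x) + ∫ x, f.rep x * g.d 1 x = 0 := by
  have i0 := L2.integrable_mul f.memLp_rep g.memLp_rep
  have i1 := L2.integrable_mul (Lp.memLp (f.d 1)) g.memLp_rep
  have i2 := L2.integrable_mul f.memLp_rep (Lp.memLp (g.d 1))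
  rw [← integral_add i1 i2]
  exact (f.isPrimitive.mul g.isPrimitive).integral_eq_zero i0 (i1.add i2)

theorem L2.norm_sq (f : L2) : ‖f‖ ^ 2 = ∫ x, f x ^ 2 := by
  rw [← real_inner_self_eq_norm_sq, L2.integral_mul]
  simp [pow_two]

theorem L2.integrable_sq (f : L2) : Integrable (fun x => f x ^ 2) volume :=
  (Lp.memLp f).integrable_sq

/-- Write f(x)² as the integral of 2ff' over the left half-line and as minus the integral over the
right one, bound each by the integral of f² + f'² over its half-line, and add. The factor 1/2
matters: it is the source of E₀²/4 in the Riccati inequality and of √2 in the threshold. -/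
theorem H1.rep_sq_le (f : H1) (x : ℝ) : f.rep x ^ 2 ≤ ‖f‖ ^ 2 / 2 := by
  have hp := f.isPrimitive.mul f.isPrimitive
  have i0 := L2.integrable_mul f.memLp_rep f.memLp_rep
  have i1 := L2.integrable_mul (Lp.memLp (f.d 1)) f.memLp_rep
  have i2 := L2.integrable_mul f.memLp_rep (Lp.memLp (f.d 1))
  have i3 : Integrable (fun x => f.rep x ^ 2 + f.d 1 x ^ 2) volume :=
    f.memLp_rep.integrable_sq.add (L2.integrable_sq _)
  have h1 := hp.integral_Ioi (x := x) i0.integrableOn (i1.add i2).integrableOn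
  have h2 := hp.integral_Iic (x := x) i0.integrableOn (i1.add i2).integrableOn
  have h3 : ∫ y in Iic x, (f.d 1 y * f.rep y + f.rep y * f.d 1 y) ≤
      ∫ y in Iic x, (f.rep y ^ 2 + f.d 1 y ^ 2) :=
    integral_mono (i1.add i2).integrableOn i3.integrableOn fun y => by
      simp only; nlinarith [sq_nonneg (f.rep y - f.d 1 y)]
  have h4 : ∫ y in Ioi x, -(f.d 1 y * f.rep y + f.rep y * f.d 1 y) ≤
      ∫ y in Ioi x, (f.rep y ^ 2 + f.d 1 y ^ 2) :=
    integral_mono (i1.add i2).neg.integrableOn i3.integrableOn fun y => by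
      simp only; nlinarith [sq_nonneg (f.rep y + f.d 1 y)]
  rw [integral_neg, h1] at h4
  rw [h2] at h3
  have h5 := intervalIntegral.integral_Iic_add_Ioi (b := x) i3.integrableOn i3.integrableOn
  rw [integral_add f.memLp_rep.integrable_sq (L2.integrable_sq _)] at h5
  have h6 : ∫ x, f.rep x ^ 2 = ‖f.d 0‖ ^ 2 := by
    rw [L2.norm_sq]
    exact integral_congr_ae (f.rep_ae.mono fun x hx => by simp only [hx])
  rw [h6, ← L2.norm_sq, ← f.norm_sq] at h5
  linarith

theorem H1.abs_rep_le (f : H1) (x : ℝ) : |f.rep x| ≤ ‖f‖ :=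
  abs_le_of_sq_le_sq (by nlinarith [f.rep_sq_le x, sq_nonneg ‖f‖]) (norm_nonneg f)

theorem H1.rep_add (f g : H1) : (f + g).rep = fun x => f.rep x + g.rep x := by
  apply H1.rep_eq_of_ae (f.continuous_rep.add g.continuous_rep)
  have : (f + g).d 0 = f.d 0 + g.d 0 := rfl
  rw [this]
  filter_upwards [f.rep_ae, g.rep_ae, Lp.coeFn_add (f.d 0) (g.d 0)] with x h1 h2 h3
  change f.rep x + g.rep x = _
  rw [h3, h1, h2]; rfl

theorem H1.rep_smul (c : ℝ) (f : H1) : (c • f).rep = fun x => c * f.rep x := by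
  apply H1.rep_eq_of_ae (continuous_const.mul f.continuous_rep)
  have : (c • f).d 0 = c • f.d 0 := rfl
  rw [this]
  filter_upwards [f.rep_ae, Lp.coeFn_smul c (f.d 0)] with x h1 h3
  change c * f.rep x = _
  rw [h3, h1]; rfl

theorem H1.rep_sub (f g : H1) : (f - g).rep = fun x => f.rep x - g.rep x := by
  rw [sub_eq_add_neg, ← neg_one_smul ℝ g, H1.rep_add, H1.rep_smul]
  ext x; ring

/-- Evaluation of the continuous representative at a point. -/
def H1.evalL (x : ℝ) : H1 →L[ℝ] ℝ :=
  LinearMap.mkContinuous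
    { toFun := fun f => f.rep x
      map_add' := fun f g => by rw [H1.rep_add]
      map_smul' := fun c f => by rw [H1.rep_smul]; rfl } 1
    fun f => by simpa using f.abs_rep_le x

/-- `H¹` functions are Hölder continuous of exponent `1/2`. -/
theorem H1.rep_holder (f : H1) (x y : ℝ) : (f.rep y - f.rep x) ^ 2 ≤ ‖f‖ ^ 2 * |y - x| := by
  rw [f.isPrimitive.sub_eq]
  wlog hxy : x ≤ y generalizing x y
  · rw [intervalIntegral.integral_symm, neg_sq, abs_sub_comm]
    exact this y x (le_of_not_ge hxy)
  have h1 : ‖f.d 1‖ ^ 2 ≤ ‖f‖ ^ 2 := by rw [f.norm_sq]; nlinarith [sq_nonneg ‖f.d 0‖]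
  have h2 : ∫ z in x..y, f.d 1 z ^ 2 ≤ ‖f.d 1‖ ^ 2 := by
    rw [L2.norm_sq, intervalIntegral.integral_of_le hxy]
    exact setIntegral_le_integral (L2.integrable_sq _) (Eventually.of_forall fun z => sq_nonneg _)
  have hi := f.isPrimitive.intervalIntegrable x y
  have hi2 : IntervalIntegrable (fun z => f.d 1 z ^ 2) volume x y :=
    (L2.integrable_sq _).intervalIntegrable
  set A := ∫ z in x..y, f.d 1 z with hA
  have h3 : ∀ s : ℝ, 0 ≤ (∫ z in x..y, f.d 1 z ^ 2) - 2 * s * A + s ^ 2 * (y - x) := by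
    intro s
    have : (∫ z in x..y, f.d 1 z ^ 2) - 2 * s * A + s ^ 2 * (y - x) =
        ∫ z in x..y, (f.d 1 z - s) ^ 2 := by
      have e : ∀ z, (f.d 1 z - s) ^ 2 = f.d 1 z ^ 2 - 2 * s * f.d 1 z + s ^ 2 := fun z => by ring
      simp only [e]
      rw [intervalIntegral.integral_add (hi2.sub (hi.const_mul _)) intervalIntegrable_const,
        intervalIntegral.integral_sub hi2 (hi.const_mul _), intervalIntegral.integral_const_mul,
        intervalIntegral.integral_const, smul_eq_mul, ← hA]
      ring
    rw [this]
    exact intervalIntegral.integral_nonneg hxy fun z _ => sq_nonneg _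
  rw [abs_of_nonneg (by linarith)]
  rcases hxy.eq_or_lt with h | h
  · subst h; simp [hA]
  -- The quadratic in `s` is evaluated at its minimum, the mean of the derivative; this is the
  -- Cauchy–Schwarz inequality.
  · have h4 := h3 (A / (y - x))
    have h5 : (∫ z in x..y, f.d 1 z ^ 2) * (y - x) - A ^ 2 =
        (y - x) * ((∫ z in x..y, f.d 1 z ^ 2) - 2 * (A / (y - x)) * A +
          (A / (y - x)) ^ 2 * (y - x)) := by
      have : y - x ≠ 0 := by linarith
      field_simp
      ring
    have h6 := mul_nonneg (by linarith : 0 ≤ y - x) h4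
    nlinarith

theorem L2.congr {f g : L2} (h : (f : ℝ → ℝ) =ᵐ[volume] g) : f = g := Lp.ext h

theorem memLp_bdd_mul {f g : ℝ → ℝ} {C : ℝ} (hf : Continuous f) (hC : ∀ x, |f x| ≤ C)
    (hg : MemLp g 2 volume) : MemLp (fun x => f x * g x) 2 volume := by
  refine MemLp.of_le_mul (c := C) hg (hf.aestronglyMeasurable.mul hg.1) ?_
  refine Eventually.of_forall fun x => ?_
  rw [norm_mul]
  exact mul_le_mul_of_nonneg_right (hC x) (norm_nonneg _)

theorem H1.memLp_mul (f : H1) (g : L2) : MemLp (fun x => f.rep x * g x) 2 volume :=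
  memLp_bdd_mul f.continuous_rep f.abs_rep_le (Lp.memLp g)

/-- Multiplication of an `L²` function by an `H¹` function. -/
def H1.mulL : H1 →L[ℝ] L2 →L[ℝ] L2 :=
  LinearMap.mkContinuous₂
    (LinearMap.mk₂ ℝ (fun (f : H1) (g : L2) => (f.memLp_mul g).toLp)
      (fun f f' g => by
        apply L2.congr
        filter_upwards [((f + f').memLp_mul g).coeFn_toLp, (f.memLp_mul g).coeFn_toLp,
          (f'.memLp_mul g).coeFn_toLp, Lp.coeFn_add (f.memLp_mul g).toLp (f'.memLp_mul g).toLp]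
          with x h1 h2 h3 h4
        rw [h1, h4, Pi.add_apply, h2, h3, H1.rep_add, add_mul])
      (fun c f g => by
        apply L2.congr
        filter_upwards [((c • f).memLp_mul g).coeFn_toLp, (f.memLp_mul g).coeFn_toLp,
          Lp.coeFn_smul c (f.memLp_mul g).toLp] with x h1 h2 h4
        rw [h1, h4, Pi.smul_apply, h2, H1.rep_smul, smul_eq_mul, mul_assoc])
      (fun f g g' => by
        apply L2.congr
        filter_upwards [(f.memLp_mul (g + g')).coeFn_toLp, (f.memLp_mul g).coeFn_toLp,
          (f.memLp_mul g').coeFn_toLp, Lp.coeFn_add (f.memLp_mul g).toLp (f.memLp_mul g').toLp,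
          Lp.coeFn_add g g'] with x h1 h2 h3 h4 h5
        rw [h1, h4, Pi.add_apply, h2, h3, h5, Pi.add_apply, mul_add])
      (fun c f g => by
        apply L2.congr
        filter_upwards [(f.memLp_mul (c • g)).coeFn_toLp, (f.memLp_mul g).coeFn_toLp,
          Lp.coeFn_smul c (f.memLp_mul g).toLp, Lp.coeFn_smul c g] with x h1 h2 h4 h5
        rw [h1, h4, Pi.smul_apply, h2, h5, Pi.smul_apply, smul_eq_mul, smul_eq_mul]
        ring)) 1
    (fun f g => by
      rw [one_mul]
      refine Lp.norm_le_mul_norm_of_ae_le_mul ?_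
      filter_upwards [(f.memLp_mul g).coeFn_toLp] with x h1
      rw [LinearMap.mk₂_apply, h1, norm_mul]
      exact mul_le_mul_of_nonneg_right (f.abs_rep_le x) (norm_nonneg _))

theorem H1.mulL_ae (f : H1) (g : L2) : H1.mulL f g =ᵐ[volume] fun x => f.rep x * g x :=
  (f.memLp_mul g).coeFn_toLp

theorem H1.norm_mulL_le (f : H1) (g : L2) : ‖H1.mulL f g‖ ≤ ‖f‖ * ‖g‖ := by
  refine Lp.norm_le_mul_norm_of_ae_le_mul ?_
  filter_upwards [H1.mulL_ae f g] with x h1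
  rw [h1, norm_mul]
  exact mul_le_mul_of_nonneg_right (f.abs_rep_le x) (norm_nonneg _)

theorem H1.inner_mulL (f : H1) (g h : L2) :
    inner ℝ (H1.mulL f g) h = ∫ x, f.rep x * g x * h x := by
  rw [L2.integral_mul]
  exact integral_congr_ae ((H1.mulL_ae f g).mono fun x hx => by simp only [hx])

theorem H1.inner_mulL_comm (f : H1) (g h : L2) :
    inner ℝ (H1.mulL f g) h = inner ℝ (H1.mulL f h) g := by
  rw [H1.inner_mulL, H1.inner_mulL]
  congr 1; ext x; ring

theorem H1.inner_mulL_swap (f h : H1) (g : L2) :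
    inner ℝ (H1.mulL f g) (h.d 0) = inner ℝ (H1.mulL h g) (f.d 0) := by
  rw [H1.inner_mulL, H1.inner_mulL]
  refine integral_congr_ae ?_
  filter_upwards [f.rep_ae, h.rep_ae] with x h1 h2
  simp only [← h1, ← h2]; ring

/-- The product of two `H¹` functions. -/
def H1.mul (f g : H1) : H1 :=
  H1.mk (H1.mulL f (g.d 0)) (H1.mulL f (g.d 1) + H1.mulL g (f.d 1)) <| by
    refine (f.isPrimitive.mul g.isPrimitive).isWeakDeriv ?_ ?_
    · filter_upwards [H1.mulL_ae f (g.d 0), g.rep_ae] with x h1 h2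
      rw [h1, h2]
    · filter_upwards [H1.mulL_ae f (g.d 1), H1.mulL_ae g (f.d 1),
        Lp.coeFn_add (H1.mulL f (g.d 1)) (H1.mulL g (f.d 1))] with x h1 h2 h3
      rw [h3, Pi.add_apply, h1, h2]; ring

theorem H1.mul_d_zero (f g : H1) : (H1.mul f g).d 0 = H1.mulL f (g.d 0) := rfl
theorem H1.mul_d_one (f g : H1) :
    (H1.mul f g).d 1 = H1.mulL f (g.d 1) + H1.mulL g (f.d 1) := rfl

theorem H1.rep_mul (f g : H1) : (H1.mul f g).rep = fun x => f.rep x * g.rep x := by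
  apply H1.rep_eq_of_ae (f.continuous_rep.mul g.continuous_rep)
  rw [H1.mul_d_zero]
  filter_upwards [H1.mulL_ae f (g.d 0), g.rep_ae] with x h1 h2
  change f.rep x * g.rep x = _
  rw [h1, h2]

theorem H1.inner_by_parts (f g : H1) : inner ℝ (f.d 1) (g.d 0) + inner ℝ (f.d 0) (g.d 1) = 0 := by
  rw [L2.integral_mul, L2.integral_mul, ← H1.integral_by_parts f g]
  congr 1
  · exact integral_congr_ae (g.rep_ae.mono fun x hx => by simp only [hx])
  · exact integral_congr_ae (f.rep_ae.mono fun x hx => by simp only [hx])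

theorem H1.inner_by_parts₃ (f g h : H1) :
    inner ℝ (H1.mulL f (g.d 1)) (h.d 0) + inner ℝ (H1.mulL g (f.d 1)) (h.d 0)
      + inner ℝ (H1.mulL f (g.d 0)) (h.d 1) = 0 := by
  have := H1.inner_by_parts (H1.mul f g) h
  rwa [H1.mul_d_zero, H1.mul_d_one, inner_add_left] at this

/-! ### The equation in terms of v = u - u_xx -/

/-- A continuous linear map into a Sobolev space from its components. -/
def Sobolev.liftL {E : Type*} [NormedAddCommGroup E] [NormedSpace ℝ E] {k : ℕ}
    (A : Fin (k + 1) → E →L[ℝ] L2) (h : ∀ x, ∀ i : Fin k, IsWeakDeriv (A i.castSucc x) (A i.succ x)) :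
    E →L[ℝ] Sobolev k :=
  (((PiLp.continuousLinearEquiv 2 ℝ (fun _ : Fin (k + 1) => L2)).symm :
    (Fin (k + 1) → L2) →L[ℝ] _).comp (ContinuousLinearMap.pi A)).codRestrict (sobolevSubmodule k)
    fun x => by exact fun i => h x i

/-- `v = u - u_xx` as an `H¹` function. -/
def Sobolev.vH : Sobolev 4 →L[ℝ] H1 :=
  Sobolev.liftL ![dL 4 0 - dL 4 2, dL 4 1 - dL 4 3] fun U i => by
    fin_cases i
    exact (show IsWeakDeriv (U.d 0) (U.d 1) from U.2 0).sub
      (show IsWeakDeriv (U.d 2) (U.d 3) from U.2 2)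

/-- `v_x = u_x - u_xxx` as an `H¹` function. -/
def Sobolev.vxH : Sobolev 4 →L[ℝ] H1 :=
  Sobolev.liftL ![dL 4 1 - dL 4 3, dL 4 2 - dL 4 4] fun U i => by
    fin_cases i
    exact U.isWeakDeriv_vx

/-- `m = u - 2 u_xx + u_xxxx` as a continuous linear map. -/
def Sobolev.mL : Sobolev 4 →L[ℝ] L2 := dL 4 0 - (2 : ℝ) • dL 4 2 + dL 4 4

/-- `u - u_xx` for `u` in `H³`. -/
def Sobolev.wH : Sobolev 3 →L[ℝ] H1 :=
  Sobolev.liftL ![dL 3 0 - dL 3 2, dL 3 1 - dL 3 3] fun U i => by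
    fin_cases i
    exact (show IsWeakDeriv (U.d 0) (U.d 1) from U.2 0).sub
      (show IsWeakDeriv (U.d 2) (U.d 3) from U.2 2)

theorem Sobolev.vH_d_zero (U : Sobolev 4) : (Sobolev.vH U).d 0 = U.v := rfl
theorem Sobolev.vH_d_one (U : Sobolev 4) : (Sobolev.vH U).d 1 = U.vx := rfl
theorem Sobolev.vxH_d_zero (U : Sobolev 4) : (Sobolev.vxH U).d 0 = U.vx := rfl
theorem Sobolev.vxH_d_one (U : Sobolev 4) : (Sobolev.vxH U).d 1 = U.d 2 - U.d 4 := rfl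
theorem Sobolev.wH_d_zero (U : Sobolev 3) : (Sobolev.wH U).d 0 = U.d 0 - U.d 2 := rfl
theorem Sobolev.wH_d_one (U : Sobolev 3) : (Sobolev.wH U).d 1 = U.d 1 - U.d 3 := rfl
theorem Sobolev.wH_incl (U : Sobolev 4) : Sobolev.wH U.incl = Sobolev.vH U :=
  H1.ext' rfl rfl

/-- Factoring (1 - ∂ₓ²)² through v is what turns the problem into the Camassa–Holm equation. -/
theorem Sobolev.m_eq (U : Sobolev 4) :
    U.m = (Sobolev.vH U).d 0 - (Sobolev.vxH U).d 1 := by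
  rw [Sobolev.vH_d_zero, Sobolev.vxH_d_one, Sobolev.m, Sobolev.v, two_smul]
  abel

theorem Sobolev.vxRep_eq (U : Sobolev 4) : U.vxRep = (Sobolev.vxH U).rep :=
  (H1.rep_eq_of_ae (f := Sobolev.vxH U) U.continuous_vxRep U.vxRep_ae_eq).symm

theorem L2.integrable_test (f : L2) {ψ : ℝ → ℝ} (hψ : Continuous ψ) (hc : HasCompactSupport ψ) :
    Integrable (fun x => f x * ψ x) volume := by
  simpa [mul_comm] using
    (L2.locallyIntegrable f).integrable_smul_left_of_hasCompactSupport hψ hc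

theorem L2.integral_sub_mul (f g : L2) {ψ : ℝ → ℝ} (hψ : Continuous ψ)
    (hc : HasCompactSupport ψ) :
    ∫ x, (f - g : L2) x * ψ x = (∫ x, f x * ψ x) - ∫ x, g x * ψ x := by
  rw [← integral_sub (L2.integrable_test f hψ hc) (L2.integrable_test g hψ hc)]
  refine integral_congr_ae ?_
  filter_upwards [Lp.coeFn_sub f g] with x hx
  rw [hx, Pi.sub_apply, sub_mul]

theorem L2.integral_add_mul (f g : L2) {ψ : ℝ → ℝ} (hψ : Continuous ψ)
    (hc : HasCompactSupport ψ) :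
    ∫ x, (f + g : L2) x * ψ x = (∫ x, f x * ψ x) + ∫ x, g x * ψ x := by
  rw [← integral_add (L2.integrable_test f hψ hc) (L2.integrable_test g hψ hc)]
  refine integral_congr_ae ?_
  filter_upwards [Lp.coeFn_add f g] with x hx
  rw [hx, Pi.add_apply, add_mul]

theorem contDiff_deriv {η : ℝ → ℝ} (h : ContDiff ℝ ∞ η) : ContDiff ℝ ∞ (deriv η) :=
  (contDiff_infty_iff_deriv.1 h).2

/-- One factor 1 - ∂ₓ² is moved from the test function onto `ut`, and from the other factor only one
derivative is moved, since `ut` has just three. The result is the H¹ pairing of v_t with `η`. -/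
theorem integral_helmholtz_sq (ut : Sobolev 3) {η : ℝ → ℝ} (hη : ContDiff ℝ ∞ η)
    (hc : HasCompactSupport η) :
    ∫ x, ut.d 0 x * (η x - 2 * iteratedDeriv 2 η x + iteratedDeriv 4 η x) =
      (∫ x, (Sobolev.wH ut).d 0 x * η x) + ∫ x, (Sobolev.wH ut).d 1 x * deriv η x := by
  have e2 : iteratedDeriv 2 η = deriv (deriv η) := by
    simp [iteratedDeriv_succ, iteratedDeriv_zero]
  have e4 : iteratedDeriv 4 η = deriv (deriv (deriv (deriv η))) := by
    simp [iteratedDeriv_succ, iteratedDeriv_zero]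
  have d1 := contDiff_deriv hη
  have d2 := contDiff_deriv d1
  have d3 := contDiff_deriv d2
  have d4 := contDiff_deriv d3
  have c1 := hc.deriv
  have c2 := c1.deriv
  have c3 := c2.deriv
  have c4 := c3.deriv
  have w0 : IsWeakDeriv (ut.d 0) (ut.d 1) := ut.2 0
  have w1 : IsWeakDeriv (ut.d 1) (ut.d 2) := ut.2 1
  have w2 : IsWeakDeriv (ut.d 2) (ut.d 3) := ut.2 2
  have f1 := w0 _ d1 c1
  have f2 := w0 _ d3 c3
  have f3 := w1 _ d2 c2
  have f4 := w1 _ hη hc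
  have f5 := w2 _ d1 c1
  have f6 := w1 _ d2 c2
  rw [Sobolev.wH_d_zero, Sobolev.wH_d_one, L2.integral_sub_mul _ _ hη.continuous hc,
    L2.integral_sub_mul _ _ d1.continuous c1, e2, e4]
  have i0 := L2.integrable_test (ut.d 0) hη.continuous hc
  have i2 := L2.integrable_test (ut.d 0) d2.continuous c2
  have i4 := L2.integrable_test (ut.d 0) d4.continuous c4
  have : ∀ x, ut.d 0 x * (η x - 2 * deriv (deriv η) x + deriv (deriv (deriv (deriv η))) x) =
      ut.d 0 x * η x - 2 * (ut.d 0 x * deriv (deriv η) x) +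
        ut.d 0 x * deriv (deriv (deriv (deriv η))) x := fun x => by ring
  simp only [this]
  have i02 : Integrable (fun x => ut.d 0 x * η x - 2 * (ut.d 0 x * deriv (deriv η) x)) volume :=
    i0.sub (i2.const_mul 2)
  rw [integral_add i02 i4, integral_sub i0 (i2.const_mul 2),
    integral_const_mul]
  linarith

/-- The equation in conservation form, for `v = u - u_xx` and `w = v_t`. -/
def VEquation (U : Sobolev 4) (w : H1) : Prop :=
  IsWeakDeriv (w.d 1 - H1.mulL (Sobolev.vH U) U.m) (w.d 0 + H1.mulL (Sobolev.vxH U) U.m)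

theorem satisfiesEquation_iff (U : Sobolev 4) (ut : Sobolev 3) :
    SatisfiesEquation U ut ↔ VEquation U (Sobolev.wH ut) := by
  refine forall_congr' fun η => forall_congr' fun hη => forall_congr' fun hc => ?_
  have hd := (contDiff_deriv hη).continuous
  rw [integral_helmholtz_sq ut hη hc, L2.integral_sub_mul _ _ hd hc.deriv,
    L2.integral_add_mul _ _ hη.continuous hc]
  have i1 := L2.integrable_test (H1.mulL (Sobolev.vxH U) U.m) hη.continuous hc
  have i2 := L2.integrable_test (H1.mulL (Sobolev.vH U) U.m) hd hc.deriv
  have e1 : ∫ x, 2 * U.vx x * U.m x * η x =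
      2 * ∫ x, H1.mulL (Sobolev.vxH U) U.m x * η x := by
    rw [← integral_const_mul]
    refine integral_congr_ae ?_
    filter_upwards [H1.mulL_ae (Sobolev.vxH U) U.m, (Sobolev.vxH U).rep_ae] with x h1 h2
    rw [h1, h2, Sobolev.vxH_d_zero]; ring
  have e2 : ∫ x, U.m x * (U.vx x * η x + U.v x * deriv η x) =
      (∫ x, H1.mulL (Sobolev.vxH U) U.m x * η x) +
        ∫ x, H1.mulL (Sobolev.vH U) U.m x * deriv η x := by
    rw [← integral_add i1 i2]
    refine integral_congr_ae ?_
    filter_upwards [H1.mulL_ae (Sobolev.vxH U) U.m, (Sobolev.vxH U).rep_ae,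
      H1.mulL_ae (Sobolev.vH U) U.m, (Sobolev.vH U).rep_ae] with x h1 h2 h3 h4
    rw [h1, h2, h3, h4, Sobolev.vxH_d_zero, Sobolev.vH_d_zero]; ring
  rw [e1, e2]
  constructor <;> intro h <;> linarith

/-- Extends the weak form from test functions to all of H¹, so that v and differences of solutions
may be used as multipliers. -/
theorem VEquation.inner_eq {U : Sobolev 4} {w : H1} (h : VEquation U w) (η : H1) :
    inner ℝ w η = -inner ℝ (H1.mulL (Sobolev.vxH U) U.m) (η.d 0)
      + inner ℝ (H1.mulL (Sobolev.vH U) U.m) (η.d 1) := by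
  have h1 : inner ℝ (w.d 0 + H1.mulL (Sobolev.vxH U) U.m) (η.d 0) +
      inner ℝ (w.d 1 - H1.mulL (Sobolev.vH U) U.m) (η.d 1) = 0 :=
    H1.inner_by_parts (H1.mk _ _ h) η
  rw [inner_add_left, inner_sub_left] at h1
  rw [H1.inner_eq, ← L2.integral_mul, ← L2.integral_mul]
  linarith

/-- For η = v the two terms on the right are both the integral of v v_x m, with opposite signs. This
is the conservation law. -/
theorem VEquation.inner_self {U : Sobolev 4} {w : H1} (h : VEquation U w) :
    inner ℝ w (Sobolev.vH U) = 0 := by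
  rw [h.inner_eq, Sobolev.vH_d_one, ← Sobolev.vxH_d_zero, H1.inner_mulL_swap]
  ring

theorem VEquation.unique {U : Sobolev 4} {w w' : H1} (h : VEquation U w) (h' : VEquation U w') :
    w = w' :=
  ext_inner_right ℝ fun η => by rw [h.inner_eq, h'.inner_eq]

/-- Expanding the squares of u - u_xx and u_x - u_xxx, the cross terms become 2‖u_x‖² and 2‖u_xx‖²
after integration by parts; this explains the coefficients 3. -/
theorem Sobolev.E₀_eq (U : Sobolev 4) : U.E₀ = ‖Sobolev.vH U‖ := by
  have w0 : IsWeakDeriv (U.d 0) (U.d 1) := U.2 0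
  have w1 : IsWeakDeriv (U.d 1) (U.d 2) := U.2 1
  have w2 : IsWeakDeriv (U.d 2) (U.d 3) := U.2 2
  have h1 := H1.inner_by_parts (H1.mk _ _ w0) (H1.mk _ _ w1)
  have h2 := H1.inner_by_parts (H1.mk _ _ w1) (H1.mk _ _ w2)
  simp only [H1.mk_d_zero, H1.mk_d_one] at h1 h2
  rw [Sobolev.E₀, Real.sqrt_eq_iff_mul_self_eq (by positivity) (norm_nonneg _), ← pow_two,
    H1.norm_sq, Sobolev.vH_d_zero, Sobolev.vH_d_one, Sobolev.v, Sobolev.vx,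
    norm_sub_sq_real, norm_sub_sq_real]
  rw [real_inner_self_eq_norm_sq] at h1 h2
  have i0 := L2.integrable_sq (U.d 0)
  have i1 := (L2.integrable_sq (U.d 1)).const_mul 3
  have i2 := (L2.integrable_sq (U.d 2)).const_mul 3
  have i3 := L2.integrable_sq (U.d 3)
  have i01 : Integrable (fun x => U.d 0 x ^ 2 + 3 * U.d 1 x ^ 2) volume := i0.add i1
  have i012 : Integrable (fun x => U.d 0 x ^ 2 + 3 * U.d 1 x ^ 2 + 3 * U.d 2 x ^ 2) volume :=
    i01.add i2
  rw [integral_add i012 i3, integral_add i01 i2, integral_add i0 i1,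
    integral_const_mul, integral_const_mul, ← L2.norm_sq, ← L2.norm_sq, ← L2.norm_sq,
    ← L2.norm_sq]
  linarith

/-! ### Stability, uniqueness and the conserved norm -/

theorem abs_inner_mulL_le (f : H1) (g h : L2) : |inner ℝ (H1.mulL f g) h| ≤ ‖f‖ * ‖g‖ * ‖h‖ :=
  (abs_real_inner_le_norm _ _).trans
    (mul_le_mul_of_nonneg_right (f.norm_mulL_le g) (norm_nonneg _))

/-- The stability estimate in `H¹`. -/
theorem VEquation.inner_sub_le {U₁ U₂ : Sobolev 4} {w₁ w₂ : H1} (h₁ : VEquation U₁ w₁)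
    (h₂ : VEquation U₂ w₂) {K : ℝ} (hv : ‖Sobolev.vH U₁‖ ≤ K) (hvx : ‖Sobolev.vxH U₁‖ ≤ K) :
    |inner ℝ (w₁ - w₂) (Sobolev.vH U₁ - Sobolev.vH U₂)| ≤
      5 * K * ‖Sobolev.vH U₁ - Sobolev.vH U₂‖ ^ 2 := by
  set w := Sobolev.vH U₁ - Sobolev.vH U₂ with hw
  set wx := Sobolev.vxH U₁ - Sobolev.vxH U₂ with hwx
  have hd : wx.d 0 = w.d 1 := rfl
  have hM : U₁.m - U₂.m = w.d 0 - wx.d 1 := by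
    rw [Sobolev.m_eq, Sobolev.m_eq]
    simp only [← Sobolev.dL_apply, hw, hwx, map_sub]
    abel
  have e1 : H1.mulL (Sobolev.vxH U₁) U₁.m - H1.mulL (Sobolev.vxH U₂) U₂.m =
      H1.mulL (Sobolev.vxH U₁) (w.d 0) - H1.mulL (Sobolev.vxH U₁) (wx.d 1) + H1.mulL wx U₂.m := by
    rw [← map_sub, ← hM, hwx]
    simp only [map_sub, sub_apply]
    abel
  have e2 : H1.mulL (Sobolev.vH U₁) U₁.m - H1.mulL (Sobolev.vH U₂) U₂.m =
      H1.mulL (Sobolev.vH U₁) (w.d 0) - H1.mulL (Sobolev.vH U₁) (wx.d 1) + H1.mulL w U₂.m := by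
    rw [← map_sub, ← hM, hw]
    simp only [map_sub, sub_apply]
    abel
  have key : inner ℝ (w₁ - w₂) w =
      -inner ℝ (H1.mulL (Sobolev.vxH U₁) U₁.m - H1.mulL (Sobolev.vxH U₂) U₂.m) (w.d 0) +
      inner ℝ (H1.mulL (Sobolev.vH U₁) U₁.m - H1.mulL (Sobolev.vH U₂) U₂.m) (w.d 1) := by
    rw [inner_sub_left, h₁.inner_eq, h₂.inner_eq, inner_sub_left, inner_sub_left]
    ring
  -- The two terms containing `U₂.m` are the same integral and cancel. What remains has coefficients
  -- from the first solution only, and the terms with the uncontrolled second derivative `wx.d 1`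
  -- are integrated by parts: in `t2` such a term occurs twice, so it equals half of a term without
  -- it.
  rw [e1, e2, ← hd, inner_add_left, inner_add_left, H1.inner_mulL_swap w wx] at key
  simp only [inner_sub_left] at key
  have t1 := H1.inner_by_parts₃ (Sobolev.vxH U₁) wx w
  have t2 := H1.inner_by_parts₃ (Sobolev.vH U₁) wx wx
  rw [H1.inner_mulL_swap wx w] at t1
  rw [H1.inner_mulL_comm (Sobolev.vH U₁) (wx.d 0) (wx.d 1), H1.inner_mulL_comm wx,
    Sobolev.vH_d_one, ← Sobolev.vxH_d_zero, H1.inner_mulL_swap wx] at t2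
  have n0 : ‖w.d 0‖ ≤ ‖w‖ := w.norm_d_le 0
  have n1 : ‖wx.d 0‖ ≤ ‖w‖ := w.norm_d_le 1
  have n2 : ‖w.d 1‖ ≤ ‖w‖ := w.norm_d_le 1
  have n3 : ‖(Sobolev.vxH U₁).d 1‖ ≤ K := ((Sobolev.vxH U₁).norm_d_le 1).trans hvx
  have hK : 0 ≤ K := (norm_nonneg _).trans hv
  have hKw : 0 ≤ K * ‖w‖ := mul_nonneg hK (norm_nonneg w)
  have b1 : |inner ℝ (H1.mulL (Sobolev.vxH U₁) (w.d 0)) (w.d 0)| ≤ K * ‖w‖ * ‖w‖ :=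
    (abs_inner_mulL_le _ _ _).trans (by gcongr)
  have b2 : |inner ℝ (H1.mulL w ((Sobolev.vxH U₁).d 1)) (wx.d 0)| ≤ ‖w‖ * K * ‖w‖ :=
    (abs_inner_mulL_le _ _ _).trans (by gcongr)
  have b3 : |inner ℝ (H1.mulL (Sobolev.vxH U₁) (wx.d 0)) (w.d 1)| ≤ K * ‖w‖ * ‖w‖ :=
    (abs_inner_mulL_le _ _ _).trans (by gcongr)
  have b4 : |inner ℝ (H1.mulL (Sobolev.vH U₁) (w.d 0)) (wx.d 0)| ≤ K * ‖w‖ * ‖w‖ :=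
    (abs_inner_mulL_le _ _ _).trans (by gcongr)
  have b5 : |inner ℝ (H1.mulL (Sobolev.vxH U₁) (wx.d 0)) (wx.d 0)| ≤ K * ‖w‖ * ‖w‖ :=
    (abs_inner_mulL_le _ _ _).trans (by gcongr)
  rw [inner_sub_left]
  rw [abs_le] at *
  constructor <;> nlinarith

/-- A solution, in terms of `v = u - u_xx`. -/
theorem IsSolution.exists_hasDerivWithinAt {u₀ : Sobolev 4} {T : EReal} {u : ℝ → Sobolev 4}
    (h : IsSolution u₀ T u) :
    ∃ w : ℝ → H1, ContinuousOn w (timeInterval T) ∧ ∀ t ∈ timeInterval T,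
      HasDerivWithinAt (fun s => Sobolev.vH (u s)) (w t) (timeInterval T) t ∧
        VEquation (u t) (w t) := by
  obtain ⟨-, -, ut, hutc, hut⟩ := h
  refine ⟨fun t => Sobolev.wH (ut t), Sobolev.wH.continuous.comp_continuousOn hutc,
    fun t ht => ⟨?_, (satisfiesEquation_iff _ _).1 (hut t ht).2⟩⟩
  have := Sobolev.wH.hasFDerivAt.comp_hasDerivWithinAt t (hut t ht).1
  simpa only [Function.comp_def, Sobolev.wH_incl] using this

theorem timeInterval_mem_nhdsGE {T : EReal} {t : ℝ} (ht : t ∈ timeInterval T) :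
    timeInterval T ∈ 𝓝[≥] t := by
  obtain ⟨h0, hT⟩ := ht
  have : {s : ℝ | (s : EReal) < T} ∈ 𝓝 t :=
    (isOpen_Iio.preimage continuous_coe_real_ereal).mem_nhds hT
  filter_upwards [mem_nhdsWithin_of_mem_nhds this, self_mem_nhdsWithin] with s hs hs'
  exact ⟨h0.trans hs', hs⟩

theorem Icc_subset_timeInterval {T : EReal} {t : ℝ} (ht : t ∈ timeInterval T) :
    Icc 0 t ⊆ timeInterval T := fun _ hs =>
  ⟨hs.1, (EReal.coe_le_coe_iff.2 hs.2).trans_lt ht.2⟩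

theorem ContinuousOn.exists_norm_le {E : Type*} [SeminormedAddCommGroup E] {f : ℝ → E} {a b : ℝ}
    (hf : ContinuousOn f (Icc a b)) : ∃ K, 0 ≤ K ∧ ∀ t ∈ Icc a b, ‖f t‖ ≤ K := by
  obtain ⟨K, hK⟩ := isCompact_Icc.exists_bound_of_continuousOn hf
  exact ⟨max K 0, le_max_right _ _, fun t ht => (hK t ht).trans (le_max_left _ _)⟩

/-- Pairing u = u_xx with u gives ‖u‖² = -‖u_x‖². -/
theorem Sobolev.d_zero_eq_zero {U : Sobolev 4} (h : Sobolev.vH U = 0) : U.d 0 = 0 := by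
  have w0 : IsWeakDeriv (U.d 0) (U.d 1) := U.2 0
  have w1 : IsWeakDeriv (U.d 1) (U.d 2) := U.2 1
  have h1 : inner ℝ (U.d 1) (U.d 1) + inner ℝ (U.d 0) (U.d 2) = 0 :=
    H1.inner_by_parts (H1.mk _ _ w0) (H1.mk _ _ w1)
  have h2 : U.d 0 - U.d 2 = 0 := by
    rw [← Sobolev.v, ← Sobolev.vH_d_zero, h]; rfl
  rw [sub_eq_zero] at h2
  rw [← h2, real_inner_self_eq_norm_sq, real_inner_self_eq_norm_sq] at h1
  have : ‖U.d 0‖ = 0 := by nlinarith [sq_nonneg ‖U.d 0‖, sq_nonneg ‖U.d 1‖]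
  exact norm_eq_zero.1 this

theorem IsWeakDeriv.eq_zero {g : L2} (h : IsWeakDeriv 0 g) : g = 0 := by
  have h1 : (H1.mk _ _ h).rep = fun _ => 0 :=
    H1.rep_eq_of_ae continuous_const (Lp.coeFn_zero ℝ 2 volume).symm
  have h2 := (H1.mk _ _ h).isPrimitive.ae_hasDerivAt
  apply L2.congr
  filter_upwards [h2, Lp.coeFn_zero ℝ 2 (volume : Measure ℝ)] with x hx h0
  rw [h1] at hx
  rw [h0]
  exact hx.unique (hasDerivAt_const x 0)

/-- An element of a Sobolev space is determined by its component of order zero. -/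
theorem Sobolev.eq_zero {k : ℕ} {U : Sobolev k} (h : U.d 0 = 0) : U = 0 := by
  have : ∀ n : ℕ, ∀ hn : n < k + 1, U.d ⟨n, hn⟩ = 0 := by
    intro n
    induction n with
    | zero => exact fun _ => h
    | succ n ih =>
      intro hn
      have h1 : IsWeakDeriv (U.d ⟨n, by omega⟩) (U.d ⟨n + 1, hn⟩) := U.2 ⟨n, by omega⟩
      rw [ih] at h1
      exact h1.eq_zero
  apply Subtype.ext
  apply PiLp.ext
  intro i
  exact this i i.2

theorem Sobolev.vH_injective : Function.Injective Sobolev.vH := by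
  rw [injective_iff_map_eq_zero]
  exact fun U h => Sobolev.eq_zero (Sobolev.d_zero_eq_zero h)

/-- Uniqueness of solutions. -/
theorem IsSolution.unique {u₀ : Sobolev 4} {T₁ T₂ : EReal} {u₁ u₂ : ℝ → Sobolev 4}
    (h₁ : IsSolution u₀ T₁ u₁) (h₂ : IsSolution u₀ T₂ u₂) {t : ℝ} (ht₁ : t ∈ timeInterval T₁)
    (ht₂ : t ∈ timeInterval T₂) : u₁ t = u₂ t := by
  obtain ⟨w₁, -, hw₁⟩ := h₁.exists_hasDerivWithinAt
  obtain ⟨w₂, -, hw₂⟩ := h₂.exists_hasDerivWithinAt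
  have s₁ := Icc_subset_timeInterval ht₁
  have s₂ := Icc_subset_timeInterval ht₂
  obtain ⟨K, hK0, hK⟩ := ContinuousOn.exists_norm_le (h₁.2.1.mono s₁)
  set C := (‖Sobolev.vH‖ + ‖Sobolev.vxH‖) * K with hC
  set w : ℝ → H1 := fun s => Sobolev.vH (u₁ s) - Sobolev.vH (u₂ s) with hw
  have hd : ∀ s ∈ Ico 0 t, HasDerivWithinAt w (w₁ s - w₂ s) (Ici s) s := fun s hs =>
    (((hw₁ s (s₁ (Ico_subset_Icc_self hs))).1.mono_of_mem_nhdsWithin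
      (timeInterval_mem_nhdsGE (s₁ (Ico_subset_Icc_self hs)))).sub
    ((hw₂ s (s₂ (Ico_subset_Icc_self hs))).1.mono_of_mem_nhdsWithin
      (timeInterval_mem_nhdsGE (s₂ (Ico_subset_Icc_self hs)))))
  have hwc : ContinuousOn w (Icc 0 t) :=
    (Sobolev.vH.continuous.comp_continuousOn (h₁.2.1.mono s₁)).sub
      (Sobolev.vH.continuous.comp_continuousOn (h₂.2.1.mono s₂))
  have hf : ∀ s ∈ Icc 0 t, ‖w s‖ ^ 2 = 0 := by
    -- Grönwall for the squared H¹ distance; the constant is twice the 5 of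
    -- `VEquation.inner_sub_le`, the 2 coming from differentiating a square.
    refine eq_zero_of_abs_deriv_le_mul_abs_self_of_eq_zero_right (K := 10 * C)
      (f' := fun s => 2 * inner ℝ (w s) (w₁ s - w₂ s)) (hwc.norm.pow 2)
      (fun s hs => (hd s hs).norm_sq) ?_ fun s hs => ?_
    · simp [hw, h₁.1, h₂.1]
    · have hs' := Ico_subset_Icc_self hs
      have n1 : ‖Sobolev.vH (u₁ s)‖ ≤ C := (Sobolev.vH.le_opNorm _).trans (by
        rw [hC]
        exact mul_le_mul (by linarith [norm_nonneg Sobolev.vxH]) (hK s hs') (norm_nonneg _)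
          (by positivity))
      have n2 : ‖Sobolev.vxH (u₁ s)‖ ≤ C := (Sobolev.vxH.le_opNorm _).trans (by
        rw [hC]
        exact mul_le_mul (by linarith [norm_nonneg Sobolev.vH]) (hK s hs') (norm_nonneg _)
          (by positivity))
      have := (hw₁ s (s₁ hs')).2.inner_sub_le (hw₂ s (s₂ hs')).2 n1 n2
      rw [real_inner_comm] at this
      rw [Real.norm_eq_abs, abs_mul, abs_two, Real.norm_of_nonneg (by positivity)]
      linarith
  have := hf t ⟨ht₁.1, le_rfl⟩
  rw [sq_eq_zero_iff, norm_eq_zero, hw, sub_eq_zero] at this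
  exact Sobolev.vH_injective this

/-- Conservation of the `H¹` norm of `v`. -/
theorem IsSolution.norm_vH {u₀ : Sobolev 4} {T : EReal} {u : ℝ → Sobolev 4}
    (h : IsSolution u₀ T u) {t : ℝ} (ht : t ∈ timeInterval T) :
    ‖Sobolev.vH (u t)‖ = ‖Sobolev.vH u₀‖ := by
  obtain ⟨w, -, hw⟩ := h.exists_hasDerivWithinAt
  have s₁ := Icc_subset_timeInterval ht
  have key : ∀ s ∈ Icc 0 t, ‖Sobolev.vH (u s)‖ ^ 2 = ‖Sobolev.vH (u 0)‖ ^ 2 := by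
    refine constant_of_has_deriv_right_zero
      ((Sobolev.vH.continuous.comp_continuousOn (h.2.1.mono s₁)).norm.pow 2) fun s hs => ?_
    have hs' := s₁ (Ico_subset_Icc_self hs)
    have := ((hw s hs').1.mono_of_mem_nhdsWithin (timeInterval_mem_nhdsGE hs')).norm_sq
    rwa [real_inner_comm, (hw s hs').2.inner_self, mul_zero] at this
  have := key t ⟨ht.1, le_rfl⟩
  rw [h.1] at this
  exact (pow_left_inj₀ (norm_nonneg _) (norm_nonneg _) two_ne_zero).1 this

/-! ### First-order Green formulas and the lower bound for the pressure -/

theorem memLp_exp_neg_Ioi (x : ℝ) :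
    MemLp (fun y => Real.exp (x - y)) 2 (volume.restrict (Ioi x)) := by
  rw [memLp_two_iff_integrable_sq (by fun_prop)]
  have : ∀ y, Real.exp (x - y) ^ 2 = Real.exp (2 * x) * Real.exp (-2 * y) := fun y => by
    rw [← Real.exp_nat_mul, ← Real.exp_add]; congr 1; push_cast; ring
  simp only [this]
  exact (exp_neg_integrableOn_Ioi x two_pos).const_mul _

theorem memLp_exp_Iic (x : ℝ) :
    MemLp (fun y => Real.exp (y - x)) 2 (volume.restrict (Iic x)) := by
  rw [memLp_two_iff_integrable_sq (by fun_prop)]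
  have : ∀ y, Real.exp (y - x) ^ 2 = Real.exp (-(2 * x)) * Real.exp (2 * y) := fun y => by
    rw [← Real.exp_nat_mul, ← Real.exp_add]; congr 1; push_cast; ring
  simp only [this]
  exact (integrableOn_exp_mul_Iic two_pos x).const_mul _

theorem integrableOn_exp_neg_mul (x : ℝ) {g : ℝ → ℝ} (hg : MemLp g 2 volume) :
    IntegrableOn (fun y => Real.exp (x - y) * g y) (Ioi x) :=
  (memLp_exp_neg_Ioi x).integrable_mul (hg.restrict _)

theorem integrableOn_exp_mul (x : ℝ) {g : ℝ → ℝ} (hg : MemLp g 2 volume) :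
    IntegrableOn (fun y => Real.exp (y - x) * g y) (Iic x) :=
  (memLp_exp_Iic x).integrable_mul (hg.restrict _)

/-- The solution in `H¹` of `a - a' = g`. -/
theorem H1.rep_eq_integral_Ioi {a : H1} {g : L2} (h : a.d 1 = a.d 0 - g) (x : ℝ) :
    a.rep x = ∫ y in Ioi x, Real.exp (x - y) * g y := by
  have he : IsPrimitive (fun y => Real.exp (x - y)) (fun y => -Real.exp (x - y)) :=
    IsPrimitive.of_hasDerivAt (fun y => by
      simpa using ((hasDerivAt_id y).const_sub x).exp) (by fun_prop)
  have hae : (fun y => -Real.exp (x - y) * a.rep y + Real.exp (x - y) * a.d 1 y)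
      =ᵐ[volume] fun y => -(Real.exp (x - y) * g y) := by
    rw [h]
    filter_upwards [a.rep_ae, Lp.coeFn_sub (a.d 0) g] with y h1 h2
    rw [h1, h2, Pi.sub_apply]; ring
  have hp := (he.mul a.isPrimitive).congr hae
  have := hp.integral_Ioi (x := x) (integrableOn_exp_neg_mul x a.memLp_rep)
    (integrableOn_exp_neg_mul x (Lp.memLp g)).neg
  rw [integral_neg] at this
  simp only [sub_self, Real.exp_zero, one_mul] at this
  linarith

/-- The solution in `H¹` of `b + b' = g`. -/
theorem H1.rep_eq_integral_Iic {b : H1} {g : L2} (h : b.d 1 = g - b.d 0) (x : ℝ) :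
    b.rep x = ∫ y in Iic x, Real.exp (y - x) * g y := by
  have he : IsPrimitive (fun y => Real.exp (y - x)) (fun y => Real.exp (y - x)) :=
    IsPrimitive.of_hasDerivAt (fun y => by
      simpa using ((hasDerivAt_id y).sub_const x).exp) (by fun_prop)
  have hae : (fun y => Real.exp (y - x) * b.rep y + Real.exp (y - x) * b.d 1 y)
      =ᵐ[volume] fun y => Real.exp (y - x) * g y := by
    rw [h]
    filter_upwards [b.rep_ae, Lp.coeFn_sub g (b.d 0)] with y h1 h2
    rw [h1, h2, Pi.sub_apply]; ring
  have hp := (he.mul b.isPrimitive).congr hae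
  have := hp.integral_Iic (x := x) (integrableOn_exp_mul x b.memLp_rep)
    (integrableOn_exp_mul x (Lp.memLp g))
  rw [this]
  simp

theorem H1.mulL_d_zero_comm (f g : H1) : H1.mulL f (g.d 0) = H1.mulL g (f.d 0) := by
  apply L2.congr
  filter_upwards [H1.mulL_ae f (g.d 0), H1.mulL_ae g (f.d 0), f.rep_ae, g.rep_ae]
    with x h1 h2 h3 h4
  rw [h1, h2, ← h3, ← h4, mul_comm]

theorem H1.sub_d (f g : H1) (j : Fin 2) : (f - g).d j = f.d j - g.d j := rfl
theorem H1.add_d (f g : H1) (j : Fin 2) : (f + g).d j = f.d j + g.d j := rfl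

theorem source_ae (v vx : H1) :
    (H1.mulL v (v.d 0) + (1 / 2 : ℝ) • H1.mulL vx (vx.d 0) : L2) =ᵐ[volume]
      fun y => v.rep y ^ 2 + vx.rep y ^ 2 / 2 := by
  filter_upwards [H1.mulL_ae v (v.d 0), H1.mulL_ae vx (vx.d 0), v.rep_ae, vx.rep_ae,
    Lp.coeFn_add (H1.mulL v (v.d 0)) ((1 / 2 : ℝ) • H1.mulL vx (vx.d 0)),
    Lp.coeFn_smul (1 / 2 : ℝ) (H1.mulL vx (vx.d 0))] with y h1 h2 h3 h4 h5 h6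
  rw [h5, Pi.add_apply, h6, Pi.smul_apply, h1, h2, ← h3, ← h4, smul_eq_mul]
  ring

theorem sq_d_one_ae {v vx : H1} (hv : v.d 1 = vx.d 0) :
    (H1.mul v v).d 1 =ᵐ[volume] fun y => 2 * v.rep y * vx.rep y := by
  rw [H1.mul_d_one, hv]
  filter_upwards [H1.mulL_ae v (vx.d 0), vx.rep_ae,
    Lp.coeFn_add (H1.mulL v (vx.d 0)) (H1.mulL v (vx.d 0))] with y h1 h2 h3
  rw [h3, Pi.add_apply, h1, ← h2]
  ring

/-- For `g = v² + v_x²/2` and `P, z` in `H¹` with `P' = -z` and `z' = g - P` one has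
`v² ≤ 2 P`. -/
theorem sq_le_two_mul_pressure {v vx P z : H1} (hv : v.d 1 = vx.d 0) (hP : P.d 1 = -z.d 0)
    (hz : z.d 1 = H1.mulL v (v.d 0) + (1 / 2 : ℝ) • H1.mulL vx (vx.d 0) - P.d 0) (x : ℝ) :
    v.rep x ^ 2 ≤ 2 * P.rep x := by
  set g : L2 := H1.mulL v (v.d 0) + (1 / 2 : ℝ) • H1.mulL vx (vx.d 0) with hg
  set s := H1.mul v v with hs
  have hsr : ∀ y, s.rep y = v.rep y ^ 2 := fun y => by rw [hs, H1.rep_mul]; ring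
  -- P - z and P + z satisfy first-order equations with source g, so both are one-sided exponential
  -- integrals of g. The function v² has the same representations with sources v² ∓ 2v v_x, and
  -- these are at most 2g = 2v² + v_x² because (v ± v_x)² ≥ 0. Adding the two comparisons removes z.
  have e1 := H1.rep_eq_integral_Ioi (a := P - z) (g := g)
    (by rw [H1.sub_d, H1.sub_d, hP, hz]; abel) x
  have e2 := H1.rep_eq_integral_Iic (b := P + z) (g := g)
    (by rw [H1.add_d, H1.add_d, hP, hz]; abel) x
  have e3 := H1.rep_eq_integral_Ioi (a := s) (g := s.d 0 - s.d 1) (by abel) x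
  have e4 := H1.rep_eq_integral_Iic (b := s) (g := s.d 0 + s.d 1) (by abel) x
  have i1 := integrableOn_exp_neg_mul x (Lp.memLp g)
  have i2 := integrableOn_exp_mul x (Lp.memLp g)
  have i3 := integrableOn_exp_neg_mul x (Lp.memLp (s.d 0 - s.d 1))
  have i4 := integrableOn_exp_mul x (Lp.memLp (s.d 0 + s.d 1))
  have c1 : ∫ y in Ioi x, Real.exp (x - y) * (s.d 0 - s.d 1 : L2) y ≤
      ∫ y in Ioi x, 2 * (Real.exp (x - y) * g y) := by
    refine integral_mono_ae i3 (i1.const_mul 2) (ae_restrict_of_ae ?_)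
    filter_upwards [source_ae v vx, sq_d_one_ae hv, s.rep_ae, Lp.coeFn_sub (s.d 0) (s.d 1)]
      with y h1 h2 h3 h4
    rw [h4, Pi.sub_apply, ← h3, h2, h1, hsr, mul_left_comm]
    refine mul_le_mul_of_nonneg_left ?_ (Real.exp_pos _).le
    nlinarith [sq_nonneg (v.rep y + vx.rep y)]
  have c2 : ∫ y in Iic x, Real.exp (y - x) * (s.d 0 + s.d 1 : L2) y ≤
      ∫ y in Iic x, 2 * (Real.exp (y - x) * g y) := by
    refine integral_mono_ae i4 (i2.const_mul 2) (ae_restrict_of_ae ?_)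
    filter_upwards [source_ae v vx, sq_d_one_ae hv, s.rep_ae, Lp.coeFn_add (s.d 0) (s.d 1)]
      with y h1 h2 h3 h4
    rw [h4, Pi.add_apply, ← h3, h2, h1, hsr, mul_left_comm]
    refine mul_le_mul_of_nonneg_left ?_ (Real.exp_pos _).le
    nlinarith [sq_nonneg (v.rep y - vx.rep y)]
  rw [integral_const_mul, ← e1, ← e3, hsr, H1.rep_sub] at c1
  rw [integral_const_mul, ← e2, ← e4, hsr, H1.rep_add] at c2
  linarith

/-! ### The material derivative and its slopes -/

theorem Sobolev.hasDerivAt_vH (U : Sobolev 4) (x : ℝ) :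
    HasDerivAt (Sobolev.vH U).rep ((Sobolev.vxH U).rep x) x := by
  have h : IsPrimitive (Sobolev.vH U).rep (Sobolev.vxH U).rep :=
    (Sobolev.vH U).isPrimitive.congr (Sobolev.vxH U).rep_ae.symm
  have hc := (Sobolev.vxH U).continuous_rep
  rw [h.eq_add 0]
  exact (intervalIntegral.integral_hasDerivAt_right (hc.intervalIntegrable _ _)
    hc.stronglyMeasurable.stronglyMeasurableAtFilter hc.continuousAt).const_add _

/-- The material derivative `v_t + v v_x`. -/
def materialDeriv (U : Sobolev 4) (w : H1) : H1 := w + H1.mul (Sobolev.vH U) (Sobolev.vxH U)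

theorem materialDeriv_rep (U : Sobolev 4) (w : H1) (x : ℝ) :
    (materialDeriv U w).rep x = w.rep x + (Sobolev.vH U).rep x * (Sobolev.vxH U).rep x := by
  rw [materialDeriv, H1.rep_add, H1.rep_mul]

/-- With z the material derivative, z_x = v² + v_x²/2 - P ≤ v²/2 + v_x²/2, and the sharp embedding
bounds v²/2 by a quarter of the squared H¹ norm. -/
theorem VEquation.materialDeriv_d_one_le {U : Sobolev 4} {w : H1} (h : VEquation U w) :
    ∀ᵐ x, (materialDeriv U w).d 1 x ≤
      ‖Sobolev.vH U‖ ^ 2 / 4 + (Sobolev.vxH U).rep x ^ 2 / 2 := by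
  set v := Sobolev.vH U with hv
  set vx := Sobolev.vxH U with hvx
  set z := materialDeriv U w with hz
  have hvd : v.d 1 = vx.d 0 := rfl
  -- `Q` is -P written without inverting 1 - ∂ₓ². By the equation its derivative is v_t + v_x m +
  -- v_x v_xx, which is v_t + v v_x because m = v - v_xx.
  set Q : L2 := w.d 1 - H1.mulL v U.m + (1 / 2 : ℝ) • H1.mulL vx (vx.d 0) with hQ
  have hs := (H1.mul vx vx).isWeakDeriv.smul (1 / 2)
  rw [H1.mul_d_zero, H1.mul_d_one] at hs
  have hQw : IsWeakDeriv Q (z.d 0) := by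
    have := h.add hs
    convert this using 1
    rw [U.m_eq, map_sub, H1.mulL_d_zero_comm, hz, materialDeriv, H1.add_d, H1.mul_d_zero]
    module
  set P : H1 := H1.mk (-Q) (-z.d 0) (by
    have := hQw.smul (-1)
    simpa using this) with hP
  have hz1 : z.d 1 = H1.mulL v (v.d 0) + (1 / 2 : ℝ) • H1.mulL vx (vx.d 0) - P.d 0 := by
    rw [hP, H1.mk_d_zero, hQ, U.m_eq, map_sub, hz, materialDeriv, H1.add_d, H1.mul_d_one, ← hv,
      ← hvx, hvd]
    module
  have key := sq_le_two_mul_pressure (v := v) (vx := vx) (P := P) (z := z) hvd rfl hz1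
  rw [hz1]
  filter_upwards [source_ae v vx, P.rep_ae, Lp.coeFn_sub
    (H1.mulL v (v.d 0) + (1 / 2 : ℝ) • H1.mulL vx (vx.d 0)) (P.d 0)] with x h1 h2 h3
  rw [h3, Pi.sub_apply, h1, ← h2]
  have := v.rep_sq_le x
  linarith [key x]

/-- The slope of `v` and that of the material derivative of `v`. -/
theorem VEquation.slope_materialDeriv_le {U : Sobolev 4} {w : H1} (h : VEquation U w) {N : ℝ}
    (hN : ‖Sobolev.vxH U‖ ≤ N) {x y : ℝ} (hxy : x ≠ y) :
    ((materialDeriv U w).rep y - (materialDeriv U w).rep x) / (y - x) ≤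
      ‖Sobolev.vH U‖ ^ 2 / 4 + N ^ 2 * √|y - x|
        + (((Sobolev.vH U).rep y - (Sobolev.vH U).rep x) / (y - x)) ^ 2 / 2 := by
  wlog hlt : x < y generalizing x y
  · have := this hxy.symm (lt_of_le_of_ne (not_lt.1 hlt) hxy.symm)
    rw [← neg_sub x y, ← neg_sub ((materialDeriv U w).rep x), neg_div_neg_eq,
      ← neg_sub ((Sobolev.vH U).rep x), neg_div_neg_eq, abs_neg]
    exact this
  set v := Sobolev.vH U with hv
  set vx := Sobolev.vxH U with hvx
  set ρ := (v.rep y - v.rep x) / (y - x) with hρ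
  -- At some intermediate point v_x equals the slope of v. Hölder continuity then replaces v_x² by
  -- the squared slope throughout the interval, at the cost of the square-root error.
  obtain ⟨ξ, hξ, hξρ⟩ := exists_hasDerivAt_eq_slope v.rep vx.rep hlt v.continuous_rep.continuousOn
    fun s _ => U.hasDerivAt_vH s
  have hN0 : 0 ≤ N := (norm_nonneg _).trans hN
  have hb : ∀ s, |vx.rep s| ≤ N := fun s => (vx.abs_rep_le s).trans hN
  have hsq : ∀ s ∈ Icc x y, vx.rep s ^ 2 ≤ ρ ^ 2 + 2 * (N ^ 2 * √|y - x|) := by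
    intro s hs
    have h1 : |vx.rep s - vx.rep ξ| ≤ N * √|y - x| := by
      apply abs_le_of_sq_le_sq _ (by positivity)
      rw [mul_pow, Real.sq_sqrt (abs_nonneg _)]
      refine (vx.rep_holder ξ s).trans ?_
      refine mul_le_mul (pow_le_pow_left₀ (norm_nonneg _) hN 2) ?_ (abs_nonneg _) (by positivity)
      rw [abs_of_pos (by linarith : 0 < y - x), abs_le]
      constructor <;> linarith [hs.1, hs.2, hξ.1, hξ.2]
    have h2 : |vx.rep s + vx.rep ξ| ≤ 2 * N :=
      (abs_add_le _ _).trans (by linarith [hb s, hb ξ])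
    have h3 : |(vx.rep s - vx.rep ξ) * (vx.rep s + vx.rep ξ)| ≤ N * √|y - x| * (2 * N) := by
      rw [abs_mul]
      exact mul_le_mul h1 h2 (abs_nonneg _) (by positivity)
    have h4 := (le_abs_self _).trans h3
    rw [hρ, ← hξρ]
    nlinarith
  rw [div_le_iff₀ (by linarith), (materialDeriv U w).isPrimitive.sub_eq]
  have : ∫ s in x..y, (materialDeriv U w).d 1 s ≤
      ∫ _ in x..y, (‖v‖ ^ 2 / 4 + N ^ 2 * √|y - x| + ρ ^ 2 / 2) := by
    refine intervalIntegral.integral_mono_ae_restrict hlt.le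
      ((materialDeriv U w).isPrimitive.intervalIntegrable x y) intervalIntegrable_const ?_
    filter_upwards [ae_restrict_of_ae h.materialDeriv_d_one_le,
      ae_restrict_mem measurableSet_Icc] with s h1 h2
    linarith [hsq s h2]
  rw [intervalIntegral.integral_const, smul_eq_mul] at this
  linarith

/-- The chain rule along a curve. -/
theorem H1.hasDerivWithinAt_rep_comp {v : ℝ → H1} {w : H1} {q : ℝ → ℝ} {q' g t : ℝ} {S : Set ℝ}
    (hv : HasDerivWithinAt v w S t) (hq : HasDerivWithinAt q q' S t)
    (hg : HasDerivAt (v t).rep g (q t)) :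
    HasDerivWithinAt (fun s => (v s).rep (q s)) (w.rep (q t) + g * q') S t := by
  have h1 : HasDerivWithinAt (fun s => (v t).rep (q s)) (g * q') S t :=
    hg.comp_hasDerivWithinAt t hq
  have h2 : HasDerivWithinAt (fun s => (v s).rep (q s) - (v t).rep (q s)) (w.rep (q t)) S t := by
    rw [hasDerivWithinAt_iff_isLittleO] at hv ⊢
    -- The first remainder is small uniformly in the position, since the H¹ norm dominates the
    -- supremum; the second only needs continuity of `w` at the limiting point.
    have e : ∀ s, (v s).rep (q s) - (v t).rep (q s) - ((v t).rep (q t) - (v t).rep (q t)) -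
        (s - t) • w.rep (q t) =
        (v s - v t - (s - t) • w).rep (q s) + (s - t) * (w.rep (q s) - w.rep (q t)) := by
      intro s
      rw [H1.rep_sub, H1.rep_sub, H1.rep_smul, smul_eq_mul]
      ring
    simp only [e]
    refine Asymptotics.IsLittleO.add ?_ ?_
    · refine Asymptotics.IsBigO.trans_isLittleO (Asymptotics.IsBigO.of_bound 1 ?_) hv
      refine Eventually.of_forall fun s => ?_
      rw [one_mul]
      exact H1.abs_rep_le _ _
    · have : (fun s => w.rep (q s) - w.rep (q t)) =o[𝓝[S] t] fun _ => (1 : ℝ) := by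
        rw [Asymptotics.isLittleO_one_iff, tendsto_sub_nhds_zero_iff]
        exact (w.continuous_rep.tendsto _).comp hq.continuousWithinAt
      simpa using (Asymptotics.isBigO_refl (fun s => s - t) (𝓝[S] t)).mul_isLittleO this
  refine ((h2.add h1).congr_of_eventuallyEq ?_ ?_)
  · exact Eventually.of_forall fun s => by simp
  · simp

/-! ### Riccati comparison along characteristics and the lifespan bound -/

/-- Finite lifespan for a Riccati inequality. -/
theorem riccati_lifespan {R R' : ℝ → ℝ} {b c : ℝ} (hb : 0 ≤ b) (hR : ContinuousOn R (Icc 0 b))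
    (hR' : ∀ t ∈ Ico 0 b, HasDerivWithinAt R (R' t) (Ici t) t)
    (hle : ∀ t ∈ Ico 0 b, R' t ≤ c - R t ^ 2 / 2) (hc : 0 ≤ c) (h0 : R 0 < 0)
    (h0c : 2 * c < R 0 ^ 2) : b ≤ 1 / (-(1 / 2) * R 0 + c / R 0) := by
  set r := R 0 with hr
  -- The initial value is a barrier: wherever R = r, the derivative is at most c - r²/2 < 0.
  have h1 : ∀ ⦃t⦄, t ∈ Icc 0 b → R t ≤ r :=
    image_le_of_deriv_right_lt_deriv_boundary (B := fun _ => r) (B' := fun _ => 0) hR hR' le_rfl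
      (fun t => hasDerivAt_const t r) fun t ht hRt => by
        have := hle t ht
        rw [hRt] at this
        linarith
  set κ := 1 / 2 - c / r ^ 2 with hκ
  have hr2 : 0 < r ^ 2 := by nlinarith
  have hκ0 : 0 < κ := by
    rw [hκ, sub_pos, div_lt_iff₀ hr2]; linarith
  have hne : ∀ t ∈ Icc 0 b, R t ≠ 0 := fun t ht => ((h1 ht).trans_lt h0).ne
  -- Below the barrier (1/R)' = -R'/R² ≥ 1/2 - c/R² ≥ κ, so 1/R increases at rate at least `κ` while
  -- staying negative. This is impossible beyond time -1/(rκ).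
  have h2 : ∀ ⦃t⦄, t ∈ Icc 0 b → 1 / r + κ * t ≤ (R t)⁻¹ := by
    refine image_le_of_deriv_right_le_deriv_boundary (f := fun t => 1 / r + κ * t)
      (f' := fun _ => κ) (B' := fun t => -R' t / R t ^ 2) (by fun_prop)
      (fun t _ => ?_) (by simp [hr]) (hR.inv₀ hne)
      (fun t ht => (hR' t ht).fun_inv (hne t (Ico_subset_Icc_self ht))) fun t ht => ?_
    · have := ((hasDerivAt_id t).const_mul κ).const_add (1 / r)
      rw [mul_one] at this
      exact this.hasDerivWithinAt
    · have h3 := h1 (Ico_subset_Icc_self ht)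
      have h4 : r ^ 2 ≤ R t ^ 2 := by nlinarith
      rw [le_div_iff₀ (by linarith)]
      have h5 : c ≤ c / r ^ 2 * R t ^ 2 := by
        rw [div_mul_eq_mul_div, le_div_iff₀ hr2]
        exact mul_le_mul_of_nonneg_left h4 hc
      have := hle t ht
      rw [hκ]
      linarith
  have h3 := h2 (right_mem_Icc.2 hb)
  have h4 : (R b)⁻¹ < 0 := inv_lt_zero.2 ((h1 (right_mem_Icc.2 hb)).trans_lt h0)
  have h5 : -(1 / 2) * r + c / r = -r * κ := by
    have := h0.ne
    rw [hκ]; field_simp; ring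
  rw [h5, le_div_iff₀ (mul_pos (by linarith) hκ0)]
  have h6 : κ * b < -(1 / r) := by linarith
  have h7 : (-r) * (κ * b) < (-r) * (-(1 / r)) := mul_lt_mul_of_pos_left h6 (by linarith)
  have h8 : (-r) * (-(1 / r)) = 1 := by rw [neg_mul_neg, mul_one_div_cancel h0.ne]
  linarith

/-- Characteristics of a continuous curve in `H¹` with Lipschitz values. -/
theorem exists_characteristic {v : ℝ → H1} {b N : ℝ} (hb : 0 ≤ b)
    (hv : ContinuousOn v (Icc 0 b)) (hN : ∀ t ∈ Icc 0 b, ∀ x y,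
      |(v t).rep x - (v t).rep y| ≤ N * |x - y|) (hN0 : 0 ≤ N) (x₀ : ℝ) :
    ∃ q : ℝ → ℝ, q 0 = x₀ ∧
      ∀ t ∈ Icc 0 b, HasDerivWithinAt q ((v t).rep (q t)) (Icc 0 b) t := by
  obtain ⟨C, hC0, hC⟩ := ContinuousOn.exists_norm_le hv
  -- A curve of speed at most `C` stays within `C * b` of its start, so the ball of this radius
  -- gives existence on all of `[0, b]`.
  have : IsPicardLindelof (fun t x => (v t).rep x) (⟨0, left_mem_Icc.2 hb⟩ : Icc 0 b) x₀
      ⟨C * b, mul_nonneg hC0 hb⟩ 0 ⟨C, hC0⟩ ⟨N, hN0⟩ := by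
    refine ⟨fun t ht => ?_, fun x _ => ?_, fun t ht x _ => ?_, ?_⟩
    · exact LipschitzOnWith.of_dist_le_mul fun x _ y _ => hN t ht x y
    · exact (H1.evalL x).continuous.comp_continuousOn hv
    · exact ((v t).abs_rep_le x).trans (hC t ht)
    · simp only [sub_zero, sub_self, max_eq_left hb, NNReal.coe_zero]
      exact le_rfl
  exact this.exists_eq_forall_mem_Icc_hasDerivWithinAt₀

theorem hasDerivWithinAt_Ici_of_Icc {E : Type*} [NormedAddCommGroup E] [NormedSpace ℝ E]
    {f : ℝ → E} {f' : E} {a b t : ℝ} (h : HasDerivWithinAt f f' (Icc a b) t) (ht : t ∈ Ico a b) :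
    HasDerivWithinAt f f' (Ici t) t :=
  h.mono_of_mem_nhdsWithin (mem_of_superset (Icc_mem_nhdsGE ht.2) (Icc_subset_Icc_left ht.1))

theorem Sobolev.abs_rep_vH_sub_le {U : Sobolev 4} {N : ℝ} (hN : ‖Sobolev.vxH U‖ ≤ N) (x y : ℝ) :
    |(Sobolev.vH U).rep x - (Sobolev.vH U).rep y| ≤ N * |x - y| := by
  have := convex_univ.norm_image_sub_le_of_norm_hasDerivWithin_le (f := (Sobolev.vH U).rep)
    (C := N) (fun s _ => (U.hasDerivAt_vH s).hasDerivWithinAt)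
    (fun s _ => ((Sobolev.vxH U).abs_rep_le s).trans hN) (mem_univ y) (mem_univ x)
  simpa using this

/-- A lower bound that propagates along characteristics. -/
theorem ne_zero_and_abs_le_of_deriv {D D' : ℝ → ℝ} {b N : ℝ}
    (hD : ContinuousOn D (Icc 0 b)) (hD' : ∀ t ∈ Ico 0 b, HasDerivWithinAt D (D' t) (Ici t) t)
    (hN : ∀ t ∈ Ico 0 b, |D' t| ≤ N * |D t|) (h0 : D 0 ≠ 0) {t : ℝ} (ht : t ∈ Icc 0 b) :
    D t ≠ 0 ∧ |D t| ≤ |D 0| * Real.exp (N * t) := by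
  constructor
  · have hd : ∀ s : ℝ, HasDerivAt (fun s => Real.exp (2 * N * s)) (Real.exp (2 * N * s) * (2 * N)) s :=
      fun s => by simpa using ((hasDerivAt_id s).const_mul (2 * N)).exp
    -- The weight makes D² exp(2Nt) nondecreasing, because 2DD' ≥ -2ND². Hence distinct
    -- characteristics never meet.
    have : D 0 ^ 2 ≤ D t ^ 2 * Real.exp (2 * N * t) := by
      refine image_le_of_deriv_right_le_deriv_boundary (f := fun _ => D 0 ^ 2) (f' := fun _ => 0)
        (B := fun t => D t ^ 2 * Real.exp (2 * N * t))
        (B' := fun t => (2 * D t * D' t) * Real.exp (2 * N * t) +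
          D t ^ 2 * (Real.exp (2 * N * t) * (2 * N))) continuousOn_const
        (fun s _ => hasDerivWithinAt_const s _ _) (by simp) (by fun_prop)
        (fun s hs => ?_) (fun s hs => ?_) ht
      · have := ((hD' s hs).fun_pow 2).fun_mul (hd s).hasDerivWithinAt
        simpa using this
      · have h1 := hN s hs
        have h2 : |D s * D' s| ≤ N * D s ^ 2 := by
          rw [abs_mul, ← sq_abs (D s)]
          nlinarith [abs_nonneg (D s)]
        have h3 := (abs_le.1 h2).1
        have h4 := Real.exp_pos (2 * N * s)
        nlinarith
    intro h
    rw [h] at this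
    have h2 : 0 < D 0 ^ 2 := by positivity
    simp at this
    exact h0 this
  · have := norm_le_gronwallBound_of_norm_deriv_right_le (ε := 0) (K := N) hD hD'
      (δ := |D 0|) le_rfl (fun s hs => by simpa using hN s hs) t ht
    rwa [gronwallBound_ε0, sub_zero] at this

/-- The lifespan estimate, with an error coming from the distance of two characteristics. -/
theorem IsSolution.le_lifespan_slope {u₀ : Sobolev 4} {T : EReal} {u : ℝ → Sobolev 4}
    (h : IsSolution u₀ T u) {b : ℝ} (hb : b ∈ timeInterval T) :
    ∃ N, 0 ≤ N ∧ ∀ x y : ℝ, x ≠ y → ∀ r c : ℝ,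
      r = ((Sobolev.vH u₀).rep y - (Sobolev.vH u₀).rep x) / (y - x) →
      c = ‖Sobolev.vH u₀‖ ^ 2 / 4 + N ^ 2 * √(|y - x| * Real.exp (N * b)) →
      r < 0 → 2 * c < r ^ 2 → b ≤ 1 / (-(1 / 2) * r + c / r) := by
  obtain ⟨w, -, hw⟩ := h.exists_hasDerivWithinAt
  have s₁ := Icc_subset_timeInterval hb
  have huc := h.2.1.mono s₁
  obtain ⟨N, hN0, hN⟩ := ContinuousOn.exists_norm_le (Sobolev.vxH.continuous.comp_continuousOn huc)
  refine ⟨N, hN0, fun x y hxy r c hr hc hr0 hrc => ?_⟩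
  have hvc : ContinuousOn (fun t => Sobolev.vH (u t)) (Icc 0 b) :=
    Sobolev.vH.continuous.comp_continuousOn huc
  have hlip : ∀ t ∈ Icc 0 b, ∀ x y, |(Sobolev.vH (u t)).rep x - (Sobolev.vH (u t)).rep y|
      ≤ N * |x - y| := fun t ht => Sobolev.abs_rep_vH_sub_le (hN t ht)
  obtain ⟨q₁, hq₁0, hq₁⟩ := exists_characteristic hb.1 hvc hlip hN0 x
  obtain ⟨q₂, hq₂0, hq₂⟩ := exists_characteristic hb.1 hvc hlip hN0 y
  set D : ℝ → ℝ := fun t => q₂ t - q₁ t with hD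
  have c₁ : ContinuousOn q₁ (Icc 0 b) := fun t ht => (hq₁ t ht).continuousWithinAt
  have c₂ : ContinuousOn q₂ (Icc 0 b) := fun t ht => (hq₂ t ht).continuousWithinAt
  have hDc : ContinuousOn D (Icc 0 b) := c₂.sub c₁
  have hD0 : D 0 = y - x := by rw [hD]; simp [hq₁0, hq₂0]
  have hDd : ∀ t ∈ Icc 0 b, HasDerivWithinAt D
      ((Sobolev.vH (u t)).rep (q₂ t) - (Sobolev.vH (u t)).rep (q₁ t)) (Icc 0 b) t :=
    fun t ht => (hq₂ t ht).sub (hq₁ t ht)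
  have hDn : ∀ t ∈ Icc 0 b, D t ≠ 0 ∧ |D t| ≤ |D 0| * Real.exp (N * t) := fun t ht =>
    ne_zero_and_abs_le_of_deriv hDc (fun s hs => hasDerivWithinAt_Ici_of_Icc (hDd s (Ico_subset_Icc_self hs)) hs)
      (fun s hs => hlip s (Ico_subset_Icc_self hs) _ _) (by rw [hD0, sub_ne_zero]; exact hxy.symm) ht
  set V : ℝ → ℝ := fun t => (Sobolev.vH (u t)).rep (q₂ t) - (Sobolev.vH (u t)).rep (q₁ t) with hV
  have hVd : ∀ t ∈ Icc 0 b, HasDerivWithinAt V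
      ((materialDeriv (u t) (w t)).rep (q₂ t) - (materialDeriv (u t) (w t)).rep (q₁ t))
      (Icc 0 b) t := by
    intro t ht
    have hv := (hw t (s₁ ht)).1.mono s₁
    have a1 := H1.hasDerivWithinAt_rep_comp hv (hq₁ t ht) ((u t).hasDerivAt_vH (q₁ t))
    have a2 := H1.hasDerivWithinAt_rep_comp hv (hq₂ t ht) ((u t).hasDerivAt_vH (q₂ t))
    rw [materialDeriv_rep, materialDeriv_rep]
    rw [mul_comm] at a1 a2
    exact a2.sub a1
  -- `R` is the slope of v between the two characteristics. Its derivative is the slope of the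
  -- material derivative minus R², so the +R²/2 in `VEquation.slope_materialDeriv_le` leaves -R²/2.
  -- The error is bounded uniformly in time, since the characteristics separate at most
  -- exponentially.
  set R : ℝ → ℝ := fun t => V t / D t with hR
  have hRd : ∀ t ∈ Icc 0 b, HasDerivWithinAt R
      ((((materialDeriv (u t) (w t)).rep (q₂ t) - (materialDeriv (u t) (w t)).rep (q₁ t)) * D t
        - V t * V t) / D t ^ 2) (Icc 0 b) t := fun t ht =>
    (hVd t ht).fun_div (hDd t ht) (hDn t ht).1
  have hR0 : R 0 = r := by
    rw [hR, hr]; simp only [hV, hD0, hq₁0, hq₂0, h.1]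
  have hc0 : 0 ≤ c := by rw [hc]; positivity
  rw [← hR0] at hr0 hrc ⊢
  refine riccati_lifespan hb.1 (fun t ht => (hRd t ht).continuousWithinAt)
    (fun t ht => hasDerivWithinAt_Ici_of_Icc (hRd t (Ico_subset_Icc_self ht)) ht) (fun t ht => ?_) hc0 hr0 hrc
  have ht' := Ico_subset_Icc_self ht
  have hDt := hDn t ht'
  have key := (hw t (s₁ ht')).2.slope_materialDeriv_le (hN t ht')
    (show q₁ t ≠ q₂ t from fun e => hDt.1 (by simp [hD, e]))
  rw [h.norm_vH (s₁ ht')] at key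
  have e1 : ((materialDeriv (u t) (w t)).rep (q₂ t) - (materialDeriv (u t) (w t)).rep (q₁ t)) /
      (q₂ t - q₁ t) - R t ^ 2 = (((materialDeriv (u t) (w t)).rep (q₂ t) -
      (materialDeriv (u t) (w t)).rep (q₁ t)) * D t - V t * V t) / D t ^ 2 := by
    have := hDt.1
    change _ / D t - (V t / D t) ^ 2 = _
    field_simp
  have e2 : √|q₂ t - q₁ t| ≤ √(|y - x| * Real.exp (N * b)) := by
    apply Real.sqrt_le_sqrt
    refine hDt.2.trans ?_
    rw [hD0]
    gcongr
    exact ht'.2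
  have e3 : N ^ 2 * √|q₂ t - q₁ t| ≤ N ^ 2 * √(|y - x| * Real.exp (N * b)) := by gcongr
  have e4 : ((Sobolev.vH (u t)).rep (q₂ t) - (Sobolev.vH (u t)).rep (q₁ t)) / (q₂ t - q₁ t) = R t :=
    rfl
  rw [e4] at key
  rw [← e1, hc]
  linarith

/-- The upper bound for the lifespan. -/
theorem IsSolution.le_lifespan {u₀ : Sobolev 4} {T : EReal} {u : ℝ → Sobolev 4}
    (h : IsSolution u₀ T u) {b : ℝ} (hb : b ∈ timeInterval T) {x₀ : ℝ}
    (hx₀ : u₀.vxRep x₀ < -(u₀.E₀ / √2)) :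
    b ≤ 1 / (-(1 / 2) * u₀.vxRep x₀ + u₀.E₀ ^ 2 / (4 * u₀.vxRep x₀)) := by
  obtain ⟨N, hN0, hN⟩ := h.le_lifespan_slope hb
  rw [u₀.vxRep_eq, u₀.E₀_eq] at *
  set φ := (Sobolev.vxH u₀).rep x₀ with hφ
  set E := ‖Sobolev.vH u₀‖ with hE
  have hE0 : 0 ≤ E := norm_nonneg _
  have hφ0 : φ < 0 := hx₀.trans_le (neg_nonpos.2 (by positivity))
  have hφE : E ^ 2 / 2 < φ ^ 2 := by
    have h1 : E / √2 < -φ := by linarith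
    have h2 : (E / √2) ^ 2 < (-φ) ^ 2 := pow_lt_pow_left₀ h1 (by positivity) two_ne_zero
    rwa [div_pow, Real.sq_sqrt zero_le_two, neg_sq] at h2
  -- As ε tends to 0 the slope tends to φ and the error vanishes, because `N` does not depend on the
  -- two starting points. The hypotheses on slopes hold for small ε, being strict in the limit: φ <
  -- 0 and E²/2 < φ².
  set r : ℝ → ℝ := fun ε =>
    ((Sobolev.vH u₀).rep (x₀ + ε) - (Sobolev.vH u₀).rep x₀) / (x₀ + ε - x₀) with hr
  set c : ℝ → ℝ := fun ε => E ^ 2 / 4 + N ^ 2 * √(|x₀ + ε - x₀| * Real.exp (N * b)) with hc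
  have hrl : Tendsto r (𝓝[≠] 0) (𝓝 φ) := by
    have := (u₀.hasDerivAt_vH x₀).tendsto_slope_zero
    refine this.congr fun ε => ?_
    rw [hr]
    simp only [add_sub_cancel_left, smul_eq_mul]
    rw [div_eq_inv_mul]
  have hcl : Tendsto c (𝓝[≠] 0) (𝓝 (E ^ 2 / 4)) := by
    have : Continuous c := by fun_prop
    have h1 := this.tendsto 0
    have h2 : c 0 = E ^ 2 / 4 := by simp [hc]
    rw [h2] at h1
    exact h1.mono_left nhdsWithin_le_nhds
  have hden : -(1 / 2) * φ + E ^ 2 / 4 / φ ≠ 0 := by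
    have : -(1 / 2) * φ + E ^ 2 / 4 / φ = (-1 / 2) * (φ ^ 2 - E ^ 2 / 2) / φ := by
      field_simp; ring
    rw [this]
    exact div_ne_zero (mul_ne_zero (by norm_num) (by linarith)) hφ0.ne
  have hlim : Tendsto (fun ε => 1 / (-(1 / 2) * r ε + c ε / r ε)) (𝓝[≠] 0)
      (𝓝 (1 / (-(1 / 2) * φ + E ^ 2 / 4 / φ))) :=
    tendsto_const_nhds.div ((hrl.const_mul _).add (hcl.div hrl hφ0.ne)) hden
  rw [← div_div]
  refine ge_of_tendsto hlim ?_
  have ev1 := hrl.eventually (gt_mem_nhds hφ0)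
  have ev2 := (hcl.const_mul 2).eventually_lt (hrl.pow 2) (by linarith)
  filter_upwards [ev1, ev2, self_mem_nhdsWithin] with ε h1 h2 h3
  exact hN x₀ (x₀ + ε) (by simpa using fun e : ε = 0 => h3 e) (r ε) (c ε) rfl rfl h1 h2

/-! ### Lagrangian variables: an ordinary differential equation for a = log q_ξ -/

open BoundedContinuousFunction in
/-- Bounded continuous functions on the line. -/
abbrev Cb : Type := ℝ →ᵇ ℝ

theorem abs_exp_sub_exp_le {x y R : ℝ} (hx : x ≤ R) (hy : y ≤ R) :
    |Real.exp x - Real.exp y| ≤ Real.exp R * |x - y| := by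
  wlog h : y ≤ x generalizing x y
  · rw [abs_sub_comm, abs_sub_comm x]
    exact this hy hx (le_of_not_ge h)
  rw [abs_of_nonneg (sub_nonneg.2 (Real.exp_le_exp.2 h)), abs_of_nonneg (sub_nonneg.2 h)]
  have h1 : Real.exp x - Real.exp y = Real.exp x * (1 - Real.exp (y - x)) := by
    rw [mul_sub, ← Real.exp_add]; ring_nf
  rw [h1]
  refine mul_le_mul (Real.exp_le_exp.2 hx) ?_ ?_ (Real.exp_pos _).le
  · linarith [Real.add_one_le_exp (y - x)]
  · have : Real.exp (y - x) ≤ 1 := Real.exp_le_one_iff.2 (by linarith)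
    linarith

/-- A kernel that decays like `exp (-|s|)` and is Lipschitz away from `0`. -/
structure IsDecayKernel (k : ℝ → ℝ) : Prop where
  measurable : Measurable k
  bound : ∀ s, |k s| ≤ Real.exp (-|s|)
  lip : ∀ d s s', 0 < s * s' → d ≤ |s| → d ≤ |s'| → |k s - k s'| ≤ Real.exp (-d) * |s - s'|
  continuousAt : ∀ s, s ≠ 0 → ContinuousAt k s

/-- The Green function of `1 - ∂ₓ²`. -/
def greenKernel (s : ℝ) : ℝ := 1 / 2 * Real.exp (-|s|)

/-- The derivative of `greenKernel (y - x)` with respect to `x`. -/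
def greenKernelDeriv (s : ℝ) : ℝ := SignType.sign s * (1 / 2 * Real.exp (-|s|))

theorem greenKernel_lip (d s s' : ℝ) (h : d ≤ |s|) (h' : d ≤ |s'|) :
    |greenKernel s - greenKernel s'| ≤ Real.exp (-d) * |s - s'| := by
  have h1 := abs_exp_sub_exp_le (neg_le_neg h) (neg_le_neg h')
  have h2 : |(-|s| - -|s'|)| ≤ |s - s'| := by
    rw [neg_sub_neg, abs_sub_comm]; exact abs_abs_sub_abs_le _ _
  rw [greenKernel, greenKernel, ← mul_sub, abs_mul, abs_of_pos (by norm_num : (0 : ℝ) < 1 / 2)]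
  have h3 := mul_le_mul_of_nonneg_left h2 (Real.exp_pos (-d)).le
  have h4 := abs_nonneg (Real.exp (-|s|) - Real.exp (-|s'|))
  linarith

theorem abs_greenKernel_le (s : ℝ) : |greenKernel s| ≤ Real.exp (-|s|) := by
  rw [greenKernel, abs_of_nonneg (by positivity)]
  linarith [Real.exp_pos (-|s|)]

theorem isDecayKernel_greenKernel : IsDecayKernel greenKernel where
  measurable := by unfold greenKernel; fun_prop
  bound := abs_greenKernel_le
  lip d s s' _ := greenKernel_lip d s s'
  continuousAt s _ := by unfold greenKernel; fun_prop

theorem greenKernelDeriv_of_pos {s : ℝ} (h : 0 < s) : greenKernelDeriv s = greenKernel s := by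
  simp [greenKernelDeriv, greenKernel, sign_pos h]

theorem greenKernelDeriv_of_neg {s : ℝ} (h : s < 0) : greenKernelDeriv s = -greenKernel s := by
  simp [greenKernelDeriv, greenKernel, sign_neg h]

theorem isDecayKernel_greenKernelDeriv : IsDecayKernel greenKernelDeriv where
  measurable := by
    have : greenKernelDeriv = fun s => if 0 < s then greenKernel s else
        if s < 0 then -greenKernel s else 0 := by
      ext s
      rcases lt_trichotomy s 0 with h | h | h
      · simp [greenKernelDeriv_of_neg h, h, h.le]
      · simp [h, greenKernelDeriv]
      · simp [greenKernelDeriv_of_pos h, h]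
    rw [this]
    have hm := isDecayKernel_greenKernel.measurable
    exact Measurable.ite measurableSet_Ioi hm (Measurable.ite measurableSet_Iio hm.neg
      measurable_const)
  bound s := by
    rcases lt_trichotomy s 0 with h | h | h
    · rw [greenKernelDeriv_of_neg h, abs_neg]; exact abs_greenKernel_le s
    · simp [h, greenKernelDeriv]
    · rw [greenKernelDeriv_of_pos h]; exact abs_greenKernel_le s
  lip d s s' hs h h' := by
    rcases pos_and_pos_or_neg_and_neg_of_mul_pos hs with ⟨h1, h2⟩ | ⟨h1, h2⟩
    · rw [greenKernelDeriv_of_pos h1, greenKernelDeriv_of_pos h2]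
      exact greenKernel_lip d s s' h h'
    · rw [greenKernelDeriv_of_neg h1, greenKernelDeriv_of_neg h2, neg_sub_neg, abs_sub_comm]
      exact greenKernel_lip d s s' h h'
  continuousAt s hs := by
    have hc : Continuous greenKernel := by unfold greenKernel; fun_prop
    rcases hs.lt_or_gt with h | h
    · refine hc.neg.continuousAt.congr ?_
      filter_upwards [gt_mem_nhds h] with x hx
      exact (greenKernelDeriv_of_neg hx).symm
    · refine hc.continuousAt.congr ?_
      filter_upwards [lt_mem_nhds h] with x hx
      exact (greenKernelDeriv_of_pos hx).symm

/-- The flow map with derivative `exp a` that fixes the origin. -/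
def flow (a : Cb) (ξ : ℝ) : ℝ := ∫ s in (0 : ℝ)..ξ, Real.exp (a s)

theorem hasDerivAt_flow (a : Cb) (ξ : ℝ) : HasDerivAt (flow a) (Real.exp (a ξ)) ξ := by
  have hc : Continuous fun s => Real.exp (a s) := by fun_prop
  exact intervalIntegral.integral_hasDerivAt_right (hc.intervalIntegrable _ _)
    hc.stronglyMeasurable.stronglyMeasurableAtFilter hc.continuousAt

theorem continuous_flow (a : Cb) : Continuous (flow a) :=
  continuous_iff_continuousAt.2 fun ξ => (hasDerivAt_flow a ξ).continuousAt

theorem Cb.abs_le {a : Cb} {R : ℝ} (h : ‖a‖ ≤ R) (s : ℝ) : |a s| ≤ R :=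
  (a.norm_coe_le_norm s).trans h

/-- By the mean value theorem `p` is a value of exp a (any admissible value serves when x = y).
Keeping it explicit records the sign of the difference as well as its size. -/
theorem flow_sub (a : Cb) {R : ℝ} (h : ‖a‖ ≤ R) (x y : ℝ) :
    ∃ p, Real.exp (-R) ≤ p ∧ flow a y - flow a x = p * (y - x) := by
  have hR : 0 ≤ R := (norm_nonneg a).trans h
  have hp : ∀ s, Real.exp (-R) ≤ Real.exp (a s) := fun s =>
    Real.exp_le_exp.2 (abs_le.1 (Cb.abs_le h s)).1
  wlog hxy : x ≤ y generalizing x y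
  · obtain ⟨p, h1, h2⟩ := this y x (le_of_not_ge hxy)
    exact ⟨p, h1, by linarith⟩
  rcases hxy.eq_or_lt with rfl | hlt
  · exact ⟨1, Real.exp_le_one_iff.2 (by linarith), by simp⟩
  · obtain ⟨s, -, hs⟩ := exists_hasDerivAt_eq_slope (flow a) (fun s => Real.exp (a s)) hlt
      (continuous_flow a).continuousOn fun s _ => hasDerivAt_flow a s
    exact ⟨_, hp s, by rw [hs, div_mul_cancel₀ _ (by linarith)]⟩

theorem le_abs_flow_sub {a : Cb} {R : ℝ} (h : ‖a‖ ≤ R) (x y : ℝ) :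
    Real.exp (-R) * |x - y| ≤ |flow a y - flow a x| := by
  obtain ⟨p, hp, he⟩ := flow_sub a h x y
  have : 0 < p := (Real.exp_pos _).trans_le hp
  rw [he, abs_mul, abs_of_pos this, abs_sub_comm x]
  gcongr

theorem abs_flow_sub_sub_le {a b : Cb} {R : ℝ} (ha : ‖a‖ ≤ R) (hb : ‖b‖ ≤ R) (x y : ℝ) :
    |(flow a y - flow a x) - (flow b y - flow b x)| ≤ Real.exp R * ‖a - b‖ * |x - y| := by
  have hi : ∀ (a : Cb) (x y : ℝ), IntervalIntegrable (fun s => Real.exp (a s)) volume x y :=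
    fun a x y => (by fun_prop : Continuous fun s => Real.exp (a s)).intervalIntegrable _ _
  have e : ∀ a : Cb, flow a y - flow a x = ∫ s in x..y, Real.exp (a s) := fun a =>
    intervalIntegral.integral_interval_sub_left (hi a _ _) (hi a _ _)
  rw [e, e, ← intervalIntegral.integral_sub (hi a _ _) (hi b _ _), ← Real.norm_eq_abs,
    abs_sub_comm]
  refine intervalIntegral.norm_integral_le_of_norm_le_const fun s _ => ?_
  refine (abs_exp_sub_exp_le (abs_le.1 (Cb.abs_le ha s)).2 (abs_le.1 (Cb.abs_le hb s)).2).trans ?_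
  gcongr
  exact (a - b).norm_coe_le_norm s

/-- The nonlocal operator with kernel `k` in Lagrangian variables. -/
def lagrangeOp (k : ℝ → ℝ) (m : L2) (a : Cb) (ξ : ℝ) : ℝ :=
  ∫ η, k (flow a η - flow a ξ) * (Real.exp (-a η) * m η)

theorem integrable_exp_neg_abs {κ : ℝ} (hκ : 0 < κ) :
    Integrable (fun s : ℝ => Real.exp (-κ * |s|)) := by
  have h1 : IntegrableOn (fun s : ℝ => Real.exp (-κ * |s|)) (Ioi 0) := by
    refine (exp_neg_integrableOn_Ioi 0 hκ).congr_fun (fun s hs => ?_) measurableSet_Ioi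
    rw [abs_of_pos hs]
  have h2 : IntegrableOn (fun s : ℝ => Real.exp (-κ * |s|)) (Iic 0) := by
    refine (integrableOn_exp_mul_Iic hκ 0).congr_fun (fun s hs => ?_) measurableSet_Iic
    rw [abs_of_nonpos hs]; ring_nf
  rw [← integrableOn_univ, ← Iic_union_Ioi (a := (0 : ℝ))]
  exact h2.union h1

/-- The constant in `integral_exp_mul_abs_le`. -/
def decayConst (κ : ℝ) : ℝ := ∫ s : ℝ, Real.exp (-(2 * κ) * |s|)

theorem memLp_exp_neg_abs {κ : ℝ} (hκ : 0 < κ) (ξ : ℝ) :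
    MemLp (fun η : ℝ => Real.exp (-κ * |ξ - η|)) 2 volume := by
  rw [memLp_two_iff_integrable_sq (by fun_prop)]
  have := (integrable_exp_neg_abs (mul_pos two_pos hκ)).comp_sub_left ξ
  refine this.congr (Eventually.of_forall fun η => ?_)
  simp only
  rw [← Real.exp_nat_mul]
  congr 1; push_cast; ring

theorem integrable_exp_mul_abs {κ : ℝ} (hκ : 0 < κ) (ξ : ℝ) (m : L2) :
    Integrable (fun η => Real.exp (-κ * |ξ - η|) * |m η|) :=
  (memLp_exp_neg_abs hκ ξ).integrable_mul (Lp.memLp m).abs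

theorem integral_exp_mul_abs_le {κ M : ℝ} (hκ : 0 < κ) (ξ : ℝ) {m : L2} (hm : ‖m‖ ≤ M) :
    ∫ η, Real.exp (-κ * |ξ - η|) * |m η| ≤ decayConst κ + M ^ 2 := by
  have i1 := (memLp_exp_neg_abs hκ ξ).integrable_sq
  have i2 := L2.integrable_sq m
  have h1 : ∫ η, Real.exp (-κ * |ξ - η|) * |m η| ≤
      ∫ η, (Real.exp (-κ * |ξ - η|) ^ 2 + m η ^ 2) := by
    refine integral_mono (integrable_exp_mul_abs hκ ξ m) (i1.add i2) fun η => ?_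
    simp only
    nlinarith [sq_nonneg (Real.exp (-κ * |ξ - η|) - |m η|), sq_abs (m η),
      sq_nonneg (Real.exp (-κ * |ξ - η|)), sq_nonneg (m η)]
  rw [integral_add i1 i2, ← L2.norm_sq] at h1
  have h2 : ∫ η, Real.exp (-κ * |ξ - η|) ^ 2 = decayConst κ := by
    rw [decayConst, ← integral_sub_left_eq_self _ volume ξ]
    congr 1; ext η
    rw [← Real.exp_nat_mul]
    congr 1; push_cast; ring_nf
  have h3 : ‖m‖ ^ 2 ≤ M ^ 2 := pow_le_pow_left₀ (norm_nonneg _) hm 2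
  linarith

section Op

variable {k : ℝ → ℝ} (hk : IsDecayKernel k)

theorem IsDecayKernel.aestronglyMeasurable (hk : IsDecayKernel k) (m : L2) (a : Cb) (ξ : ℝ) :
    AEStronglyMeasurable (fun η => k (flow a η - flow a ξ) * (Real.exp (-a η) * m η)) volume := by
  have h1 : Measurable fun η => k (flow a η - flow a ξ) :=
    hk.measurable.comp ((continuous_flow a).measurable.sub_const _)
  have h2 : Measurable fun η => Real.exp (-a η) :=
    (by fun_prop : Continuous fun η => Real.exp (-a η)).measurable
  exact h1.aestronglyMeasurable.mul (h2.aestronglyMeasurable.mul (Lp.aestronglyMeasurable m))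

theorem IsDecayKernel.norm_integrand_le (hk : IsDecayKernel k) (m : L2) {a : Cb} {R : ℝ}
    (ha : ‖a‖ ≤ R) (ξ η : ℝ) :
    ‖k (flow a η - flow a ξ) * (Real.exp (-a η) * m η)‖ ≤
      Real.exp R * (Real.exp (-Real.exp (-R) * |ξ - η|) * |m η|) := by
  rw [norm_mul, norm_mul, Real.norm_eq_abs, Real.norm_eq_abs, Real.norm_eq_abs, Real.abs_exp]
  have h1 := hk.bound (flow a η - flow a ξ)
  have h2 : Real.exp (-|flow a η - flow a ξ|) ≤ Real.exp (-Real.exp (-R) * |ξ - η|) :=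
    Real.exp_le_exp.2 (by linarith [le_abs_flow_sub ha ξ η])
  have h3 : Real.exp (-a η) ≤ Real.exp R :=
    Real.exp_le_exp.2 (by linarith [(abs_le.1 (Cb.abs_le ha η)).1])
  calc _ ≤ Real.exp (-Real.exp (-R) * |ξ - η|) * (Real.exp R * |m η|) := by
        gcongr; exact h1.trans h2
    _ = _ := by ring

theorem IsDecayKernel.integrable (hk : IsDecayKernel k) (m : L2) (a : Cb) (ξ : ℝ) :
    Integrable fun η => k (flow a η - flow a ξ) * (Real.exp (-a η) * m η) :=
  ((integrable_exp_mul_abs (Real.exp_pos (-‖a‖)) ξ m).const_mul _).mono'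
    (hk.aestronglyMeasurable m a ξ) (Eventually.of_forall (hk.norm_integrand_le m le_rfl ξ))

theorem IsDecayKernel.abs_lagrangeOp_le (hk : IsDecayKernel k) {m : L2} {M : ℝ} (hm : ‖m‖ ≤ M)
    {a : Cb} {R : ℝ} (ha : ‖a‖ ≤ R) (ξ : ℝ) :
    |lagrangeOp k m a ξ| ≤ Real.exp R * (decayConst (Real.exp (-R)) + M ^ 2) := by
  have h1 := norm_integral_le_of_norm_le
    ((integrable_exp_mul_abs (Real.exp_pos (-R)) ξ m).const_mul (Real.exp R))
    (Eventually.of_forall (hk.norm_integrand_le m ha ξ))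
  rw [integral_const_mul] at h1
  exact h1.trans (mul_le_mul_of_nonneg_left (integral_exp_mul_abs_le (Real.exp_pos _) ξ hm)
    (Real.exp_pos _).le)

theorem IsDecayKernel.continuous_lagrangeOp (hk : IsDecayKernel k) (m : L2) (a : Cb) :
    Continuous (lagrangeOp k m a) := by
  rw [continuous_iff_continuousAt]
  intro ξ₀
  set κ := Real.exp (-‖a‖) with hκ
  have hκ0 : 0 < κ := Real.exp_pos _
  -- The factor exp κ pays for moving the centre of the exponential by at most 1. The kernel may be
  -- discontinuous only at η = ξ₀, a null set.
  refine continuousAt_of_dominated (bound := fun η => Real.exp ‖a‖ * Real.exp κ *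
    (Real.exp (-κ * |ξ₀ - η|) * |m η|)) (Eventually.of_forall fun ξ =>
    hk.aestronglyMeasurable m a ξ) ?_ ((integrable_exp_mul_abs hκ0 ξ₀ m).const_mul _) ?_
  · filter_upwards [Metric.closedBall_mem_nhds ξ₀ one_pos] with ξ hξ
    refine Eventually.of_forall fun η => (hk.norm_integrand_le m le_rfl ξ η).trans ?_
    rw [mul_assoc, ← mul_assoc (Real.exp κ), ← Real.exp_add]
    gcongr
    rw [Metric.mem_closedBall, Real.dist_eq, abs_sub_comm] at hξ
    have := abs_sub_le ξ₀ ξ η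
    rw [← hκ]
    nlinarith
  · have : ∀ᵐ η : ℝ, η ≠ ξ₀ := by simp [ae_iff, measure_singleton]
    filter_upwards [this] with η hη
    have hne : flow a η - flow a ξ₀ ≠ 0 := by
      obtain ⟨p, hp, he⟩ := flow_sub a le_rfl ξ₀ η
      rw [he]
      exact mul_ne_zero ((Real.exp_pos _).trans_le hp).ne' (sub_ne_zero.2 hη)
    refine ContinuousAt.mul ?_ continuousAt_const
    exact ContinuousAt.comp' (f := fun ξ => flow a η - flow a ξ) (hk.continuousAt _ hne)
      (continuous_const.sub (continuous_flow a)).continuousAt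

/-- The Lipschitz constant in `IsDecayKernel.abs_lagrangeOp_sub_le`. -/
def lipConst (R M : ℝ) : ℝ :=
  (2 * Real.exp (3 * R) + Real.exp R) * (decayConst (Real.exp (-R) / 2) + M ^ 2)

/-- The flows of `a` and `b` are both increasing, so the two arguments of the kernel have the same
sign and its jump at 0 is never crossed. They differ by a multiple of |ξ - η| ‖a - b‖, and the
linear growth is absorbed by the exponential decay. -/
theorem IsDecayKernel.abs_lagrangeOp_sub_le (hk : IsDecayKernel k) {m : L2} {M : ℝ}
    (hm : ‖m‖ ≤ M) {a b : Cb} {R : ℝ} (ha : ‖a‖ ≤ R) (hb : ‖b‖ ≤ R) (ξ : ℝ) :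
    |lagrangeOp k m a ξ - lagrangeOp k m b ξ| ≤ lipConst R M * ‖a - b‖ := by
  set κ := Real.exp (-R) with hκ
  have hκ0 : 0 < κ := Real.exp_pos _
  have hR : Real.exp R * κ = 1 := by rw [hκ, ← Real.exp_add]; simp
  rw [lagrangeOp, lagrangeOp, ← integral_sub (hk.integrable m a ξ) (hk.integrable m b ξ)]
  have key : ∀ η, ‖k (flow a η - flow a ξ) * (Real.exp (-a η) * m η) -
      k (flow b η - flow b ξ) * (Real.exp (-b η) * m η)‖ ≤
      ((2 * Real.exp (3 * R) + Real.exp R) * ‖a - b‖) *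
        (Real.exp (-(κ / 2) * |ξ - η|) * |m η|) := by
    intro η
    set A := flow a η - flow a ξ with hA
    set B := flow b η - flow b ξ with hB
    set s := |ξ - η| with hs
    have hs0 : 0 ≤ s := abs_nonneg _
    have hAl : κ * s ≤ |A| := le_abs_flow_sub ha ξ η
    have hBl : κ * s ≤ |B| := le_abs_flow_sub hb ξ η
    have hab : |a η - b η| ≤ ‖a - b‖ := (a - b).norm_coe_le_norm η
    have e1 : |k A - k B| ≤ Real.exp (-(κ * s)) * (Real.exp R * ‖a - b‖ * s) := by
      rcases eq_or_ne η ξ with h | h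
      · have : A = B := by rw [hA, hB, h]; simp
        rw [this, sub_self, abs_zero]; positivity
      · refine (hk.lip (κ * s) A B ?_ hAl hBl).trans ?_
        · obtain ⟨p, hp, hpe⟩ := flow_sub a ha ξ η
          obtain ⟨p', hp', hpe'⟩ := flow_sub b hb ξ η
          have h1 := hκ0.trans_le hp
          have h2 := hκ0.trans_le hp'
          rw [hA, hB, hpe, hpe']
          have h3 : 0 < (η - ξ) ^ 2 := by have := sub_ne_zero.2 h; positivity
          have : p * (η - ξ) * (p' * (η - ξ)) = p * p' * (η - ξ) ^ 2 := by ring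
          rw [this]; positivity
        · gcongr
          exact abs_flow_sub_sub_le ha hb ξ η
    have e2 : |k B| ≤ Real.exp (-(κ / 2) * s) :=
      (hk.bound B).trans (Real.exp_le_exp.2 (by nlinarith))
    -- Half of the decay rate is spent on the factor `s`; the constant is 2/κ = 2 exp R.
    have e3 : s * Real.exp (-(κ * s)) ≤ 2 * Real.exp R * Real.exp (-(κ / 2) * s) := by
      have h1 : κ / 2 * s ≤ Real.exp (κ / 2 * s) := by linarith [Real.add_one_le_exp (κ / 2 * s)]
      have h2 : Real.exp (-(κ / 2) * s) = Real.exp (-(κ * s)) * Real.exp (κ / 2 * s) := by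
        rw [← Real.exp_add]; congr 1; ring
      have h3 : s ≤ 2 * Real.exp R * Real.exp (κ / 2 * s) := by
        have := mul_le_mul_of_nonneg_left h1 (by positivity : 0 ≤ 2 * Real.exp R)
        have h4 : 2 * Real.exp R * (κ / 2 * s) = s := by
          linear_combination s * hR
        linarith
      rw [h2]
      have := mul_le_mul_of_nonneg_right h3 (Real.exp_pos (-(κ * s))).le
      linarith
    have e4 : Real.exp (-a η) ≤ Real.exp R :=
      Real.exp_le_exp.2 (by linarith [(abs_le.1 (Cb.abs_le ha η)).1])
    have e5 : |Real.exp (-a η) - Real.exp (-b η)| ≤ Real.exp R * ‖a - b‖ := by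
      refine (abs_exp_sub_exp_le (R := R) (by linarith [(abs_le.1 (Cb.abs_le ha η)).1])
        (by linarith [(abs_le.1 (Cb.abs_le hb η)).1])).trans ?_
      gcongr
      rwa [neg_sub_neg, abs_sub_comm]
    have e6 : k A * (Real.exp (-a η) * m η) - k B * (Real.exp (-b η) * m η) =
        ((k A - k B) * Real.exp (-a η) + k B * (Real.exp (-a η) - Real.exp (-b η))) * m η := by
      ring
    rw [e6, norm_mul, Real.norm_eq_abs, Real.norm_eq_abs, ← mul_assoc]
    refine mul_le_mul_of_nonneg_right ((abs_add_le _ _).trans ?_) (abs_nonneg _)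
    rw [abs_mul, abs_mul, Real.abs_exp]
    have e7 : |k A - k B| * Real.exp (-a η) ≤
        2 * Real.exp (3 * R) * ‖a - b‖ * Real.exp (-(κ / 2) * s) := by
      calc _ ≤ (Real.exp (-(κ * s)) * (Real.exp R * ‖a - b‖ * s)) * Real.exp R := by gcongr
        _ = (s * Real.exp (-(κ * s))) * (Real.exp R * Real.exp R * ‖a - b‖) := by ring
        _ ≤ (2 * Real.exp R * Real.exp (-(κ / 2) * s)) * (Real.exp R * Real.exp R * ‖a - b‖) := by
          gcongr
        _ = _ := by
          have : Real.exp (3 * R) = Real.exp R * Real.exp R * Real.exp R := by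
            rw [← Real.exp_add, ← Real.exp_add]; congr 1; ring
          rw [this]; ring
    have e8 : |k B| * |Real.exp (-a η) - Real.exp (-b η)| ≤
        Real.exp (-(κ / 2) * s) * (Real.exp R * ‖a - b‖) := by gcongr
    linarith
  have h1 := norm_integral_le_of_norm_le
    ((integrable_exp_mul_abs (half_pos hκ0) ξ m).const_mul _) (Eventually.of_forall key)
  rw [integral_const_mul] at h1
  refine h1.trans ?_
  have h2 := integral_exp_mul_abs_le (half_pos hκ0) ξ hm
  have h3 : 0 ≤ (2 * Real.exp (3 * R) + Real.exp R) * ‖a - b‖ := by positivity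
  have := mul_le_mul_of_nonneg_left h2 h3
  rw [lipConst]
  linarith

end Op

/-- The right-hand side of the ordinary differential equation for `a = log q_ξ`. -/
def lagrangeField (m : L2) (a : Cb) : Cb :=
  BoundedContinuousFunction.ofNormedAddCommGroup (lagrangeOp greenKernelDeriv m a)
    (isDecayKernel_greenKernelDeriv.continuous_lagrangeOp m a) _
    (isDecayKernel_greenKernelDeriv.abs_lagrangeOp_le (m := m) le_rfl (a := a) le_rfl)

theorem lagrangeField_apply (m : L2) (a : Cb) (ξ : ℝ) :
    lagrangeField m a ξ = lagrangeOp greenKernelDeriv m a ξ := rfl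

theorem decayConst_nonneg (κ : ℝ) : 0 ≤ decayConst κ :=
  integral_nonneg fun _ => (Real.exp_pos _).le

theorem lipConst_nonneg (R M : ℝ) : 0 ≤ lipConst R M :=
  mul_nonneg (by positivity) (add_nonneg (decayConst_nonneg _) (sq_nonneg _))

theorem norm_lagrangeField_le {m : L2} {M : ℝ} (hm : ‖m‖ ≤ M) {a : Cb} {R : ℝ} (ha : ‖a‖ ≤ R) :
    ‖lagrangeField m a‖ ≤ Real.exp R * (decayConst (Real.exp (-R)) + M ^ 2) :=
  (BoundedContinuousFunction.norm_le (mul_nonneg (Real.exp_pos _).le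
    (add_nonneg (decayConst_nonneg _) (sq_nonneg _)))).2
    (isDecayKernel_greenKernelDeriv.abs_lagrangeOp_le hm ha)

theorem norm_lagrangeField_sub_le {m : L2} {M : ℝ} (hm : ‖m‖ ≤ M) {a b : Cb} {R : ℝ}
    (ha : ‖a‖ ≤ R) (hb : ‖b‖ ≤ R) :
    ‖lagrangeField m a - lagrangeField m b‖ ≤ lipConst R M * ‖a - b‖ :=
  (BoundedContinuousFunction.norm_le (mul_nonneg (lipConst_nonneg _ _) (norm_nonneg _))).2
    (isDecayKernel_greenKernelDeriv.abs_lagrangeOp_sub_le hm ha hb)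

/-- Local existence in Lagrangian variables, with a uniform existence time. -/
theorem exists_lagrange_solution (M : ℝ) :
    ∃ δ > 0, ∀ m : L2, ‖m‖ ≤ M → ∃ a : ℝ → Cb, a 0 = 0 ∧
      ∀ t ∈ Ioo (-δ) δ, HasDerivAt a (lagrangeField m (a t)) t := by
  -- `C` bounds the field on the unit ball, with 1 added for positivity, so a solution starting at 0
  -- stays in that ball up to time 1/C. Only `M` enters.
  set C := Real.exp 1 * (decayConst (Real.exp (-1)) + M ^ 2) + 1 with hC
  have hC0 : 0 < C := by
    have := decayConst_nonneg (Real.exp (-1))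
    positivity
  refine ⟨1 / C, by positivity, fun m hm => ?_⟩
  have hδ : -(1 / C) ≤ 0 ∧ (0 : ℝ) ≤ 1 / C := ⟨by simp [hC0.le], by positivity⟩
  have hpl : IsPicardLindelof (fun _ a => lagrangeField m a)
      (⟨0, hδ⟩ : Icc (-(1 / C)) (1 / C)) (0 : Cb) 1 0 ⟨C, hC0.le⟩
      ⟨lipConst 1 M, lipConst_nonneg _ _⟩ := by
    refine ⟨fun t _ => ?_, fun x _ => continuousOn_const, fun t _ x hx => ?_, ?_⟩
    · refine LipschitzOnWith.of_dist_le_mul fun x hx y hy => ?_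
      rw [mem_closedBall_zero_iff] at hx hy
      rw [dist_eq_norm, dist_eq_norm]
      exact norm_lagrangeField_sub_le hm hx hy
    · rw [mem_closedBall_zero_iff] at hx
      refine (norm_lagrangeField_le hm hx).trans ?_
      change _ ≤ C
      rw [hC]
      simp
    · change C * max (1 / C - 0) (0 - -(1 / C)) ≤ 1 - 0
      simp [hC0.ne']
  obtain ⟨a, ha0, ha⟩ := hpl.exists_eq_forall_mem_Icc_hasDerivWithinAt₀
  exact ⟨a, ha0, fun t ht => (ha t (Ioo_subset_Icc_self ht)).hasDerivAt (Icc_mem_nhds ht.1 ht.2)⟩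

/-! ### Inverting 1 - ∂ₓ² and the evolution equation for v -/

/-- The resolvent `(1 - ∂ₓ²)⁻¹` from `L²` to `H¹`. -/
def resolvent : L2 →L[ℝ] H1 := ContinuousLinearMap.adjoint (Sobolev.dL 1 0)

/-- The operator `-∂ₓ (1 - ∂ₓ²)⁻¹` from `L²` to `H¹`, modulo sign conventions the adjoint of the
derivative. -/
def resolventDeriv : L2 →L[ℝ] H1 := ContinuousLinearMap.adjoint (Sobolev.dL 1 1)

/-- This is the weak form of v - v_xx = f: solving it is the Riesz representation in H¹, that is,
taking an adjoint. -/
theorem inner_resolvent (f : L2) (η : H1) : inner ℝ (resolvent f) η = inner ℝ f (η.d 0) :=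
  ContinuousLinearMap.adjoint_inner_left _ _ _

theorem inner_resolventDeriv (f : L2) (η : H1) :
    inner ℝ (resolventDeriv f) η = inner ℝ f (η.d 1) :=
  ContinuousLinearMap.adjoint_inner_left _ _ _

/-- A test function as an element of `H¹`. -/
theorem exists_H1_of_test {η : ℝ → ℝ} (hη : ContDiff ℝ ∞ η) (hc : HasCompactSupport η) :
    ∃ e : H1, e.d 0 =ᵐ[volume] η ∧ e.d 1 =ᵐ[volume] deriv η := by
  have hd := (contDiff_deriv hη).continuous
  have h0 : MemLp η 2 (volume : Measure ℝ) := hη.continuous.memLp_of_hasCompactSupport hc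
  have h1 : MemLp (deriv η) 2 (volume : Measure ℝ) := hd.memLp_of_hasCompactSupport hc.deriv
  have hp : IsPrimitive η (deriv η) := IsPrimitive.of_hasDerivAt
    (fun x => ((contDiff_infty_iff_deriv.1 hη).1 x).hasDerivAt) hd
  exact ⟨H1.mk h0.toLp h1.toLp (hp.isWeakDeriv h0.coeFn_toLp.symm h1.coeFn_toLp.symm),
    h0.coeFn_toLp, h1.coeFn_toLp⟩

theorem inner_eq_integral_test {e : L2} {ψ : ℝ → ℝ} (h : e =ᵐ[volume] ψ) (f : L2) :
    inner ℝ f e = ∫ x, f x * ψ x := by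
  rw [L2.integral_mul]
  exact integral_congr_ae (h.mono fun x hx => by simp only [hx])

theorem isWeakDeriv_iff_inner {f g : L2} :
    IsWeakDeriv f g ↔ ∀ e : H1, inner ℝ f (e.d 1) = -inner ℝ g (e.d 0) := by
  constructor
  · intro h e
    have : inner ℝ g (e.d 0) + inner ℝ f (e.d 1) = 0 := H1.inner_by_parts (H1.mk _ _ h) e
    linarith
  · intro h η hη hc
    obtain ⟨e, h0, h1⟩ := exists_H1_of_test hη hc
    rw [← inner_eq_integral_test h0, ← inner_eq_integral_test h1, h e]

/-- Two elements of `H¹` with the same pairings with test functions are equal. -/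
theorem H1.eq_of_inner_test {f g : H1} (h : ∀ (η : ℝ → ℝ) (e : H1), ContDiff ℝ ∞ η →
    HasCompactSupport η → e.d 0 =ᵐ[volume] η → e.d 1 =ᵐ[volume] deriv η →
    inner ℝ f e = inner ℝ g e) : f = g := by
  rw [← sub_eq_zero]
  set w := f - g with hw
  have hwd : IsWeakDeriv (w.d 1) (w.d 0) := by
    intro η hη hc
    obtain ⟨e, h0, h1⟩ := exists_H1_of_test hη hc
    have := h η e hη hc h0 h1
    rw [← sub_eq_zero, ← inner_sub_left, ← hw, H1.inner_eq, ← L2.integral_mul,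
      ← L2.integral_mul] at this
    rw [← inner_eq_integral_test h0, ← inner_eq_integral_test h1]
    linarith
  have h1 := isWeakDeriv_iff_inner.1 hwd w
  rw [real_inner_self_eq_norm_sq, real_inner_self_eq_norm_sq] at h1
  have h2 : ‖w‖ ^ 2 = 0 := by rw [H1.norm_sq]; linarith
  exact norm_eq_zero.1 (pow_eq_zero_iff two_ne_zero |>.1 h2)

theorem isWeakDeriv_resolvent_d_one (f : L2) :
    IsWeakDeriv ((resolvent f).d 1) ((resolvent f).d 0 - f) := by
  rw [isWeakDeriv_iff_inner]
  intro e
  have := inner_resolvent f e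
  rw [H1.inner_eq, ← L2.integral_mul, ← L2.integral_mul] at this
  rw [inner_sub_left]
  linarith

/-- The derivative of the resolvent, as an element of `H¹`. -/
def resolventX (f : L2) : H1 := H1.mk _ _ (isWeakDeriv_resolvent_d_one f)

theorem hasDerivAt_rep_resolvent (f : L2) (x : ℝ) :
    HasDerivAt (resolvent f).rep ((resolventX f).rep x) x := by
  have h : IsPrimitive (resolvent f).rep (resolventX f).rep :=
    (resolvent f).isPrimitive.congr (resolventX f).rep_ae.symm
  have hc := (resolventX f).continuous_rep
  rw [h.eq_add 0]
  exact (intervalIntegral.integral_hasDerivAt_right (hc.intervalIntegrable _ _)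
    hc.stronglyMeasurable.stronglyMeasurableAtFilter hc.continuousAt).const_add _

theorem integrable_decayKernel_mul {k : ℝ → ℝ} (hk : IsDecayKernel k) (f : L2) (x : ℝ) :
    Integrable (fun y => k (y - x) * f y) := by
  refine (integrable_exp_mul_abs one_pos x f).mono'
    ((hk.measurable.comp (measurable_id.sub_const x)).aestronglyMeasurable.mul
      (Lp.aestronglyMeasurable f)) (Eventually.of_forall fun y => ?_)
  rw [norm_mul]
  refine mul_le_mul_of_nonneg_right ?_ (abs_nonneg _)
  refine (hk.bound _).trans (le_of_eq ?_)
  rw [abs_sub_comm]; ring_nf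

/-- v + v_x and v - v_x solve first-order equations with source f, so each is an exponential
integral over one half-line. Half their sum and half their difference give the two kernels. -/
theorem resolvent_rep (f : L2) (x : ℝ) :
    (resolvent f).rep x = ∫ y, greenKernel (y - x) * f y ∧
    (resolventX f).rep x = ∫ y, greenKernelDeriv (y - x) * f y := by
  set v := resolvent f with hv
  set vx := resolventX f with hvx
  have d0 : vx.d 0 = v.d 1 := rfl
  have d1 : vx.d 1 = v.d 0 - f := rfl
  have e1 := H1.rep_eq_integral_Ioi (a := v + vx) (g := f)
    (by rw [H1.add_d, H1.add_d, d0, d1]; abel) x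
  have e2 := H1.rep_eq_integral_Iic (b := v - vx) (g := f)
    (by rw [H1.sub_d, H1.sub_d, d0, d1]; abel) x
  rw [H1.rep_add] at e1
  rw [H1.rep_sub] at e2
  have i0 := integrable_decayKernel_mul isDecayKernel_greenKernel f x
  have i1 := integrable_decayKernel_mul isDecayKernel_greenKernelDeriv f x
  rw [← intervalIntegral.integral_Iic_add_Ioi (b := x) i0.integrableOn i0.integrableOn,
    ← intervalIntegral.integral_Iic_add_Ioi (b := x) i1.integrableOn i1.integrableOn]
  have f1 : ∫ y in Ioi x, greenKernel (y - x) * f y =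
      1 / 2 * ∫ y in Ioi x, Real.exp (x - y) * f y := by
    rw [← integral_const_mul]
    refine setIntegral_congr_fun measurableSet_Ioi fun y hy => ?_
    have : 0 < y - x := sub_pos.2 hy
    simp only [greenKernel, abs_of_pos this, neg_sub, mul_assoc]
  have f2 : ∫ y in Iic x, greenKernel (y - x) * f y =
      1 / 2 * ∫ y in Iic x, Real.exp (y - x) * f y := by
    rw [← integral_const_mul]
    refine setIntegral_congr_fun measurableSet_Iic fun y hy => ?_
    have : y - x ≤ 0 := sub_nonpos.2 hy
    simp only [greenKernel, abs_of_nonpos this, neg_neg, mul_assoc]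
  have f3 : ∫ y in Ioi x, greenKernelDeriv (y - x) * f y =
      ∫ y in Ioi x, greenKernel (y - x) * f y :=
    setIntegral_congr_fun measurableSet_Ioi fun y hy => by
      simp only [greenKernelDeriv_of_pos (sub_pos.2 hy)]
  have f4 : ∫ y in Iic x, greenKernelDeriv (y - x) * f y =
      -∫ y in Iic x, greenKernel (y - x) * f y := by
    rw [integral_Iic_eq_integral_Iio, integral_Iic_eq_integral_Iio, ← integral_neg]
    refine setIntegral_congr_fun measurableSet_Iio fun y hy => ?_
    simp only [greenKernelDeriv_of_neg (sub_neg.2 hy), neg_mul]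
  rw [f3, f4, f1, f2, ← e1, ← e2]
  constructor <;> ring

/-- The map `m ↦ (1 - ∂ₓ²)⁻² m` from `L²` to `H⁴`. -/
def resolventSq : L2 →L[ℝ] Sobolev 4 :=
  let v := resolvent
  let u := resolvent ∘L (Sobolev.dL 1 0 ∘L v)
  Sobolev.liftL ![Sobolev.dL 1 0 ∘L u, Sobolev.dL 1 1 ∘L u,
    Sobolev.dL 1 0 ∘L u - Sobolev.dL 1 0 ∘L v, Sobolev.dL 1 1 ∘L u - Sobolev.dL 1 1 ∘L v,
    Sobolev.dL 1 0 ∘L u - Sobolev.dL 1 0 ∘L v - (Sobolev.dL 1 0 ∘L v - ContinuousLinearMap.id ℝ L2)]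
    fun m i => by
      have h0 : IsWeakDeriv ((u m).d 0) ((u m).d 1) := (u m).isWeakDeriv
      have h1 : IsWeakDeriv ((u m).d 1) ((u m).d 0 - (v m).d 0) := isWeakDeriv_resolvent_d_one _
      have h2 : IsWeakDeriv ((v m).d 0) ((v m).d 1) := (v m).isWeakDeriv
      have h3 : IsWeakDeriv ((v m).d 1) ((v m).d 0 - m) := isWeakDeriv_resolvent_d_one _
      fin_cases i
      · exact h0
      · exact h1
      · exact h0.sub h2
      · exact h1.sub h3

theorem vH_resolventSq (m : L2) : Sobolev.vH (resolventSq m) = resolvent m := by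
  refine H1.ext' ?_ ?_
  · exact sub_sub_cancel _ _
  · exact sub_sub_cancel _ _

theorem m_resolventSq (m : L2) : (resolventSq m).m = m := by
  set v := (resolvent m).d 0
  set u := (resolvent v).d 0
  change u - (2 : ℝ) • (u - v) + (u - v - (v - m)) = m
  module

theorem vxH_resolventSq (m : L2) : Sobolev.vxH (resolventSq m) = resolventX m := by
  refine H1.ext' ?_ ?_
  · exact sub_sub_cancel _ _
  · exact sub_sub_cancel _ _

/-- The lift `w ↦ (1 - ∂ₓ²)⁻¹ w` from `H¹` to `H³`. -/
def resolventLift : H1 →L[ℝ] Sobolev 3 :=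
  let u := resolvent ∘L Sobolev.dL 1 0
  Sobolev.liftL ![Sobolev.dL 1 0 ∘L u, Sobolev.dL 1 1 ∘L u,
    Sobolev.dL 1 0 ∘L u - Sobolev.dL 1 0, Sobolev.dL 1 1 ∘L u - Sobolev.dL 1 1]
    fun w i => by
      have h0 : IsWeakDeriv ((u w).d 0) ((u w).d 1) := (u w).isWeakDeriv
      have h1 : IsWeakDeriv ((u w).d 1) ((u w).d 0 - w.d 0) := isWeakDeriv_resolvent_d_one _
      fin_cases i
      · exact h0
      · exact h1
      · exact h0.sub w.isWeakDeriv

theorem incl_resolventSq (m : L2) : (resolventSq m).incl = resolventLift (resolvent m) := by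
  apply Subtype.ext
  apply PiLp.ext
  intro i
  fin_cases i <;> rfl

theorem wH_resolventLift (w : H1) : Sobolev.wH (resolventLift w) = w := by
  refine H1.ext' ?_ ?_
  · exact sub_sub_cancel _ _
  · exact sub_sub_cancel _ _

/-- The time derivative prescribed by the equation. -/
def vField (m : L2) : H1 :=
  resolventDeriv (H1.mulL (resolvent m) m) - resolvent (H1.mulL (resolventX m) m)

theorem inner_vField (m : L2) (η : H1) : inner ℝ (vField m) η =
    inner ℝ (H1.mulL (resolvent m) m) (η.d 1) - inner ℝ (H1.mulL (resolventX m) m) (η.d 0) := by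
  rw [vField, inner_sub_left, inner_resolvent, inner_resolventDeriv]

theorem continuous_resolventX : Continuous resolventX := by
  have : resolventX = fun m => Sobolev.vxH (resolventSq m) :=
    funext fun m => (vxH_resolventSq m).symm
  rw [this]
  exact Sobolev.vxH.continuous.comp resolventSq.continuous

theorem continuous_vField : Continuous vField := by
  have h1 : Continuous fun m => H1.mulL (resolvent m) m :=
    (H1.mulL.continuous.comp resolvent.continuous).clm_apply continuous_id
  have h2 : Continuous fun m => H1.mulL (resolventX m) m :=
    (H1.mulL.continuous.comp continuous_resolventX).clm_apply continuous_id
  exact (resolventDeriv.continuous.comp h1).sub (resolvent.continuous.comp h2)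

theorem vEquation_vField (m : L2) : VEquation (resolventSq m) (vField m) := by
  rw [VEquation, vH_resolventSq, vxH_resolventSq, m_resolventSq, isWeakDeriv_iff_inner]
  intro e
  have := inner_vField m e
  rw [H1.inner_eq, ← L2.integral_mul, ← L2.integral_mul] at this
  rw [inner_sub_left, inner_add_left]
  linarith

theorem resolventSq_m (U : Sobolev 4) : resolventSq U.m = U := by
  apply Sobolev.vH_injective
  rw [vH_resolventSq]
  refine ext_inner_right ℝ fun e => ?_
  have h : IsWeakDeriv ((Sobolev.vH U).d 1) ((Sobolev.vxH U).d 1) := (Sobolev.vxH U).isWeakDeriv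
  have h1 := isWeakDeriv_iff_inner.1 h e
  rw [inner_resolvent, U.m_eq, inner_sub_left, H1.inner_eq, ← L2.integral_mul, ← L2.integral_mul]
  linarith

/-! ### The flow as a change of variables and the transport of the momentum -/

theorem abs_le_abs_flow (a : Cb) (ξ : ℝ) : Real.exp (-‖a‖) * |ξ| ≤ |flow a ξ| := by
  have := le_abs_flow_sub (a := a) le_rfl 0 ξ
  simpa [flow] using this

theorem strictMono_flow (a : Cb) : StrictMono (flow a) :=
  strictMono_of_deriv_pos fun x => by rw [(hasDerivAt_flow a x).deriv]; exact Real.exp_pos _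

theorem surjective_flow (a : Cb) : Function.Surjective (flow a) := by
  have h0 : flow a 0 = 0 := by simp [flow]
  have hlin : Tendsto (fun ξ => Real.exp (-‖a‖) * |ξ|) atTop atTop :=
    tendsto_abs_atTop_atTop.const_mul_atTop (Real.exp_pos _)
  have hlin' : Tendsto (fun ξ => Real.exp (-‖a‖) * |ξ|) atBot atTop :=
    tendsto_abs_atBot_atTop.const_mul_atTop (Real.exp_pos _)
  refine (continuous_flow a).surjective ?_ ?_
  · refine tendsto_atTop_mono' _ ?_ hlin
    filter_upwards [eventually_ge_atTop 0] with ξ hξ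
    have := (strictMono_flow a).monotone hξ
    rw [h0] at this
    simpa [abs_of_nonneg this] using abs_le_abs_flow a ξ
  · refine tendsto_neg_atTop_iff.1 (tendsto_atTop_mono' _ ?_ hlin')
    filter_upwards [eventually_le_atBot 0] with ξ hξ
    have := (strictMono_flow a).monotone hξ
    rw [h0] at this
    simpa [abs_of_nonpos this] using abs_le_abs_flow a ξ

/-- The flow map `ξ ↦ c + flow a ξ` as an order isomorphism of the line. -/
def flowIso (a : Cb) (c : ℝ) : ℝ ≃o ℝ :=
  StrictMono.orderIsoOfSurjective (fun ξ => c + flow a ξ)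
    (fun _ _ h => (add_lt_add_iff_left c).2 (strictMono_flow a h))
    (fun y => by obtain ⟨x, hx⟩ := surjective_flow a (y - c); exact ⟨x, by simp [hx]⟩)

theorem flowIso_apply (a : Cb) (c ξ : ℝ) : flowIso a c ξ = c + flow a ξ := rfl

theorem hasDerivAt_flowIso (a : Cb) (c ξ : ℝ) : HasDerivAt (flowIso a c) (Real.exp (a ξ)) ξ :=
  (hasDerivAt_flow a ξ).const_add c

theorem integral_comp_flowIso (a : Cb) (c : ℝ) (g : ℝ → ℝ) :
    ∫ y, g y = ∫ ξ, Real.exp (a ξ) * g (flowIso a c ξ) := by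
  have := integral_image_eq_integral_abs_deriv_smul MeasurableSet.univ
    (fun x _ => (hasDerivAt_flowIso a c x).hasDerivWithinAt) (flowIso a c).injective.injOn g
  simpa [(flowIso a c).surjective.range_eq] using this

theorem integrable_comp_flowIso (a : Cb) (c : ℝ) (g : ℝ → ℝ) :
    Integrable g ↔ Integrable fun ξ => Real.exp (a ξ) * g (flowIso a c ξ) := by
  have := integrableOn_image_iff_integrableOn_abs_deriv_smul MeasurableSet.univ
    (fun x _ => (hasDerivAt_flowIso a c x).hasDerivWithinAt) (flowIso a c).injective.injOn g
  simpa [(flowIso a c).surjective.range_eq] using this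

theorem integrable_exp_mul_sq (m : L2) (a : Cb) (r : ℝ) :
    Integrable fun ξ => Real.exp (r * a ξ) * m ξ ^ 2 := by
  refine (L2.integrable_sq m).bdd_mul (c := Real.exp (|r| * ‖a‖))
    (by fun_prop : Continuous fun ξ => Real.exp (r * a ξ)).aestronglyMeasurable
    (Eventually.of_forall fun ξ => ?_)
  rw [Real.norm_eq_abs, Real.abs_exp]
  refine Real.exp_le_exp.2 ((le_abs_self _).trans ?_)
  rw [abs_mul]
  gcongr
  exact a.norm_coe_le_norm ξ

/-- The factor exp(-2a) is q_ξ⁻², since m satisfies m' = -2 v_x m along characteristics. In the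
squared norm the Jacobian exp a turns exp(-4a) into exp(-3a), which is bounded. -/
theorem memLp_push (m : L2) (a : Cb) (c : ℝ) :
    MemLp (fun y => Real.exp (-2 * a ((flowIso a c).symm y)) * m ((flowIso a c).symm y)) 2
      volume := by
  have hmeas : Measurable (flowIso a c).symm := (flowIso a c).symm.monotone.measurable
  rw [memLp_two_iff_integrable_sq]
  · rw [integrable_comp_flowIso a c]
    refine (integrable_exp_mul_sq m a (-3)).congr (Eventually.of_forall fun ξ => ?_)
    simp only [OrderIso.symm_apply_apply]
    rw [mul_pow, ← mul_assoc, ← Real.exp_nat_mul, ← Real.exp_add]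
    congr 2; push_cast; ring
  · have h1 : Measurable fun x => Real.exp (-2 * a x) :=
      (by fun_prop : Continuous fun x => Real.exp (-2 * a x)).measurable
    exact ((h1.comp hmeas).mul
      ((Lp.stronglyMeasurable m).measurable.comp hmeas)).aestronglyMeasurable

/-- The momentum at a later time, transported by the flow. -/
def push (m : L2) (a : Cb) (c : ℝ) : L2 := (memLp_push m a c).toLp

theorem integral_push_mul (m : L2) (a : Cb) (c : ℝ) (ψ : ℝ → ℝ) :
    ∫ y, push m a c y * ψ y = ∫ ξ, Real.exp (-a ξ) * m ξ * ψ (flowIso a c ξ) := by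
  have h1 : ∫ y, push m a c y * ψ y =
      ∫ y, Real.exp (-2 * a ((flowIso a c).symm y)) * m ((flowIso a c).symm y) * ψ y :=
    integral_congr_ae ((memLp_push m a c).coeFn_toLp.mono fun y hy => by
      simp only [push, hy])
  rw [h1, integral_comp_flowIso a c]
  congr 1
  ext ξ
  rw [OrderIso.symm_apply_apply, ← mul_assoc, ← mul_assoc, ← Real.exp_add]
  congr 3; ring

theorem norm_push_sq (m : L2) (a : Cb) (c : ℝ) :
    ‖push m a c‖ ^ 2 = ∫ ξ, Real.exp (-3 * a ξ) * m ξ ^ 2 := by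
  rw [L2.norm_sq]
  have h1 : ∫ y, push m a c y ^ 2 =
      ∫ y, (Real.exp (-2 * a ((flowIso a c).symm y)) * m ((flowIso a c).symm y)) ^ 2 :=
    integral_congr_ae ((memLp_push m a c).coeFn_toLp.mono fun y hy => by
      simp only [push, hy])
  rw [h1, integral_comp_flowIso a c]
  congr 1
  ext ξ
  rw [OrderIso.symm_apply_apply, mul_pow, ← mul_assoc, ← Real.exp_nat_mul, ← Real.exp_add]
  congr 2; push_cast; ring

theorem push_zero (m : L2) : push m 0 0 = m := by
  have h : ∀ y, (flowIso 0 0).symm y = y := fun y => by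
    rw [OrderIso.symm_apply_eq, flowIso_apply]; simp [flow]
  apply L2.congr
  filter_upwards [(memLp_push m 0 0).coeFn_toLp] with y hy
  rw [push, hy, h]
  simp

/-- The Eulerian velocity at a particle is the Lagrangian operator at its label. Only differences of
positions enter the kernel, so the centre `c` drops out and the equation for `a` closes. -/
theorem rep_resolvent_push (m : L2) (a : Cb) (c ξ : ℝ) :
    (resolvent (push m a c)).rep (flowIso a c ξ) = lagrangeOp greenKernel m a ξ := by
  rw [(resolvent_rep _ _).1]
  simp only [mul_comm (greenKernel _)]
  rw [integral_push_mul m a c fun y => greenKernel (y - flowIso a c ξ), lagrangeOp]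
  congr 1; ext η
  rw [flowIso_apply, flowIso_apply, add_sub_add_left_eq_sub]
  ring

theorem rep_resolventX_push (m : L2) (a : Cb) (c ξ : ℝ) :
    (resolventX (push m a c)).rep (flowIso a c ξ) = lagrangeField m a ξ := by
  rw [(resolvent_rep _ _).2, lagrangeField_apply]
  simp only [mul_comm (greenKernelDeriv _)]
  rw [integral_push_mul m a c fun y => greenKernelDeriv (y - flowIso a c ξ), lagrangeOp]
  congr 1; ext η
  rw [flowIso_apply, flowIso_apply, add_sub_add_left_eq_sub]
  ring

/-- Differentiating the Eulerian identity by the chain rule avoids differentiating under the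
integral across the corner of the kernel. The centre 0 is an arbitrary choice. -/
theorem hasDerivAt_lagrangeOp (m : L2) (a : Cb) (ξ : ℝ) :
    HasDerivAt (lagrangeOp greenKernel m a) (Real.exp (a ξ) * lagrangeField m a ξ) ξ := by
  have h := (hasDerivAt_rep_resolvent (push m a 0) (flowIso a 0 ξ)).comp ξ
    (hasDerivAt_flowIso a 0 ξ)
  rw [rep_resolventX_push, mul_comm] at h
  have : (resolvent (push m a 0)).rep ∘ flowIso a 0 = lagrangeOp greenKernel m a :=
    funext fun η => rep_resolvent_push m a 0 η
  rwa [this] at h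

theorem continuous_lagrangeOp_left {k : ℝ → ℝ} (hk : IsDecayKernel k) (m : L2) (ξ : ℝ) :
    Continuous fun a : Cb => lagrangeOp k m a ξ := by
  rw [continuous_iff_continuousAt]
  intro b
  rw [ContinuousAt, tendsto_iff_norm_sub_tendsto_zero]
  have h1 : Tendsto (fun a : Cb => lipConst (‖b‖ + 1) ‖m‖ * ‖a - b‖) (𝓝 b) (𝓝 0) := by
    have : Continuous fun a : Cb => lipConst (‖b‖ + 1) ‖m‖ * ‖a - b‖ := by fun_prop
    have h2 := this.tendsto b
    simpa using h2
  refine squeeze_zero' (Eventually.of_forall fun _ => norm_nonneg _) ?_ h1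
  have : ∀ᶠ a : Cb in 𝓝 b, ‖a‖ < ‖b‖ + 1 :=
    continuous_norm.continuousAt.eventually (gt_mem_nhds (by linarith))
  filter_upwards [this] with a ha
  exact hk.abs_lagrangeOp_sub_le le_rfl ha.le (by linarith) ξ

/-- Weak continuity together with continuity of the norm gives strong continuity. A dense set of
test vectors suffices: for `e` close to `M t`, the function ‖M s - e‖² is continuous at `t`. -/
theorem tendsto_of_norm_of_inner {H : Type*} [NormedAddCommGroup H] [InnerProductSpace ℝ H]
    {M : ℝ → H} {t : ℝ} {D : Set H} (hD : Dense D) (hn : ContinuousAt (fun s => ‖M s‖ ^ 2) t)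
    (hi : ∀ e ∈ D, ContinuousAt (fun s => inner ℝ (M s) e) t) : ContinuousAt M t := by
  rw [Metric.continuousAt_iff']
  intro ε hε
  obtain ⟨e, heD, he⟩ := hD.exists_dist_lt (M t) (half_pos hε)
  have h1 : ContinuousAt (fun s => ‖M s - e‖ ^ 2) t := by
    simp only [norm_sub_sq_real]
    exact (hn.sub ((hi e heD).const_mul 2)).add continuousAt_const
  rw [dist_eq_norm] at he
  have h2 : ‖M t - e‖ ^ 2 < (ε / 2) ^ 2 := pow_lt_pow_left₀ he (norm_nonneg _) two_ne_zero
  filter_upwards [h1.eventually (gt_mem_nhds h2)] with s hs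
  have h3 : ‖M s - e‖ < ε / 2 := lt_of_pow_lt_pow_left₀ 2 (by positivity) hs
  rw [dist_eq_norm]
  calc ‖M s - M t‖ = ‖(M s - e) - (M t - e)‖ := by congr 1; abel
    _ ≤ ‖M s - e‖ + ‖M t - e‖ := norm_sub_le _ _
    _ < ε := by linarith

/-! ### Time regularity of the flow, the momentum and v -/

section Time

variable {m : L2} {a : ℝ → Cb} {δ : ℝ}

/-- The position of the particle with label `0`. -/
def center (m : L2) (a : ℝ → Cb) (t : ℝ) : ℝ :=
  ∫ s in (0 : ℝ)..t, lagrangeOp greenKernel m (a s) 0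

theorem hasDerivAt_center (ha : ∀ t ∈ Ioo (-δ) δ, HasDerivAt a (lagrangeField m (a t)) t)
    {t : ℝ} (ht : t ∈ Ioo (-δ) δ) :
    HasDerivAt (center m a) (lagrangeOp greenKernel m (a t) 0) t := by
  have hc : ContinuousOn (fun s => lagrangeOp greenKernel m (a s) 0) (Ioo (-δ) δ) :=
    (continuous_lagrangeOp_left isDecayKernel_greenKernel m 0).comp_continuousOn
      fun s hs => (ha s hs).continuousAt.continuousWithinAt
  have h0 : (0 : ℝ) ∈ Ioo (-δ) δ := by
    have : -δ < δ := ht.1.trans ht.2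
    constructor <;> linarith
  refine intervalIntegral.integral_hasDerivAt_right
    ((hc.mono (ordConnected_Ioo.uIcc_subset h0 ht)).intervalIntegrable)
    (hc.stronglyMeasurableAtFilter isOpen_Ioo t ht) (hc.continuousAt (isOpen_Ioo.mem_nhds ht))

/-- The time derivative of q_ξ = exp a is exp(a) v_x(q), the label derivative of the velocity, so
integrating over labels leaves a velocity difference. The motion of `center` supplies the missing
velocity of label 0. -/
theorem hasDerivAt_flow_time (ha : ∀ t ∈ Ioo (-δ) δ, HasDerivAt a (lagrangeField m (a t)) t)
    {t : ℝ} (ht : t ∈ Ioo (-δ) δ) (ξ : ℝ) :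
    HasDerivAt (fun s => flow (a s) ξ)
      (lagrangeOp greenKernel m (a t) ξ - lagrangeOp greenKernel m (a t) 0) t := by
  set R := ‖a t‖ + 1 with hR
  have hs : {s | s ∈ Ioo (-δ) δ ∧ ‖a s‖ < R} ∈ 𝓝 t :=
    (isOpen_Ioo.eventually_mem ht).and
      ((ha t ht).continuousAt.norm.eventually (gt_mem_nhds (by linarith)))
  have key := intervalIntegral.hasDerivAt_integral_of_dominated_loc_of_deriv_le
    (μ := volume) (a := 0) (b := ξ) (F := fun s η => Real.exp (a s η))
    (F' := fun s η => Real.exp (a s η) * lagrangeField m (a s) η)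
    (bound := fun _ => Real.exp R * (Real.exp R * (decayConst (Real.exp (-R)) + ‖m‖ ^ 2))) hs
    (Eventually.of_forall fun s =>
      (by fun_prop : Continuous fun η => Real.exp (a s η)).aestronglyMeasurable)
    ((by fun_prop : Continuous fun η => Real.exp (a t η)).intervalIntegrable _ _)
    (by fun_prop : Continuous fun η =>
      Real.exp (a t η) * lagrangeField m (a t) η).aestronglyMeasurable
    (Eventually.of_forall fun η _ s hs => ?_) intervalIntegrable_const
    (Eventually.of_forall fun η _ s hs => ?_)
  · have h1 := key.2
    rwa [intervalIntegral.integral_eq_sub_of_hasDerivAt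
      (fun η _ => hasDerivAt_lagrangeOp m (a t) η)
      ((by fun_prop : Continuous fun η =>
        Real.exp (a t η) * lagrangeField m (a t) η).intervalIntegrable _ _)] at h1
  · rw [norm_mul, Real.norm_eq_abs, Real.abs_exp]
    refine mul_le_mul (Real.exp_le_exp.2 (abs_le.1 (Cb.abs_le hs.2.le η)).2) ?_ (norm_nonneg _)
      (Real.exp_pos _).le
    exact ((lagrangeField m (a s)).norm_coe_le_norm η).trans
      (norm_lagrangeField_le le_rfl hs.2.le)
  · have h1 := (BoundedContinuousFunction.evalCLM ℝ η).hasFDerivAt.comp_hasDerivAt s (ha s hs.1)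
    exact HasDerivAt.exp h1

theorem hasDerivAt_flowIso_time
    (ha : ∀ t ∈ Ioo (-δ) δ, HasDerivAt a (lagrangeField m (a t)) t)
    {t : ℝ} (ht : t ∈ Ioo (-δ) δ) (ξ : ℝ) :
    HasDerivAt (fun s => flowIso (a s) (center m a s) ξ) (lagrangeOp greenKernel m (a t) ξ) t := by
  have := (hasDerivAt_center ha ht).add (hasDerivAt_flow_time ha ht ξ)
  rwa [add_sub_cancel] at this

/-- The momentum along the flow. -/
def momentum (m : L2) (a : ℝ → Cb) (t : ℝ) : L2 := push m (a t) (center m a t)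

theorem momentum_zero (h0 : a 0 = 0) : momentum m a 0 = m := by
  rw [momentum, h0, center, intervalIntegral.integral_same, push_zero]

/-- The equation for the momentum, tested against a smooth function. -/
theorem hasDerivAt_integral_momentum
    (ha : ∀ t ∈ Ioo (-δ) δ, HasDerivAt a (lagrangeField m (a t)) t)
    {t : ℝ} (ht : t ∈ Ioo (-δ) δ) {η : ℝ → ℝ} (hη : ContDiff ℝ ∞ η) (hc : HasCompactSupport η) :
    HasDerivAt (fun s => ∫ y, momentum m a s y * η y)
      (∫ y, momentum m a t y * ((resolvent (momentum m a t)).rep y * deriv η y -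
        (resolventX (momentum m a t)).rep y * η y)) t := by
  have hd := (contDiff_deriv hη).continuous
  obtain ⟨A₀, hA₀⟩ := hc.exists_bound_of_continuous hη.continuous
  obtain ⟨A₁, hA₁⟩ := hc.deriv.exists_bound_of_continuous hd
  obtain ⟨ρ, hρ0, hρ⟩ := exists_support_subset hc
  have hz : ∀ y, ρ < |y| → η y = 0 := fun y hy =>
    image_eq_zero_of_notMem_tsupport fun h => by
      have := hρ h
      linarith [abs_lt.2 ⟨this.1, this.2⟩]
  have hz' : ∀ y, ρ < |y| → deriv η y = 0 := fun y hy =>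
    image_eq_zero_of_notMem_tsupport fun h => by
      have := hρ (tsupport_deriv_subset (𝕜 := ℝ) h)
      linarith [abs_lt.2 ⟨this.1, this.2⟩]
  set q : ℝ → ℝ → ℝ := fun s ξ => flowIso (a s) (center m a s) ξ with hq
  set R := ‖a t‖ + 1 with hR
  set γ := |center m a t| + 1 with hγ
  have hs : {s | (s ∈ Ioo (-δ) δ ∧ ‖a s‖ < R) ∧ |center m a s| < γ} ∈ 𝓝 t :=
    ((isOpen_Ioo.eventually_mem ht).and
      ((ha t ht).continuousAt.norm.eventually (gt_mem_nhds (by linarith)))).and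
      ((hasDerivAt_center ha ht).continuousAt.abs.eventually (gt_mem_nhds (by linarith)))
  set B := Real.exp R * (decayConst (Real.exp (-R)) + ‖m‖ ^ 2) with hB
  have hB0 : 0 ≤ B := mul_nonneg (Real.exp_pos _).le
    (add_nonneg (decayConst_nonneg _) (sq_nonneg _))
  -- For times near `t`, labels outside `[-L, L]` sit outside the support of `η`, since flows expand
  -- distances by at least exp(-R) and the centre stays within γ. This gives a time-independent
  -- integrable bound.
  set L := Real.exp R * (ρ + γ) with hL
  have hfar : ∀ s, ‖a s‖ < R → |center m a s| < γ → ∀ ξ, ξ ∉ Icc (-L) L → ρ < |q s ξ| := by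
    intro s hs1 hs2 ξ hξ
    have h1 : L < |ξ| := by
      by_contra h
      exact hξ (abs_le.1 (not_lt.1 h))
    have h2 : Real.exp (-R) * |ξ| ≤ |flow (a s) ξ| := by
      refine le_trans ?_ (abs_le_abs_flow (a s) ξ)
      gcongr
    have h3 : ρ + γ < Real.exp (-R) * |ξ| := by
      have := mul_lt_mul_of_pos_left h1 (Real.exp_pos (-R))
      rwa [hL, ← mul_assoc, ← Real.exp_add, neg_add_cancel, Real.exp_zero, one_mul] at this
    have h4 : |flow (a s) ξ| ≤ |q s ξ| + |center m a s| := by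
      have : flow (a s) ξ = q s ξ - center m a s := by simp [hq, flowIso_apply]
      rw [this]; exact abs_sub _ _
    linarith
  have hint : IntegrableOn (fun ξ => |m ξ|) (Icc (-L) L) :=
    ((L2.locallyIntegrable m).integrableOn_isCompact isCompact_Icc).abs
  have hqc : ∀ s, Continuous (q s) := fun s => continuous_const.add (continuous_flow (a s))
  have hmm : ∀ s, AEStronglyMeasurable (fun ξ => Real.exp (-a s ξ) * m ξ) volume := fun s =>
    (by fun_prop : Continuous fun ξ => Real.exp (-a s ξ)).aestronglyMeasurable.mul
      (Lp.aestronglyMeasurable m)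
  have hmeas : ∀ s, AEStronglyMeasurable (fun ξ => Real.exp (-a s ξ) * m ξ * η (q s ξ)) volume :=
    fun s => (hmm s).mul (hη.continuous.comp (hqc s)).aestronglyMeasurable
  have key := hasDerivAt_integral_of_dominated_loc_of_deriv_le (μ := volume)
    (F := fun s ξ => Real.exp (-a s ξ) * m ξ * η (q s ξ))
    (F' := fun s ξ => Real.exp (-a s ξ) * m ξ * (lagrangeOp greenKernel m (a s) ξ *
      deriv η (q s ξ) - lagrangeField m (a s) ξ * η (q s ξ)))
    (bound := (Icc (-L) L).indicator fun ξ => Real.exp R * (B * A₁ + B * A₀) * |m ξ|) (x₀ := t) hs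
    ?_ ?_ ?_ (Eventually.of_forall fun ξ s hs => ?_)
    ((integrable_indicator_iff measurableSet_Icc).2 (hint.const_mul _))
    (Eventually.of_forall fun ξ s hs => ?_)
  · have h1 := key.2
    have e1 : (fun s => ∫ y, momentum m a s y * η y) =
        fun s => ∫ ξ, Real.exp (-a s ξ) * m ξ * η (q s ξ) :=
      funext fun s => integral_push_mul m (a s) (center m a s) η
    rw [e1]
    refine h1.congr_deriv (Eq.symm ?_)
    refine (integral_push_mul m (a t) (center m a t) fun y =>
      (resolvent (momentum m a t)).rep y * deriv η y -
        (resolventX (momentum m a t)).rep y * η y).trans ?_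
    congr 1; ext ξ
    have r1 : (resolvent (momentum m a t)).rep (q t ξ) = _ := rep_resolvent_push _ _ _ _
    have r2 : (resolventX (momentum m a t)).rep (q t ξ) = _ := rep_resolventX_push _ _ _ _
    rw [← r1, ← r2]
  · exact Eventually.of_forall hmeas
  · refine ((integrable_indicator_iff measurableSet_Icc).2
      (hint.const_mul (Real.exp R * A₀))).mono' (hmeas t) (Eventually.of_forall fun ξ => ?_)
    by_cases hξ : ξ ∈ Icc (-L) L
    · rw [indicator_of_mem hξ, norm_mul, norm_mul, Real.norm_eq_abs (Real.exp _), Real.abs_exp]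
      have h1 : Real.exp (-a t ξ) ≤ Real.exp R :=
        Real.exp_le_exp.2 (by linarith [(abs_le.1 (Cb.abs_le (le_refl ‖a t‖) ξ)).1])
      calc _ ≤ Real.exp R * |m ξ| * A₀ := by
            gcongr
            · exact le_rfl
            · exact hA₀ _
        _ = _ := by ring
    · rw [indicator_of_notMem hξ, hz _ (hfar t (by linarith) (by linarith) ξ hξ)]
      simp
  · have h1 : Continuous fun ξ => lagrangeOp greenKernel m (a t) ξ * deriv η (q t ξ) -
        lagrangeField m (a t) ξ * η (q t ξ) :=
      ((isDecayKernel_greenKernel.continuous_lagrangeOp m (a t)).mul (hd.comp (hqc t))).sub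
        ((lagrangeField m (a t)).continuous.mul (hη.continuous.comp (hqc t)))
    exact (hmm t).mul h1.aestronglyMeasurable
  · by_cases hξ : ξ ∈ Icc (-L) L
    · rw [indicator_of_mem hξ, norm_mul, norm_mul, Real.norm_eq_abs (Real.exp _), Real.abs_exp]
      have h1 : Real.exp (-a s ξ) ≤ Real.exp R :=
        Real.exp_le_exp.2 (by linarith [(abs_le.1 (Cb.abs_le hs.1.2.le ξ)).1])
      have h2 : ‖lagrangeOp greenKernel m (a s) ξ * deriv η (q s ξ) -
          lagrangeField m (a s) ξ * η (q s ξ)‖ ≤ B * A₁ + B * A₀ := by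
        refine (norm_sub_le _ _).trans ?_
        rw [norm_mul, norm_mul]
        refine add_le_add (mul_le_mul ?_ (hA₁ _) (norm_nonneg _) hB0)
          (mul_le_mul ?_ (hA₀ _) (norm_nonneg _) hB0)
        · exact isDecayKernel_greenKernel.abs_lagrangeOp_le le_rfl hs.1.2.le ξ
        · exact isDecayKernel_greenKernelDeriv.abs_lagrangeOp_le le_rfl hs.1.2.le ξ
      calc _ ≤ Real.exp R * |m ξ| * (B * A₁ + B * A₀) := by
            gcongr
            exact le_rfl
        _ = _ := by ring
    · have := hfar s hs.1.2 hs.2 ξ hξ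
      rw [indicator_of_notMem hξ, hz _ this, hz' _ this]
      simp
  · have h1 := (BoundedContinuousFunction.evalCLM ℝ ξ).hasFDerivAt.comp_hasDerivAt s (ha s hs.1.1)
    have h2 : HasDerivAt (fun s => Real.exp (-a s ξ))
      (Real.exp (-a s ξ) * -lagrangeField m (a s) ξ) s := HasDerivAt.exp (HasDerivAt.neg h1)
    have h3 : HasDerivAt (fun s => η (q s ξ))
      (deriv η (q s ξ) * lagrangeOp greenKernel m (a s) ξ) s :=
      HasDerivAt.comp s ((contDiff_infty_iff_deriv.1 hη).1 (q s ξ)).hasDerivAt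
        (hasDerivAt_flowIso_time ha hs.1.1 ξ)
    have h4 := (h2.mul_const (m ξ)).fun_mul h3
    exact h4.congr_deriv (by ring)

/-- The squared norm is the integral of exp(-3a) m², continuous by dominated convergence, and
pairings with test functions are even differentiable. -/
theorem continuousAt_momentum (ha : ∀ t ∈ Ioo (-δ) δ, HasDerivAt a (lagrangeField m (a t)) t)
    {t : ℝ} (ht : t ∈ Ioo (-δ) δ) : ContinuousAt (momentum m a) t := by
  refine tendsto_of_norm_of_inner (Lp.dense_hasCompactSupport_contDiff (F := ℝ) (E := ℝ)
    (μ := volume) (p := 2) (by norm_num)) ?_ ?_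
  · simp only [momentum, norm_push_sq]
    have hs : ∀ᶠ s in 𝓝 t, ‖a s‖ < ‖a t‖ + 1 :=
      (ha t ht).continuousAt.norm.eventually (gt_mem_nhds (by linarith))
    refine continuousAt_of_dominated (bound := fun ξ => Real.exp (3 * (‖a t‖ + 1)) * m ξ ^ 2)
      (Eventually.of_forall fun s => (integrable_exp_mul_sq m (a s) (-3)).aestronglyMeasurable) ?_
      ((L2.integrable_sq m).const_mul _) (Eventually.of_forall fun ξ => ?_)
    · filter_upwards [hs] with s hs
      refine Eventually.of_forall fun ξ => ?_
      rw [norm_mul, Real.norm_eq_abs, Real.abs_exp, Real.norm_of_nonneg (sq_nonneg _)]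
      refine mul_le_mul_of_nonneg_right (Real.exp_le_exp.2 ?_) (sq_nonneg _)
      linarith [(abs_le.1 (Cb.abs_le hs.le ξ)).1]
    · have h1 : ContinuousAt (fun s => a s ξ) t :=
        (BoundedContinuousFunction.evalCLM ℝ ξ).continuous.continuousAt.comp (ha t ht).continuousAt
      fun_prop
  · rintro e ⟨η, he, hc, hη⟩
    have h1 := (hasDerivAt_integral_momentum ha ht hη hc).continuousAt
    have h2 : (fun s => inner ℝ (momentum m a s) e) = fun s => ∫ y, momentum m a s y * η y :=
      funext fun s => inner_eq_integral_test he _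
    rwa [h2]

/-- Only scalar pairings are known to be differentiable. The H¹-valued integral `W` of the
continuous field has the required derivative, and it coincides with v because its pairings with test
functions have the same derivatives and initial values. -/
theorem hasDerivAt_resolvent_momentum
    (ha : ∀ t ∈ Ioo (-δ) δ, HasDerivAt a (lagrangeField m (a t)) t)
    {t : ℝ} (ht : t ∈ Ioo (-δ) δ) :
    HasDerivAt (fun s => resolvent (momentum m a s)) (vField (momentum m a t)) t := by
  have h0 : (0 : ℝ) ∈ Ioo (-δ) δ := by
    have : -δ < δ := ht.1.trans ht.2
    constructor <;> linarith
  have hc : ContinuousOn (fun s => vField (momentum m a s)) (Ioo (-δ) δ) :=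
    continuous_vField.comp_continuousOn fun s hs =>
      (continuousAt_momentum ha hs).continuousWithinAt
  set W : ℝ → H1 := fun t => resolvent (momentum m a 0) +
    ∫ s in (0 : ℝ)..t, vField (momentum m a s) with hW
  have : SecondCountableTopologyEither ℝ H1 := secondCountableTopologyEither_of_left ℝ H1
  have hWd : ∀ s ∈ Ioo (-δ) δ, HasDerivAt W (vField (momentum m a s)) s := fun s hs =>
    (intervalIntegral.integral_hasDerivAt_right
      ((hc.mono (ordConnected_Ioo.uIcc_subset h0 hs)).intervalIntegrable)
      (hc.stronglyMeasurableAtFilter isOpen_Ioo s hs)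
      (hc.continuousAt (isOpen_Ioo.mem_nhds hs))).const_add _
  have hE : ∀ s ∈ Ioo (-δ) δ, resolvent (momentum m a s) = W s := by
    intro s hs
    refine H1.eq_of_inner_test fun η e hη hcs e0 e1 => ?_
    have hd : ∀ r ∈ Ioo (-δ) δ, HasDerivAt
        (fun r => inner ℝ (resolvent (momentum m a r)) e - inner ℝ (W r) e) 0 r := by
      intro r hr
      have h1 := hasDerivAt_integral_momentum ha hr hη hcs
      have h2 : (fun s => ∫ y, momentum m a s y * η y) =
          fun s => inner ℝ (resolvent (momentum m a s)) e := funext fun s => by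
        rw [inner_resolvent, inner_eq_integral_test e0]
      have h3 : ∫ y, momentum m a r y * ((resolvent (momentum m a r)).rep y * deriv η y -
          (resolventX (momentum m a r)).rep y * η y) = inner ℝ (vField (momentum m a r)) e := by
        rw [inner_vField, inner_eq_integral_test e0, inner_eq_integral_test e1,
          ← integral_sub (L2.integrable_test _ (contDiff_deriv hη).continuous hcs.deriv)
            (L2.integrable_test _ hη.continuous hcs)]
        refine integral_congr_ae ?_
        filter_upwards [H1.mulL_ae (resolvent (momentum m a r)) (momentum m a r),
          H1.mulL_ae (resolventX (momentum m a r)) (momentum m a r)] with y h4 h5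
        rw [h4, h5]; ring
      rw [h2, h3] at h1
      have h4 := (hWd r hr).inner ℝ (hasDerivAt_const r e)
      rw [inner_zero_right, zero_add] at h4
      exact (h1.fun_sub h4).congr_deriv (sub_self _)
    have := isOpen_Ioo.is_const_of_deriv_eq_zero isPreconnected_Ioo
      (fun r hr => (hd r hr).differentiableAt.differentiableWithinAt)
      (fun r hr => (hd r hr).deriv) hs h0
    have hW0 : W 0 = resolvent (momentum m a 0) := by simp [hW]
    rw [hW0, sub_self] at this
    linarith
  refine (hWd t ht).congr_of_eventuallyEq ?_
  filter_upwards [isOpen_Ioo.mem_nhds ht] with s hs using hE s hs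

end Time

/-! ### Local solutions, continuation and the maximal solution -/

/-- Local existence, with an existence time that depends only on the norm of the initial value. -/
theorem exists_local_solution (M : ℝ) :
    ∃ τ : ℝ, 0 < τ ∧ ∀ u₀ : Sobolev 4, ‖u₀‖ ≤ M → ∃ u, IsSolution u₀ (τ : EReal) u := by
  obtain ⟨δ, hδ, h⟩ := exists_lagrange_solution (‖Sobolev.mL‖ * M)
  refine ⟨δ, hδ, fun u₀ hu₀ => ?_⟩
  obtain ⟨a, ha0, ha⟩ := h u₀.m ((Sobolev.mL.le_opNorm u₀).trans (by gcongr))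
  have hI : ∀ t ∈ timeInterval (δ : EReal), t ∈ Ioo (-δ) δ := fun t ht =>
    ⟨by linarith [ht.1], EReal.coe_lt_coe_iff.1 ht.2⟩
  have hm : ∀ t ∈ timeInterval (δ : EReal), ContinuousAt (momentum u₀.m a) t := fun t ht =>
    continuousAt_momentum ha (hI t ht)
  refine ⟨fun t => resolventSq (momentum u₀.m a t), ?_, fun t ht =>
    (resolventSq.continuous.continuousAt.comp (hm t ht)).continuousWithinAt,
    fun t => resolventLift (vField (momentum u₀.m a t)), fun t ht =>
    ((resolventLift.continuous.comp continuous_vField).continuousAt.comp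
      (hm t ht)).continuousWithinAt, fun t ht => ⟨?_, ?_⟩⟩
  · simp only [momentum_zero ha0, resolventSq_m]
  · simp only [incl_resolventSq]
    exact (resolventLift.hasFDerivAt.comp_hasDerivAt t
      (hasDerivAt_resolvent_momentum ha (hI t ht))).hasDerivWithinAt
  · rw [satisfiesEquation_iff, wH_resolventLift]
    exact vEquation_vField _

theorem Sobolev.wH_injective : Function.Injective Sobolev.wH := by
  rw [injective_iff_map_eq_zero]
  intro U h
  apply Sobolev.eq_zero
  have w0 : IsWeakDeriv (U.d 0) (U.d 1) := U.2 0
  have w1 : IsWeakDeriv (U.d 1) (U.d 2) := U.2 1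
  have h1 : inner ℝ (U.d 1) (U.d 1) + inner ℝ (U.d 0) (U.d 2) = 0 :=
    H1.inner_by_parts (H1.mk _ _ w0) (H1.mk _ _ w1)
  have h2 : U.d 0 - U.d 2 = 0 := by
    rw [← Sobolev.wH_d_zero, h]; rfl
  rw [sub_eq_zero] at h2
  rw [← h2, real_inner_self_eq_norm_sq, real_inner_self_eq_norm_sq] at h1
  have : ‖U.d 0‖ = 0 := by nlinarith [sq_nonneg ‖U.d 0‖, sq_nonneg ‖U.d 1‖]
  exact norm_eq_zero.1 this

theorem Sobolev.continuous_m : Continuous Sobolev.m := Sobolev.mL.continuous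

/-- The equation at time `t`, as an evolution equation in `H³`. -/
def SolvesAt (u : ℝ → Sobolev 4) (t : ℝ) : Prop :=
  ContinuousWithinAt u (Ici 0) t ∧
    HasDerivWithinAt (fun s => (u s).incl) (resolventLift (vField (u t).m)) (Ici 0) t

/-- At each time the equation determines u_t as a continuous function of u in H⁴, so u_t can be
eliminated from the notion of solution. -/
theorem satisfiesEquation_iff_eq (U : Sobolev 4) (ut : Sobolev 3) :
    SatisfiesEquation U ut ↔ ut = resolventLift (vField U.m) := by
  have h : VEquation U (vField U.m) := by
    have := vEquation_vField U.m
    rwa [resolventSq_m] at this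
  rw [satisfiesEquation_iff]
  constructor
  · intro h'
    apply Sobolev.wH_injective
    rw [wH_resolventLift]
    exact h'.unique h
  · rintro rfl
    rwa [wH_resolventLift]

theorem nhdsWithin_timeInterval_eq {T : EReal} {t : ℝ} (ht : t ∈ timeInterval T) :
    𝓝[timeInterval T] t = 𝓝[Ici 0] t := by
  have : {s : ℝ | (s : EReal) < T} ∈ 𝓝 t :=
    (isOpen_Iio.preimage continuous_coe_real_ereal).mem_nhds ht.2
  have h : timeInterval T = Ici 0 ∩ {s : ℝ | (s : EReal) < T} := rfl
  rw [h, nhdsWithin_inter_of_mem' (mem_nhdsWithin_of_mem_nhds this)]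

/-- Being a solution is a condition on the germ of u at each time, continuity of u_t being
automatic. Restriction, translation and gluing thereby become local statements. -/
theorem isSolution_iff {u₀ : Sobolev 4} {T : EReal} {u : ℝ → Sobolev 4} :
    IsSolution u₀ T u ↔ u 0 = u₀ ∧ ∀ t ∈ timeInterval T, SolvesAt u t := by
  have hc : ∀ t ∈ timeInterval T,
      (ContinuousWithinAt u (timeInterval T) t ↔ ContinuousWithinAt u (Ici 0) t) := fun t ht => by
    rw [ContinuousWithinAt, nhdsWithin_timeInterval_eq ht]; rfl
  have hd : ∀ t ∈ timeInterval T, ∀ f' : Sobolev 3,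
      (HasDerivWithinAt (fun s => (u s).incl) f' (timeInterval T) t ↔
        HasDerivWithinAt (fun s => (u s).incl) f' (Ici 0) t) := fun t ht f' => by
    have h1 : timeInterval T ⊆ Ici 0 := fun s hs => hs.1
    refine ⟨fun h => h.mono_of_mem_nhdsWithin ?_, fun h => h.mono h1⟩
    rw [← nhdsWithin_timeInterval_eq ht]
    exact self_mem_nhdsWithin
  constructor
  · rintro ⟨h0, huc, ut, -, hut⟩
    refine ⟨h0, fun t ht => ⟨(hc t ht).1 (huc t ht), ?_⟩⟩
    obtain ⟨h1, h2⟩ := hut t ht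
    rw [satisfiesEquation_iff_eq] at h2
    rw [← h2]
    exact (hd t ht _).1 h1
  · rintro ⟨h0, h⟩
    have huc : ContinuousOn u (timeInterval T) := fun t ht => (hc t ht).2 (h t ht).1
    refine ⟨h0, huc, fun t => resolventLift (vField (u t).m), ?_, fun t ht =>
      ⟨(hd t ht _).2 (h t ht).2, (satisfiesEquation_iff_eq _ _).2 rfl⟩⟩
    exact (resolventLift.continuous.comp (continuous_vField.comp
      Sobolev.continuous_m)).comp_continuousOn huc

theorem SolvesAt.congr {u w : ℝ → Sobolev 4} {t : ℝ} (h : SolvesAt u t) (ht : 0 ≤ t)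
    (huw : ∀ᶠ s in 𝓝[Ici 0] t, w s = u s) : SolvesAt w t := by
  have e : w t = u t := huw.self_of_nhdsWithin ht
  refine ⟨h.1.congr_of_eventuallyEq huw e, ?_⟩
  rw [e]
  exact h.2.congr_of_eventuallyEq (huw.mono fun s hs => by simp only [hs]) (by simp only [e])

theorem SolvesAt.comp_add_const {u : ℝ → Sobolev 4} {t s : ℝ} (h : SolvesAt u (t + s))
    (hmap : ∀ᶠ x in 𝓝[Ici 0] t, 0 ≤ x + s) : SolvesAt (fun x => u (x + s)) t := by
  have hd : HasDerivWithinAt (fun x : ℝ => x + s) 1 {x | 0 ≤ x + s} t :=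
    (hasDerivWithinAt_id t _).add_const s
  constructor
  · exact ContinuousWithinAt.mono_of_mem_nhdsWithin
      (h.1.comp (t := Ici 0) (s := {x | 0 ≤ x + s}) hd.continuousWithinAt fun x hx => hx) hmap
  · have := HasDerivWithinAt.scomp (t' := Ici 0) t h.2 hd fun x hx => hx
    rw [one_smul] at this
    exact this.mono_of_mem_nhdsWithin hmap

theorem IsSolution.mono {u₀ : Sobolev 4} {T T' : EReal} {u : ℝ → Sobolev 4}
    (h : IsSolution u₀ T u) (hT : T' ≤ T) : IsSolution u₀ T' u := by
  rw [isSolution_iff] at h ⊢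
  exact ⟨h.1, fun t ht => h.2 t ⟨ht.1, ht.2.trans_le hT⟩⟩

theorem IsSolution.comp_add_const {u₀ : Sobolev 4} {T t₁ : ℝ} {u : ℝ → Sobolev 4}
    (h : IsSolution u₀ T u) (h0 : 0 ≤ t₁) :
    IsSolution (u t₁) ((T - t₁ : ℝ) : EReal) (fun t => u (t + t₁)) := by
  rw [isSolution_iff] at h ⊢
  refine ⟨by simp only [zero_add], fun t ht => ?_⟩
  have ht' : t < T - t₁ := EReal.coe_lt_coe_iff.1 ht.2
  refine (h.2 (t + t₁) ⟨add_nonneg ht.1 h0,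
    EReal.coe_lt_coe_iff.2 (by linarith)⟩).comp_add_const ?_
  filter_upwards [self_mem_nhdsWithin] with x hx using add_nonneg hx h0

/-- A solution can be continued by a solution that starts from one of its values. -/
theorem IsSolution.glue {u₀ : Sobolev 4} {T t₁ τ : ℝ} {u w : ℝ → Sobolev 4}
    (hu : IsSolution u₀ T u) (h0 : 0 ≤ t₁) (h1 : t₁ < T) (hw : IsSolution (u t₁) τ w) :
    ∃ u', IsSolution u₀ ((t₁ + τ : ℝ) : EReal) u' := by
  have hE : ∀ s, t₁ ≤ s → s < T → s < t₁ + τ → u s = w (s - t₁) := fun s hs hsT hsτ => by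
    have := (hu.comp_add_const h0).unique hw (t := s - t₁)
      ⟨by linarith, EReal.coe_lt_coe_iff.2 (by linarith)⟩
      ⟨by linarith, EReal.coe_lt_coe_iff.2 (by linarith)⟩
    simpa only [sub_add_cancel] using this
  rw [isSolution_iff] at hu hw
  -- The pieces agree on the overlap after `t₁` by uniqueness, so at any time t ≥ T the glued curve
  -- equals the shifted `w` on a whole neighbourhood, including times before `T`.
  refine ⟨fun s => if s < T then u s else w (s - t₁), isSolution_iff.2 ⟨?_, fun t ht => ?_⟩⟩
  · rw [if_pos (h0.trans_lt h1), hu.1]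
  have htτ : t < t₁ + τ := EReal.coe_lt_coe_iff.1 ht.2
  rcases lt_or_ge t T with htT | htT
  · refine (hu.2 t ⟨ht.1, EReal.coe_lt_coe_iff.2 htT⟩).congr ht.1 ?_
    filter_upwards [mem_nhdsWithin_of_mem_nhds (Iio_mem_nhds htT)] with s hs using if_pos hs
  · have ht1 : t₁ < t := h1.trans_le htT
    have hw' : SolvesAt (fun s => w (s + -t₁)) t :=
      (hw.2 (t + -t₁) ⟨by linarith, EReal.coe_lt_coe_iff.2 (by linarith)⟩).comp_add_const (by
        filter_upwards [mem_nhdsWithin_of_mem_nhds (Ioi_mem_nhds ht1)] with s hs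
        have : t₁ < s := hs
        linarith)
    refine hw'.congr ht.1 ?_
    filter_upwards [mem_nhdsWithin_of_mem_nhds (Ioo_mem_nhds ht1 htτ)] with s hs
    simp only [← sub_eq_add_neg]
    split_ifs with h
    · exact hE s hs.1.le h hs.2
    · rfl

/-- The lengths of the intervals on which there is a solution. -/
def existenceTimes (u₀ : Sobolev 4) : Set ℝ := {T | 0 < T ∧ ∃ u, IsSolution u₀ (T : EReal) u}

theorem existenceTimes_nonempty (u₀ : Sobolev 4) : (existenceTimes u₀).Nonempty := by
  obtain ⟨τ, hτ, h⟩ := exists_local_solution ‖u₀‖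
  exact ⟨τ, hτ, h u₀ le_rfl⟩

/-- At each time take the value of some solution that lives longer. By uniqueness this agrees near
that time with one genuine solution. A solution lasting beyond the supremum would restrict to one on
a real interval longer than the supremum. -/
theorem exists_isMaximalSolution {u₀ : Sobolev 4} (hb : BddAbove (existenceTimes u₀)) :
    ∃ u, IsMaximalSolution u₀ ((sSup (existenceTimes u₀) : ℝ) : EReal) u := by
  classical
  set T := sSup (existenceTimes u₀) with hT
  have hT0 : 0 < T := by
    obtain ⟨r, hr⟩ := existenceTimes_nonempty u₀
    exact hr.1.trans_le (le_csSup hb hr)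
  have hex : ∀ t ∈ timeInterval (T : EReal), ∃ u, ∃ r : ℝ,
      IsSolution u₀ (r : EReal) u ∧ t < r := fun t ht => by
    obtain ⟨r, ⟨-, u, hu⟩, htr⟩ :=
      exists_lt_of_lt_csSup (existenceTimes_nonempty u₀) (EReal.coe_lt_coe_iff.1 ht.2)
    exact ⟨u, r, hu, htr⟩
  choose! v r hv hr using hex
  set U : ℝ → Sobolev 4 := fun t => v t t with hU
  have hUeq : ∀ (T' : EReal) (w : ℝ → Sobolev 4), IsSolution u₀ T' w →
      ∀ t ∈ timeInterval T', t ∈ timeInterval (T : EReal) → w t = U t := fun T' w hw t ht ht' =>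
    hw.unique (hv t ht') ht ⟨ht.1, EReal.coe_lt_coe_iff.2 (hr t ht')⟩
  have h0 : (0 : ℝ) ∈ timeInterval (T : EReal) := ⟨le_rfl, EReal.coe_lt_coe_iff.2 hT0⟩
  refine ⟨U, EReal.coe_pos.2 hT0, isSolution_iff.2 ⟨(hv 0 h0).1, fun t ht => ?_⟩,
    fun T' w hw => ?_⟩
  · refine ((isSolution_iff.1 (hv t ht)).2 t
      ⟨ht.1, EReal.coe_lt_coe_iff.2 (hr t ht)⟩).congr ht.1 ?_
    filter_upwards [self_mem_nhdsWithin, mem_nhdsWithin_of_mem_nhds (Iio_mem_nhds (hr t ht)),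
      mem_nhdsWithin_of_mem_nhds (Iio_mem_nhds (EReal.coe_lt_coe_iff.1 ht.2))] with s hs0 hsr hsT
    exact (hUeq _ _ (hv t ht) s ⟨hs0, EReal.coe_lt_coe_iff.2 hsr⟩
      ⟨hs0, EReal.coe_lt_coe_iff.2 hsT⟩).symm
  · have hle : T' ≤ T := by
      by_contra! hlt
      obtain ⟨q, hq, hq'⟩ := EReal.lt_iff_exists_real_btwn.1 hlt
      have hTq : T < q := EReal.coe_lt_coe_iff.1 hq
      exact hTq.not_ge (le_csSup hb ⟨hT0.trans hTq, w, hw.mono hq'.le⟩)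
    exact ⟨hle, fun t ht => hUeq T' w hw t ht ⟨ht.1, ht.2.trans_le hle⟩⟩

/-- If the norm were below `M` at a time within `τ` of `T`, where `τ` is the existence time for data
bounded by `M`, restarting there would give a solution past `T`. -/
theorem IsMaximalSolution.tendsto_norm {u₀ : Sobolev 4} {T : ℝ} {u : ℝ → Sobolev 4}
    (h : IsMaximalSolution u₀ (T : EReal) u) : Tendsto (fun t => ‖u t‖) (𝓝[<] T) atTop := by
  refine tendsto_atTop.2 fun M => ?_
  obtain ⟨τ, hτ, hM⟩ := exists_local_solution M
  have hT : 0 < T := EReal.coe_pos.1 h.1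
  filter_upwards [Ioo_mem_nhdsLT (max_lt hT (sub_lt_self T hτ))] with t ht
  by_contra! hlt
  obtain ⟨w, hw⟩ := hM (u t) hlt.le
  obtain ⟨u', hu'⟩ := h.2.1.glue ((le_max_left _ _).trans ht.1.le) ht.2 hw
  have h1 := EReal.coe_le_coe_iff.1 (h.2.2 _ _ hu').1
  linarith [(le_max_right 0 (T - τ)).trans_lt ht.1]

theorem existenceTimes_le {u₀ : Sobolev 4} {x₀ : ℝ} (h : u₀.vxRep x₀ < -(u₀.E₀ / √2)) {T : ℝ}
    (hT : T ∈ existenceTimes u₀) :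
    T ≤ 1 / (-(1 / 2) * u₀.vxRep x₀ + u₀.E₀ ^ 2 / (4 * u₀.vxRep x₀)) := by
  obtain ⟨hT0, u, hu⟩ := hT
  -- The bound is known only for times at which the solution exists, so it is passed to the
  -- endpoint. For negative `b` it follows from the bound at time 0.
  refine le_of_forall_lt_imp_le_of_dense fun b hb => ?_
  rcases lt_or_ge b 0 with hb0 | hb0
  · exact hb0.le.trans (hu.le_lifespan (b := 0) ⟨le_rfl, EReal.coe_lt_coe_iff.2 hT0⟩ h)
  · exact hu.le_lifespan ⟨hb0, EReal.coe_lt_coe_iff.2 hb⟩ h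

/-- As E²/φ ≤ 0, the denominator with 2 is the smaller one; it is positive because φ < -E gives E²/φ
> φ. -/
theorem lifespan_bound_le {φ E : ℝ} (hE : 0 ≤ E) (h : φ < -E) :
    1 / (-(1 / 2) * φ + E ^ 2 / (4 * φ)) ≤ 1 / (-(1 / 2) * φ + E ^ 2 / (2 * φ)) := by
  have hφ : φ < 0 := by linarith
  have e1 : E ^ 2 / (2 * φ) = E ^ 2 / φ / 2 := by rw [div_div, mul_comm]
  have e2 : E ^ 2 / (4 * φ) = E ^ 2 / φ / 4 := by rw [div_div, mul_comm]
  have h1 : E ^ 2 / φ ≤ 0 := div_nonpos_of_nonneg_of_nonpos (sq_nonneg E) hφ.le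
  have h2 : φ < E ^ 2 / φ := by
    rw [lt_div_iff_of_neg hφ]
    nlinarith
  rw [e1, e2]
  exact one_div_le_one_div_of_le (by linarith) (by linarith)

end CHType
end

theorem mainTheorem5 (u₀ : CHType.Sobolev 4) (x₀ : ℝ)
    (h : u₀.vxRep x₀ < -(u₀.E₀ / √2)) :
    ∃ (T : ℝ) (u : ℝ → CHType.Sobolev 4),
      CHType.IsMaximalSolution u₀ (T : EReal) u ∧
      Tendsto (fun t => ‖u t‖) (𝓝[<] T) atTop ∧
      T ≤ 1 / (-(1 / 2) * u₀.vxRep x₀ + u₀.E₀ ^ 2 / (4 * u₀.vxRep x₀)) ∧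
      (u₀.vxRep x₀ < -u₀.E₀ →
        T ≤ 1 / (-(1 / 2) * u₀.vxRep x₀ + u₀.E₀ ^ 2 / (2 * u₀.vxRep x₀))) := by
  have hle := fun T => CHType.existenceTimes_le h (T := T)
  obtain ⟨u, hu⟩ := CHType.exists_isMaximalSolution ⟨_, hle⟩
  have hT := csSup_le (CHType.existenceTimes_nonempty u₀) hle
  exact ⟨_, u, hu, hu.tendsto_norm, hT, fun h' =>
    hT.trans (CHType.lifespan_bound_le (Real.sqrt_nonneg _) h')⟩
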